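/- **Conventions.** All C*-algebras are finite-dimensional and unital, and sub-C*-algebras contain the unit. $\omega$ is a factor, i.e. a C*-algebra whose centre is $\mathbb C\,\mathrm{id}$. For sub-C*-algebras of $\omega$, $\mathcal F'$ is the commutant of $\mathcal F$ in $\omega$, $\mathcal Z(\mathcal F)=\mathcal F\cap\mathcal F'$ its centre, $\mathcal F\vee\mathcal G$ the algebra generated by $\mathcal F$ and $\mathcal G$. We write $(\mathcal F_1,\mathcal F_2)\vdash\mathcal G$ if $\mathcal F_1,\mathcal F_2\subseteq\mathcal G$ and, for every atomic (nonzero minimal) orthogonal projector $\pi$ of $\mathcal Z(\mathcal G)$, $\pi\mathcal F_1$ and $\pi\mathcal F_2$ are each other's commutants within $\pi\mathcal G$. We write $\mathcal F\perp\mathcal G$ if $fg=0$ with $f\in\mathcal F$, $g\in\mathcal G$ implies $f=0$ or $g=0$. On the circle $\mathbb Q/N\mathbb Z$ of circumference $N$, with its usual distance $d$, let $\Gamma_N=\{0,1,\dots,N-1\}$, $\Gamma_N^{+1/2}=\Gamma_N+\frac12$ and $\Gamma_N^{\mathrm{fine}}=\{n\pm\frac14 : n\in\Gamma_N\}$, each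 with its cyclic order. For a subset $S$ of one of these sets, $S\pm\rho$ is the set of the vertices $x$ (of whichever of the three sets is relevant) with $d(x,s)\le\rho$ for some $s\in S$; $\overline S$ is the complement of $S$. A *1D partition* $(\mathcal A_S)_{S\subseteq\Gamma}\vdash\omega$ over one of these vertex sets $\Gamma$ assigns to each $S\subseteq\Gamma$ a sub-C*-algebra $\mathcal A_S\subseteq\omega$ with $\mathcal A_\emptyset=\mathbb C\,\mathrm{id}$, $\mathcal A_\Gamma=\omega$, and $(\mathcal A_S,\mathcal A_T)\vdash\mathcal A_{S\sqcup T}$ for all disjoint $S,T$. It is *strongly connected* if for every nonempty interval $\llbracket m,n\rrbracket\neq\Gamma$ one has $\mathcal Z(\mathcal A_{\llbracket m,n\rrbracket})=(\mathcal Z_{m^-}\cap\mathcal Z_m)\vee(\mathcal Z_n\cap\mathcal Z_{n^+})$, where $\mathcal Z_x=\mathcal Z(\mathcal A_{\{x\}})$, $m^-$ is the vertex preceding $m$ and $n^+$ the vertex following $n$. It has *correlation length at most $l$* if $\mathcal A_S\perp\mathcal A_{\overline{S\pm l}}$ for all $S\subseteq\Gamma$. **Theorem (fine-graining).** Let $N$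 be a natural number and let $r>0$ be a natural number or half a natural number. Put $\Gamma=\Gamma_N$ if $r$ is an integer, and $\Gamma=\Gamma_N^{+1/2}$ otherwise. Let $(\mathcal A_S)_{S\subseteq\Gamma_N}$ and $(\mathcal B_S)_{S\subseteq\Gamma}$ be strongly connected 1D partitions of the factor $\omega$, of correlation length at most $l_A\in\mathbb N$ and $l_B\in\mathbb N$ respectively, such that $$\forall S\subseteq\Gamma_N,\quad \mathcal A_S\subseteq\mathcal B_{S\pm r}.$$ If $N\ge 4r+2(l_A+l_B)+1$, then there is a strongly connected 1D partition $(\tilde{\mathcal A}_S)_{S\subseteq\Gamma_N^{\mathrm{fine}}}\vdash\omega$, with correlation length at most $l_A+\frac12$, such that $$\forall S\subseteq\Gamma_N,\quad \mathcal A_S=\tilde{\mathcal A}_{S\pm\frac14},\qquad\text{and}\qquad \forall S\subseteq\Gamma_N^{\mathrm{fine}},\quad \tilde{\mathcal A}_S\subseteq\mathcal B_{S\pm(r-\frac14)}.$$ -/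

import Mathlib

namespace QPartition

section Algebra

variable {Ω : Type*} [CStarAlgebra Ω]

/-- The centre `F ∩ F'` of a unital star-subalgebra `F`. In a finite-dimensional C*-algebra the
unital star-subalgebras are exactly the unital sub-C*-algebras. -/
def centre (F : StarSubalgebra ℂ Ω) : StarSubalgebra ℂ Ω :=
  F ⊓ StarSubalgebra.centralizer ℂ (F : Set Ω)

/-- `p` is an atomic projector of `Z`: a nonzero orthogonal projector in `Z` that dominates no
projector of `Z` other than `0` and itself. -/
structure IsAtomProj (Z : StarSubalgebra ℂ Ω) (p : Ω) : Prop where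
  mem : p ∈ Z
  proj : IsStarProjection p
  ne_zero : p ≠ 0
  minimal : ∀ q ∈ Z, IsStarProjection q → p * q = q → q = 0 ∨ q = p

/-- The set `p F = {p f | f ∈ F}`. -/
def compress (p : Ω) (F : StarSubalgebra ℂ Ω) : Set Ω := {x | ∃ f ∈ F, x = p * f}

/-- `(F₁, F₂) ⊢ G`: in each block `p G` of `G` (`p` an atomic projector of the centre of `G`),
the algebras `p F₁` and `p F₂` are the commutants of each other. -/
structure IsBipartition (F₁ F₂ G : StarSubalgebra ℂ Ω) : Prop where
  le_left : F₁ ≤ G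
  le_right : F₂ ≤ G
  right_eq : ∀ p, IsAtomProj (centre G) p →
    compress p F₂ = {x ∈ compress p G | ∀ y ∈ compress p F₁, x * y = y * x}
  left_eq : ∀ p, IsAtomProj (centre G) p →
    compress p F₁ = {x ∈ compress p G | ∀ y ∈ compress p F₂, x * y = y * x}

/-- `A` is a partition of `Ω` with parts labelled by `V`. -/
structure IsPartition {V : Type*} (A : Set V → StarSubalgebra ℂ Ω) : Prop where
  empty : A ∅ = ⊥
  univ : A Set.univ = ⊤
  bipartition : ∀ S T : Set V, Disjoint S T → IsBipartition (A S) (A T) (A (S ∪ T))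

/-- `F ⊥ G`: a product of nonzero elements of `F` and `G` is nonzero. (For commuting `F` and `G`
this says that the product map `F ⊗ G → Ω` is injective.) -/
def Uncorrelated (F G : StarSubalgebra ℂ Ω) : Prop :=
  ∀ f ∈ F, ∀ g ∈ G, f * g = 0 → f = 0 ∨ g = 0

end Algebra

/-- The C*-algebra `Ω` is a factor: its centre consists of the multiples of the identity. -/
def IsFactor (Ω : Type*) [CStarAlgebra Ω] : Prop :=
  centre (⊤ : StarSubalgebra ℂ Ω) = ⊥

section Cycle

/-- The interval `⟦m, m + k⟧ = {m, m + 1, …, m + k}` of the cycle `ZMod M`. -/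
def arc {M : ℕ} (m : ZMod M) (k : ℕ) : Set (ZMod M) := {x | ∃ i : ℕ, i ≤ k ∧ x = m + i}

/-- Position of the vertex with label `n` on the circle of circumference `N`, for the cycle of `N`
vertices `δ, 1 + δ, …, N - 1 + δ`: this is `Γ_N` for `δ = 0`, and `Γ_N^{+1/2}` for `δ = 1/2`. -/
def pos (N : ℕ) (δ : ℚ) (n : ZMod N) : ℚ := (n.val : ℚ) + δ

/-- Position of the vertex with label `k` on the circle of circumference `N`, for the cycle
`Γ_N^fine` of `2 N` vertices `1/4, 3/4, 5/4, …, N - 1/4`. -/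
def finePos (N : ℕ) (k : ZMod (2 * N)) : ℚ := (k.val : ℚ) / 2 + 1 / 4

/-- `S ± ρ`, for a set `S` of vertices with positions `p`, as a set of vertices with
positions `q`: the vertices at distance at most `ρ` from `S` on the circle of circumference `N`. -/
def thicken (N : ℕ) {V W : Type*} (p : V → ℚ) (q : W → ℚ) (ρ : ℚ) (S : Set V) : Set W :=
  {w | ∃ v ∈ S, ∃ k : ℤ, |q w - p v - k * N| ≤ ρ}

variable {Ω : Type*} [CStarAlgebra Ω]

/-- `A` has correlation length at most `l`: for every `S`, the algebras of `S` and of the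
complement of `S ± l` are uncorrelated. -/
def CorrelationLengthLE (N : ℕ) {V : Type*} (p : V → ℚ) (A : Set V → StarSubalgebra ℂ Ω)
    (l : ℚ) : Prop :=
  ∀ S : Set V, Uncorrelated (A S) (A (thicken N p p l S)ᶜ)

/-- A partition over the cycle `ZMod M` is strongly connected if the centre of the algebra of each
proper nonempty interval `⟦m, n⟧` is `(Z_{m-1} ∩ Z_m) ∨ (Z_n ∩ Z_{n+1})`. -/
structure IsStronglyConnectedPartition {M : ℕ} (A : Set (ZMod M) → StarSubalgebra ℂ Ω) : Prop where
  isPartition : IsPartition A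
  centre_arc : ∀ (m : ZMod M) (k : ℕ), k + 1 < M →
    centre (A (arc m k)) =
      (centre (A {m - 1}) ⊓ centre (A {m})) ⊔ (centre (A {m + k}) ⊓ centre (A {m + k + 1}))

end Cycle

end QPartition

/-! A strongly connected partition over a cycle is governed by the algebras of its intervals,
indexed by the cuts bounding them, together with the centre shared by the two sides of each cut.
`CutSystem` axiomatises these data: complementary intervals are mutual commutants, and an element of
an interval commuting with both pieces of a subdivision lies in the algebra generated by the three
cut centres. Conversely, `part` turns a cut system into a partition. The problem becomes to draw a
new cut through every vertex of `A`.

Number the fine cuts by integers, the cut `k` at position `k / 2`: odd cuts are those of `A`, and an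
even cut `x` at first duplicates `x + 1`. Outside an interval from `x - 1` to `e`, the algebra of
`A` is contained in one of `B`. Taking commutants, the algebra `W` of `B` over the interval from `x
- 1 + R` to `e - R` (where `r = R / 2`) lies in that of `A` over the interval from `x - 1` to `e`.
Let `K` be generated by `W` and by `A` from `x + 1` to a distant cut `d₀`. It lies between the
algebras of `A` from `x + 1` and from `x - 1` to `d₀`, so `K` and its commutant describe a cut
inside the vertex. In `B`, `K` begins no earlier than `x + 1 - R`, while its commutant, which
commutes with `W`, ends no later than `x - 1 + R`. This is the gain of a quarter on each side.

On a circle `K` has a second end `d₀`, whose centre contaminates every computation. Multiplication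
by an atom of that centre makes it scalar, and nothing is lost if no nonzero element of the interval
in question is killed by the atom. Finite correlation length ensures this through `gluing`: pairwise
compatible atoms of three cuts are jointly compatible. The same principle identifies the
intersection of two interval algebras with the algebra of their overlap (`inf_le_of_uncorrelated`),
which localises the new intervals in `B`.

The algebra underneath is the double commutant theorem in a factor and the modular law `sup_inf_cm`.
`Splitting` records what is needed of `K`, `insert` shows that the axioms survive the replacement of
one cut, and `Refinement.exists_insert` is the step iterated over all even cuts. -/

open Module
-- The regular trace and the double commutant theorem.
namespace QPartition
variable {Ω : Type*} [CStarAlgebra Ω]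

/-- The trace of the left regular representation. -/
noncomputable def regTrace : Ω →ₗ[ℂ] ℂ := LinearMap.trace ℂ Ω ∘ₗ LinearMap.mul ℂ Ω

lemma regTrace_apply (x : Ω) : regTrace x = LinearMap.trace ℂ Ω (LinearMap.mulLeft ℂ x) := rfl

lemma regTrace_mul_comm (x y : Ω) : regTrace (x * y) = regTrace (y * x) := by
  simp only [regTrace_apply, LinearMap.mulLeft_mul]
  exact LinearMap.trace_mul_comm ℂ (LinearMap.mulLeft ℂ x) (LinearMap.mulLeft ℂ y)


section FiniteDimensional
variable [FiniteDimensional ℂ Ω]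

lemma mem_roots_charpoly_mulLeft {a : Ω} {μ : ℂ} :
    μ ∈ (LinearMap.mulLeft ℂ a).charpoly.roots ↔ μ ∈ spectrum ℂ a := by
  rw [Polynomial.mem_roots (LinearMap.charpoly_monic _).ne_zero,
    ← Module.End.mem_spectrum_iff_isRoot_charpoly]
  refine ⟨fun hμ => AlgHom.spectrum_apply_subset (Algebra.lmul ℂ Ω) a hμ, fun hμ => ?_⟩
  rw [spectrum.mem_iff] at hμ ⊢
  intro h
  apply hμ
  have e : (algebraMap ℂ (End ℂ Ω)) μ - LinearMap.mulLeft ℂ a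
      = LinearMap.mulLeft ℂ ((algebraMap ℂ Ω) μ - a) := by
    ext y; simp [sub_mul, Algebra.smul_def]
  rw [e, Module.End.isUnit_iff] at h
  obtain ⟨y, hy⟩ := h.2 1
  have hy' : ((algebraMap ℂ Ω) μ - a) * y = 1 := hy
  refine ⟨⟨_, y, hy', h.1 ?_⟩, rfl⟩
  simp only [LinearMap.mulLeft_apply]
  rw [← mul_assoc, hy', one_mul, mul_one]

lemma finite_spectrum (a : Ω) : (spectrum ℂ a).Finite :=
  ((LinearMap.mulLeft ℂ a).charpoly.roots.toFinset.finite_toSet).subset fun _ hμ => by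
    rw [Finset.mem_coe, Multiset.mem_toFinset]
    exact mem_roots_charpoly_mulLeft.2 hμ

/-- The trace is the sum, with multiplicity, of the points of a spectrum contained in the
nonnegative reals. If it vanishes, so does the spectral radius, which is the norm of a self-adjoint
element. -/
lemma eq_zero_of_regTrace_star_mul_self {x : Ω} (hx : regTrace (star x * x) = 0) : x = 0 := by
  set a := star x * x with ha
  have hsa : IsSelfAdjoint a := IsSelfAdjoint.star_mul_self x
  have hre : ∀ μ ∈ spectrum ℂ a, 0 ≤ μ.re ∧ μ = μ.re := by
    intro μ hμ
    have h1 := hsa.mem_spectrum_eq_re hμ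
    refine ⟨?_, h1⟩
    rw [h1, hsa.coe_mem_spectrum_complex] at hμ
    exact spectrum_star_mul_self_nonneg _ hμ
  rw [regTrace_apply, Module.End.trace_eq_sum_roots_charpoly_of_splits (IsAlgClosed.splits _)] at hx
  set s := (LinearMap.mulLeft ℂ a).charpoly.roots with hs
  have hroot : ∀ μ, μ ∈ s ↔ μ ∈ spectrum ℂ a := fun μ => mem_roots_charpoly_mulLeft
  have hsum : (s.map Complex.re).sum = 0 := by
    have := congrArg Complex.re hx
    rwa [show s.sum.re = (s.map Complex.re).sum from map_multiset_sum Complex.reAddGroupHom s] at this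
  have hz : ∀ μ ∈ spectrum ℂ a, μ = 0 := by
    intro μ hμ
    have h0 : ∀ t ∈ s.map Complex.re, (0:ℝ) ≤ t := by
      intro t ht
      obtain ⟨ν, hν, rfl⟩ := Multiset.mem_map.1 ht
      exact (hre ν ((hroot ν).1 hν)).1
    have h1 := Multiset.single_le_sum h0 μ.re (Multiset.mem_map_of_mem _ ((hroot μ).2 hμ))
    rw [(hre μ hμ).2, le_antisymm (hsum ▸ h1) (hre μ hμ).1]; simp
  have hr : spectralRadius ℂ a = 0 := by
    rw [spectralRadius, ← nonpos_iff_eq_zero]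
    exact iSup₂_le fun μ hμ => by simp [hz μ hμ]
  rw [hsa.spectralRadius_eq_nnnorm] at hr
  have : a = 0 := by simpa using hr
  exact CStarRing.star_mul_self_eq_zero_iff x |>.1 this

/-- The trace form is nondegenerate on `F` by faithfulness, so a basis and its dual basis serve. -/
lemma exists_dual_families (F : StarSubalgebra ℂ Ω) :
    ∃ (n : ℕ) (f g : Fin n → Ω), (∀ k, f k ∈ F) ∧ (∀ k, g k ∈ F) ∧
      (∀ y ∈ F, ∑ k, regTrace (g k * y) • f k = y) ∧
      (∀ y ∈ F, ∑ k, regTrace (f k * y) • g k = y) := by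
  let S : Submodule ℂ Ω := Subalgebra.toSubmodule F.toSubalgebra
  let β : LinearMap.BilinForm ℂ S :=
    LinearMap.mk₂ ℂ (fun x y => regTrace ((x : Ω) * (y : Ω)))
      (fun a b c => by simp [add_mul]) (fun r a b => by simp)
      (fun a b c => by simp [mul_add]) (fun r a b => by simp)
  have hβ : ∀ x y, β x y = regTrace ((x : Ω) * (y : Ω)) := fun _ _ => rfl
  have hsymm : β.IsSymm := ⟨fun x y => by simp [hβ, regTrace_mul_comm (x : Ω)]⟩
  have hsep : ∀ x : S, (∀ y, β x y = 0) → x = 0 := by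
    intro x h
    have h1 := h ⟨star (x : Ω), star_mem (S := StarSubalgebra ℂ Ω) x.2⟩
    rw [hβ, regTrace_mul_comm] at h1
    exact Subtype.ext (eq_zero_of_regTrace_star_mul_self h1)
  have hnd : β.Nondegenerate := ⟨hsep, fun x h => hsep x fun y => by
    have := h y
    rw [hβ] at this ⊢
    rw [regTrace_mul_comm, this]⟩
  let b := Module.finBasis ℂ S
  let b' := β.dualBasis hnd b
  refine ⟨_, fun k => (b k : Ω), fun k => (b' k : Ω), fun k => (b k).2, fun k => (b' k).2, ?_, ?_⟩
  · intro y hy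
    have h := b.sum_repr ⟨y, hy⟩
    have h2 : ∀ k, b.repr ⟨y, hy⟩ k = regTrace ((b' k : Ω) * y) := by
      intro k
      have := β.dualBasis_repr_apply hnd b' ⟨y, hy⟩ k
      rw [β.dualBasis_dualBasis hnd hsymm b] at this
      rw [this, hβ, regTrace_mul_comm]
    calc _ = ((∑ k, b.repr ⟨y, hy⟩ k • b k : S) : Ω) := by
          simp [h2]
      _ = y := by rw [h]
  · intro y hy
    have h := b'.sum_repr ⟨y, hy⟩
    have h2 : ∀ k, b'.repr ⟨y, hy⟩ k = regTrace ((b k : Ω) * y) := by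
      intro k
      rw [β.dualBasis_repr_apply hnd b ⟨y, hy⟩ k, hβ, regTrace_mul_comm]
    calc _ = ((∑ k, b'.repr ⟨y, hy⟩ k • b' k : S) : Ω) := by
          simp [h2]
      _ = y := by rw [h]

end FiniteDimensional

/-- The tensor `∑ f k ⊗ g k` is invariant: expanding `a * f k` in the `f l` and then resumming in
the `g k` moves `a` across. Averaging thus lands in the commutant. -/
lemma sum_mul_mul_dual_commute {F : StarSubalgebra ℂ Ω} {n : ℕ} {f g : Fin n → Ω}
    (hf : ∀ k, f k ∈ F) (hg : ∀ k, g k ∈ F)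
    (h₁ : ∀ y ∈ F, ∑ k, regTrace (g k * y) • f k = y)
    (h₂ : ∀ y ∈ F, ∑ k, regTrace (f k * y) • g k = y) {a : Ω} (ha : a ∈ F) (y : Ω) :
    a * ∑ k, f k * y * g k = (∑ k, f k * y * g k) * a := by
  calc a * ∑ k, f k * y * g k = ∑ k, (a * f k) * y * g k := by
        simp [Finset.mul_sum, mul_assoc]
    _ = ∑ k, (∑ l, regTrace (g l * (a * f k)) • f l) * y * g k := by
        refine Finset.sum_congr rfl fun k _ => ?_
        rw [h₁ _ (mul_mem ha (hf k))]
    _ = ∑ l, f l * y * ∑ k, regTrace (f k * (g l * a)) • g k := by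
        simp only [Finset.sum_mul, Finset.mul_sum]
        rw [Finset.sum_comm]
        refine Finset.sum_congr rfl fun l _ => Finset.sum_congr rfl fun k _ => ?_
        rw [← mul_assoc (g l) a (f k), regTrace_mul_comm]
        simp
    _ = (∑ k, f k * y * g k) * a := by
        rw [Finset.sum_mul]
        refine Finset.sum_congr rfl fun l _ => ?_
        rw [h₂ _ (mul_mem (hg l) ha)]; simp [mul_assoc]


/-- The commutant of a star-subalgebra. -/
def cm (F : StarSubalgebra ℂ Ω) : StarSubalgebra ℂ Ω := StarSubalgebra.centralizer ℂ (F : Set Ω)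

lemma mem_cm {F : StarSubalgebra ℂ Ω} {z : Ω} : z ∈ cm F ↔ ∀ f ∈ F, f * z = z * f := by
  rw [cm, StarSubalgebra.mem_centralizer_iff]
  exact ⟨fun h f hf => (h f hf).1, fun h f hf => ⟨h f hf, h _ (star_mem hf)⟩⟩

lemma cm_anti {F G : StarSubalgebra ℂ Ω} (h : F ≤ G) : cm G ≤ cm F := fun _ hz =>
  mem_cm.2 fun f hf => mem_cm.1 hz f (h hf)

lemma le_cm_iff {F G : StarSubalgebra ℂ Ω} : F ≤ cm G ↔ ∀ f ∈ F, ∀ g ∈ G, f * g = g * f :=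
  ⟨fun h _ hf g hg => (mem_cm.1 (h hf) g hg).symm,
    fun h f hf => mem_cm.2 fun g hg => (h f hf g hg).symm⟩

lemma le_cm_comm {F G : StarSubalgebra ℂ Ω} : F ≤ cm G ↔ G ≤ cm F := by
  rw [le_cm_iff, le_cm_iff]
  exact ⟨fun h g hg f hf => (h f hf g hg).symm, fun h f hf g hg => (h g hg f hf).symm⟩

lemma le_cm_cm (F : StarSubalgebra ℂ Ω) : F ≤ cm (cm F) := le_cm_comm.1 le_rfl

lemma cm_sup (F G : StarSubalgebra ℂ Ω) : cm (F ⊔ G) = cm F ⊓ cm G :=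
  le_antisymm (le_inf (cm_anti le_sup_left) (cm_anti le_sup_right)) <| le_cm_comm.1 <|
    sup_le (le_cm_comm.1 inf_le_left) (le_cm_comm.1 inf_le_right)

lemma cm_iSup {ι : Sort*} (F : ι → StarSubalgebra ℂ Ω) : cm (⨆ i, F i) = ⨅ i, cm (F i) :=
  le_antisymm (le_iInf fun i => cm_anti (le_iSup F i)) <| le_cm_comm.1 <|
    iSup_le fun i => le_cm_comm.1 (iInf_le _ i)

lemma cm_bot : cm (⊥ : StarSubalgebra ℂ Ω) = ⊤ := by
  rw [eq_top_iff]
  intro z _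
  refine mem_cm.2 fun f hf => ?_
  obtain ⟨c, rfl⟩ := StarSubalgebra.mem_bot.1 hf
  exact Algebra.commutes c z

lemma centre_eq (F : StarSubalgebra ℂ Ω) : centre F = F ⊓ cm F := rfl

lemma IsFactor.cm_top (hΩ : IsFactor Ω) : cm (⊤ : StarSubalgebra ℂ Ω) = ⊥ := by
  have h : centre (⊤ : StarSubalgebra ℂ Ω) = ⊥ := hΩ
  rwa [centre_eq, top_inf_eq] at h

/-- Averages over `F` lie in `cm F`, hence commute with `x`. Averages over the whole factor are
scalars given by the trace. Combining the two expresses `x` as a linear combination of the `f k`. -/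
theorem IsFactor.cm_cm [FiniteDimensional ℂ Ω] (hΩ : IsFactor Ω) (F : StarSubalgebra ℂ Ω) :
    cm (cm F) = F := by
  refine le_antisymm (fun x hx => ?_) (le_cm_cm F)
  obtain ⟨n, f, g, hf, hg, h₁, h₂⟩ := exists_dual_families F
  obtain ⟨m, y, z, hy, hz, k₁, k₂⟩ := exists_dual_families (⊤ : StarSubalgebra ℂ Ω)
  have hcen : ∀ b : Ω, regTrace (1 : Ω) • ∑ j, z j * b * y j = regTrace b • (1 : Ω) := by
    intro b
    have hc : ∑ j, z j * b * y j ∈ cm (⊤ : StarSubalgebra ℂ Ω) := mem_cm.2 fun a ha =>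
      sum_mul_mul_dual_commute hz hy k₂ k₁ ha b
    rw [hΩ.cm_top, StarSubalgebra.mem_bot] at hc
    obtain ⟨c, hc⟩ := hc
    have ht : regTrace b = ∑ j, regTrace (z j * b * y j) := by
      -- Expand left multiplication by `b` in rank-one maps: the scalar value of the average is read
      -- off by comparing traces.
      have hid : LinearMap.mulLeft ℂ b
          = ∑ j, (regTrace ∘ₗ LinearMap.mulLeft ℂ (z j)).smulRight (b * y j) := by
        ext w
        simp only [LinearMap.mulLeft_apply, LinearMap.sum_apply, LinearMap.smulRight_apply,
          LinearMap.comp_apply]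
        conv_lhs => rw [← k₁ w trivial, Finset.mul_sum]
        simp
      rw [regTrace_apply, hid, map_sum]
      simp [LinearMap.trace_smulRight, mul_assoc]
    rw [← map_sum, ← hc, Algebra.algebraMap_eq_smul_one, map_smul] at ht
    rw [← hc, ht, Algebra.algebraMap_eq_smul_one, smul_smul, smul_eq_mul, mul_comm]
  have hcomm : ∀ w, x * ∑ k, f k * w * g k = ∑ k, f k * w * (g k * x) := by
    intro w
    have hw : ∑ k, f k * w * g k ∈ cm F := mem_cm.2 fun a ha =>
      sum_mul_mul_dual_commute hf hg h₁ h₂ ha w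
    rw [← mem_cm.1 hx _ hw, Finset.sum_mul]
    simp [mul_assoc]
  -- Put `w = z j` in `hcomm`, multiply by `y j` and sum: one side is `x`, the other lies in `F`.
  have hl : regTrace (1 : Ω) • ∑ j, (x * ∑ k, f k * z j * g k) * y j = x := by
    calc _ = ∑ k, x * f k * (regTrace (1 : Ω) • ∑ j, z j * g k * y j) := by
          simp only [Finset.mul_sum, Finset.sum_mul, Finset.smul_sum]
          rw [Finset.sum_comm]
          simp [mul_assoc]
      _ = x * ∑ k, regTrace (g k * 1) • f k := by
          simp [hcen, Finset.mul_sum]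
      _ = x := by rw [h₁ 1 (one_mem F), mul_one]
  have hr : regTrace (1 : Ω) • ∑ j, (∑ k, f k * z j * (g k * x)) * y j
      = ∑ k, regTrace (g k * x) • f k := by
    calc _ = ∑ k, f k * (regTrace (1 : Ω) • ∑ j, z j * (g k * x) * y j) := by
          simp only [Finset.mul_sum, Finset.sum_mul, Finset.smul_sum]
          rw [Finset.sum_comm]
          simp [mul_assoc]
      _ = _ := by simp [hcen]
  simp only [hcomm] at hl
  rw [hr] at hl
  rw [← hl]
  exact sum_mem fun k _ => F.smul_mem (hf k) _

end QPartition

/-! ### Conditional expectations and the modular law. -/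

open Module
namespace QPartition
variable {Ω : Type*} [CStarAlgebra Ω]

/-- `E` is the projection onto `F` orthogonal for the trace. Faithfulness of the trace makes it a
map of `F`-bimodules. -/
lemma exists_condExp [FiniteDimensional ℂ Ω] (F : StarSubalgebra ℂ Ω) :
    ∃ E : Ω →ₗ[ℂ] Ω, (∀ y, E y ∈ F) ∧ (∀ y ∈ F, E y = y) ∧
      (∀ a ∈ F, ∀ y, E (a * y) = a * E y) ∧ (∀ a ∈ F, ∀ y, E (y * a) = E y * a) ∧
      (∀ a ∈ F, ∀ y, regTrace (a * E y) = regTrace (a * y)) := by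
  obtain ⟨n, f, g, hf, hg, h₁, h₂⟩ := exists_dual_families F
  let E : Ω →ₗ[ℂ] Ω := ∑ k, (regTrace ∘ₗ LinearMap.mulLeft ℂ (g k)).smulRight (f k)
  have hE : ∀ y, E y = ∑ k, regTrace (g k * y) • f k := fun y => by simp [E]
  have hmem : ∀ y, E y ∈ F := fun y => by
    rw [hE]; exact sum_mem fun k _ => F.smul_mem (hf k) _
  have htr : ∀ a ∈ F, ∀ y, regTrace (a * E y) = regTrace (a * y) := by
    intro a ha y
    conv_rhs => rw [← h₂ a ha]
    rw [hE]
    simp only [Finset.mul_sum, Finset.sum_mul, map_sum, mul_smul_comm, smul_mul_assoc, map_smul,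
      smul_eq_mul]
    exact Finset.sum_congr rfl fun k _ => by rw [regTrace_mul_comm a (f k), mul_comm]
  have huniq : ∀ z ∈ F, (∀ a ∈ F, regTrace (a * z) = 0) → z = 0 := fun z hz h =>
    eq_zero_of_regTrace_star_mul_self (h _ (star_mem hz))
  refine ⟨E, hmem, fun y hy => (hE y).trans (h₁ y hy), fun a ha y => ?_, fun a ha y => ?_, htr⟩
  · refine sub_eq_zero.1 (huniq _ (sub_mem (hmem _) (mul_mem ha (hmem _))) fun b hb => ?_)
    rw [mul_sub, map_sub, htr b hb, ← mul_assoc b a (E y), htr _ (mul_mem hb ha), mul_assoc,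
      sub_self]
  · refine sub_eq_zero.1 (huniq _ (sub_mem (hmem _) (mul_mem (hmem _) ha)) fun b hb => ?_)
    rw [mul_sub, map_sub, htr b hb, regTrace_mul_comm b (E y * a), mul_assoc (E y) a b,
      regTrace_mul_comm (E y), htr _ (mul_mem ha hb), regTrace_mul_comm b, mul_assoc y,
      regTrace_mul_comm y, sub_self]

/-- As `P` and `Q` commute, the sums of products `a * b` already form a star-subalgebra. -/
lemma sup_induction_of_le_cm {P Q : StarSubalgebra ℂ Ω} (h : P ≤ cm Q) {p : Ω → Prop}
    (hmul : ∀ a ∈ P, ∀ b ∈ Q, p (a * b)) (hadd : ∀ x y, p x → p y → p (x + y)) {x : Ω}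
    (hx : x ∈ P ⊔ Q) : p x := by
  let s : Set Ω := {x | ∃ a ∈ P, ∃ b ∈ Q, x = a * b}
  let V : AddSubmonoid Ω := AddSubmonoid.closure s
  have hV : ∀ x ∈ V, p x := fun x hx => by
    induction hx using AddSubmonoid.closure_induction with
    | mem x hx => obtain ⟨a, ha, b, hb, rfl⟩ := hx; exact hmul a ha b hb
    | zero => simpa using hmul 0 (zero_mem P) 0 (zero_mem Q)
    | add x y _ _ hx hy => exact hadd x y hx hy
  have hc := le_cm_iff.1 h
  let T : StarSubalgebra ℂ Ω :=
    { carrier := V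
      zero_mem' := zero_mem V
      add_mem' := fun hx hy => add_mem hx hy
      one_mem' := AddSubmonoid.subset_closure ⟨1, one_mem P, 1, one_mem Q, (mul_one 1).symm⟩
      mul_mem' := fun {x y} hx hy => by
        induction hx, hy using AddSubmonoid.closure_induction₂ with
        | mem x y hx hy =>
          obtain ⟨a, ha, b, hb, rfl⟩ := hx
          obtain ⟨a', ha', b', hb', rfl⟩ := hy
          refine AddSubmonoid.subset_closure ⟨a * a', mul_mem ha ha', b * b', mul_mem hb hb', ?_⟩
          rw [mul_assoc, ← mul_assoc b, ← hc a' ha' b hb]; simp [mul_assoc]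
        | zero_left x _ => simp
        | zero_right x _ => simp
        | add_left x y z _ _ _ h1 h2 => rw [add_mul]; exact add_mem h1 h2
        | add_right x y z _ _ _ h1 h2 => rw [mul_add]; exact add_mem h1 h2
      algebraMap_mem' := fun r => AddSubmonoid.subset_closure
        ⟨_, P.algebraMap_mem r, 1, one_mem Q, (mul_one _).symm⟩
      star_mem' := fun {x} hx => by
        induction hx using AddSubmonoid.closure_induction with
        | mem x hx =>
          obtain ⟨a, ha, b, hb, rfl⟩ := hx
          refine AddSubmonoid.subset_closure ⟨star a, star_mem ha, star b, star_mem hb, ?_⟩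
          rw [star_mul, hc _ (star_mem ha) _ (star_mem hb)]
        | zero => simp
        | add x y _ _ hx hy => rw [star_add]; exact add_mem hx hy }
  have hT : P ⊔ Q ≤ T := sup_le
    (fun a ha => AddSubmonoid.subset_closure ⟨a, ha, 1, one_mem Q, (mul_one a).symm⟩)
    (fun b hb => AddSubmonoid.subset_closure ⟨1, one_mem P, b, hb, (one_mul b).symm⟩)
  exact hV x (hT hx)

section Factor
variable [FiniteDimensional ℂ Ω] [hΩ : Fact (IsFactor Ω)]

lemma cm_cm (F : StarSubalgebra ℂ Ω) : cm (cm F) = F := hΩ.out.cm_cm F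

lemma cm_inf (F G : StarSubalgebra ℂ Ω) : cm (F ⊓ G) = cm F ⊔ cm G := by
  rw [← cm_cm (cm F ⊔ cm G), cm_sup, cm_cm, cm_cm]

lemma cm_le_cm_iff {F G : StarSubalgebra ℂ Ω} : cm F ≤ cm G ↔ G ≤ F :=
  ⟨fun h => by simpa only [cm_cm] using cm_anti h, cm_anti⟩

/-- The modular law used throughout. The conditional expectation onto `cm Q₀` lets factors from `P`
pass, and preserves `Q` because it is also linear over `cm Q`. So it sends `a * b` to `a` times an
element of `Q ⊓ cm Q₀`. -/
lemma sup_inf_cm {P Q Q₀ : StarSubalgebra ℂ Ω} (hP : P ≤ cm Q) (hQ : Q₀ ≤ Q) :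
    (P ⊔ Q) ⊓ cm Q₀ = P ⊔ (Q ⊓ cm Q₀) := by
  refine le_antisymm ?_ (le_inf (sup_le_sup_left inf_le_left _)
    (sup_le (hP.trans (cm_anti hQ)) inf_le_right))
  rintro x ⟨hx, hx'⟩
  obtain ⟨E, hE, hid, hl, hr, -⟩ := exists_condExp (cm Q₀)
  rw [← hid x hx']
  have hQE : ∀ q ∈ Q, E q ∈ Q := by
    intro q hq
    rw [← cm_cm Q]
    refine mem_cm.2 fun a ha => ?_
    have ha' : a ∈ cm Q₀ := cm_anti hQ ha
    rw [← hl a ha' q, ← hr a ha' q, mem_cm.1 ha q hq]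
  refine sup_induction_of_le_cm (p := fun x => E x ∈ P ⊔ (Q ⊓ cm Q₀)) hP ?_ ?_ hx
  · intro a ha b hb
    rw [hl a (hP.trans (cm_anti hQ) ha)]
    exact StarSubalgebra.mul_mem_sup ha ⟨hQE b hb, hE b⟩
  · intro x y hx hy
    rw [map_add]; exact add_mem hx hy

lemma sup_inf_cm_self {P Q : StarSubalgebra ℂ Ω} (hP : P ≤ cm Q) :
    (P ⊔ Q) ⊓ cm Q = P ⊔ centre Q := sup_inf_cm hP le_rfl

/-- The commutant form of the modular law: it splits `P` off from an algebra that commutes with the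
centre of `P`. -/
lemma le_sup_inf_cm {P Y : StarSubalgebra ℂ Ω} (hP : P ≤ Y) (hZ : centre P ≤ cm Y) :
    Y ≤ P ⊔ (Y ⊓ cm P) := by
  rw [← cm_le_cm_iff, cm_sup, cm_inf, cm_cm, inf_comm, sup_inf_cm_self (cm_anti hP)]
  exact sup_le le_rfl hZ

lemma centre_cm (F : StarSubalgebra ℂ Ω) : centre (cm F) = centre F := by
  rw [centre_eq, centre_eq, cm_cm, inf_comm]

lemma cm_centre (F : StarSubalgebra ℂ Ω) : cm (centre F) = F ⊔ cm F := by
  rw [centre_eq, cm_inf, cm_cm, sup_comm]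

end Factor
-- Atomic projectors of commutative algebras.
section Atoms
variable {Z : StarSubalgebra ℂ Ω}

lemma isStarProjection_mul {p q : Ω} (hZ : Z ≤ cm Z) (hp : IsStarProjection p)
    (hq : IsStarProjection q) (hpZ : p ∈ Z) (hqZ : q ∈ Z) : IsStarProjection (p * q) :=
  hp.mul hq (le_cm_iff.1 hZ p hpZ q hqZ)

lemma IsAtomProj.eq_of_mul_ne_zero (hZ : Z ≤ cm Z) {p q : Ω} (hp : IsAtomProj Z p)
    (hq : IsAtomProj Z q) (h : p * q ≠ 0) : p = q := by
  have hc := le_cm_iff.1 hZ p hp.mem q hq.mem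
  have hpq := isStarProjection_mul hZ hp.proj hq.proj hp.mem hq.mem
  have h1 := (hp.minimal _ (mul_mem hp.mem hq.mem) hpq
    (by rw [← mul_assoc, hp.proj.isIdempotentElem])).resolve_left h
  have h2 := (hq.minimal _ (mul_mem hp.mem hq.mem) hpq
    (by rw [hc, ← mul_assoc, hq.proj.isIdempotentElem])).resolve_left h
  exact h1.symm.trans h2

variable [FiniteDimensional ℂ Ω]

/-- The spectral projectors of `z` belong to `Z` and sum to one. By minimality `p` lies below one of
them, on which `z` is scalar. -/
lemma IsAtomProj.exists_smul {p z : Ω} (hp : IsAtomProj Z p) (hZ : Z ≤ cm Z) (hz : z ∈ Z) :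
    ∃ c : ℂ, z * p = c • p := by
  have hc := le_cm_iff.1 hZ
  have : IsStarNormal z := ⟨hc _ (star_mem hz) _ hz⟩
  have hfin := finite_spectrum z
  -- The spectrum is finite, so indicator functions of points are continuous on it.
  have hcont : ∀ f : ℂ → ℂ, ContinuousOn f (spectrum ℂ z) := fun f => hfin.continuousOn f
  have hclosed : IsClosed (Z : Set Ω) :=
    Submodule.closed_of_finiteDimensional (Subalgebra.toSubmodule Z.toSubalgebra)
  let q : ℂ → Ω := fun μ => cfc (fun w : ℂ => if w = μ then (1 : ℂ) else 0) z
  have hqmem : ∀ μ, q μ ∈ Z := fun μ =>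
    StarAlgebra.elemental.le_of_mem hclosed hz (cfc_mem_elemental _ z)
  have hqproj : ∀ μ, IsStarProjection (q μ) := fun μ => by
    constructor
    · change q μ * q μ = q μ
      rw [← cfc_mul _ _ z (hcont _) (hcont _)]
      congr 1; ext w; split_ifs <;> simp
    · change star (q μ) = q μ
      rw [← cfc_star]
      congr 1; ext w; split_ifs <;> simp
  have hqz : ∀ μ, z * q μ = μ • q μ := fun μ => by
    conv_lhs => rw [← cfc_id ℂ z]
    rw [← cfc_mul _ _ z (hcont _) (hcont _), ← cfc_smul _ _ z (hcont _)]
    congr 1; ext w; by_cases h : w = μ <;> simp [h]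
  have hsum : ∑ μ ∈ hfin.toFinset, q μ = 1 := by
    rw [← cfc_sum _ z _ (fun _ _ => hcont _), ← cfc_one ℂ z]
    refine cfc_congr fun w hw => ?_
    simp only [Finset.sum_apply, Finset.sum_ite_eq, Pi.one_apply]
    simp [hw]
  obtain ⟨μ, hμ⟩ : ∃ μ, p * q μ ≠ 0 := by
    by_contra! h
    apply hp.ne_zero
    rw [← mul_one p, ← hsum, Finset.mul_sum]
    exact Finset.sum_eq_zero fun μ _ => h μ
  have h2 : p * q μ = p := by
    refine (hp.minimal _ (mul_mem hp.mem (hqmem μ))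
      (isStarProjection_mul hZ hp.proj (hqproj μ) hp.mem (hqmem μ)) ?_).resolve_left hμ
    rw [← mul_assoc, hp.proj.isIdempotentElem]
  refine ⟨μ, ?_⟩
  conv_lhs => rw [← h2, hc p hp.mem _ (hqmem μ), ← mul_assoc, hqz, smul_mul_assoc,
    hc _ (hqmem μ) _ hp.mem, h2]

/-- Induction on the dimension of `q Z`: a projector that is neither zero nor an atom splits into
two with strictly smaller corners. -/
lemma exists_sum_atoms_eq (hZ : Z ≤ cm Z) {q : Ω} (hq : q ∈ Z) (hqp : IsStarProjection q) :
    ∃ s : Finset Ω, (∀ p ∈ s, IsAtomProj Z p ∧ q * p = p) ∧ ∑ p ∈ s, p = q := by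
  classical
  have hc := le_cm_iff.1 hZ
  let S := Subalgebra.toSubmodule Z.toSubalgebra
  generalize hn : finrank ℂ (S.map (LinearMap.mulLeft ℂ q)) = n
  induction n using Nat.strong_induction_on generalizing q with
  | _ n ih =>
    have hlt : ∀ q' ∈ Z, IsStarProjection q' → q * q' = q' → q' ≠ q →
        finrank ℂ (S.map (LinearMap.mulLeft ℂ q')) < n := by
      intro q' hq' hqp' hle hne
      rw [← hn]
      refine Submodule.finrank_lt_finrank_of_lt (lt_of_le_of_ne ?_ ?_)
      · rintro _ ⟨z, hz, rfl⟩
        exact ⟨q' * z, mul_mem (S := StarSubalgebra ℂ Ω) hq' hz, by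
          simp [← mul_assoc, hle]⟩
      · intro h
        have : q ∈ S.map (LinearMap.mulLeft ℂ q') := h ▸ ⟨1, one_mem Z, by simp⟩
        obtain ⟨z, hz, hzq⟩ := this
        apply hne
        have hzq' : q' * z = q := hzq
        have : q' * q = q := by rw [← hzq', ← mul_assoc, hqp'.isIdempotentElem]
        rw [← hle, hc _ hq _ hq', this]
    by_cases h0 : q = 0
    · exact ⟨∅, by simp, by simp [h0]⟩
    by_cases hat : IsAtomProj Z q
    · exact ⟨{q}, by simp [hat, hqp.isIdempotentElem.eq], by simp⟩
    have : ∃ q' ∈ Z, IsStarProjection q' ∧ q * q' = q' ∧ q' ≠ 0 ∧ q' ≠ q := by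
      by_contra! h
      exact hat ⟨hq, hqp, h0, fun q' h1 h2 h3 => by
        by_cases h4 : q' = 0
        · exact Or.inl h4
        · exact Or.inr (h q' h1 h2 h3 h4)⟩
    obtain ⟨q', hq', hqp', hle, hne0, hne⟩ := this
    have hle' : q' * q = q' := by rw [hc _ hq' _ hq, hle]
    have hsub : IsStarProjection (q - q') := hqp'.sub_of_mul_eq_right hqp hle
    have hqs : q * (q - q') = q - q' := by rw [mul_sub, hqp.isIdempotentElem, hle]
    obtain ⟨s, hs, hsq⟩ := ih _ (hlt q' hq' hqp' hle hne) hq' hqp' rfl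
    obtain ⟨t, ht, htq⟩ := ih _ (hlt (q - q') (sub_mem hq hq') hsub hqs
      (by simpa using hne0)) (sub_mem hq hq') hsub rfl
    have hdisj : Disjoint s t := by
      rw [Finset.disjoint_left]
      intro p hps hpt
      apply (hs p hps).1.ne_zero
      have h1 := (hs p hps).2
      have h2 := (ht p hpt).2
      rw [← h2, sub_mul, h1, ← h1, ← mul_assoc, hle, sub_self]
    refine ⟨s ∪ t, fun p hp => ?_, by rw [Finset.sum_union hdisj, hsq, htq]; abel⟩
    rcases Finset.mem_union.1 hp with hp | hp
    · exact ⟨(hs p hp).1, by rw [← (hs p hp).2, ← mul_assoc, hle]⟩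
    · exact ⟨(ht p hp).1, by rw [← (ht p hp).2, ← mul_assoc, hqs]⟩

lemma exists_sum_atoms (hZ : Z ≤ cm Z) :
    ∃ s : Finset Ω, (∀ p ∈ s, IsAtomProj Z p) ∧ ∑ p ∈ s, p = 1 := by
  obtain ⟨s, hs, h⟩ := exists_sum_atoms_eq hZ (one_mem Z) (IsStarProjection.one Ω)
  exact ⟨s, fun p hp => (hs p hp).1, h⟩

lemma mem_of_forall_mul_atom (hZ : Z ≤ cm Z) {Y : StarSubalgebra ℂ Ω} {x : Ω}
    (h : ∀ p, IsAtomProj Z p → x * p ∈ Y) : x ∈ Y := by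
  obtain ⟨s, hs, h1⟩ := exists_sum_atoms hZ
  rw [← mul_one x, ← h1, Finset.mul_sum]
  exact sum_mem fun p hp => h p (hs p hp)

lemma eq_zero_of_forall_mul_atom (hZ : Z ≤ cm Z) {x : Ω}
    (h : ∀ p, IsAtomProj Z p → x * p = 0) : x = 0 := by
  obtain ⟨s, hs, h1⟩ := exists_sum_atoms hZ
  rw [← mul_one x, ← h1, Finset.mul_sum]
  exact Finset.sum_eq_zero fun p hp => h p (hs p hp)

lemma exists_atom_mul_ne_zero (hZ : Z ≤ cm Z) {x : Ω} (hx : x ≠ 0) :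
    ∃ p, IsAtomProj Z p ∧ x * p ≠ 0 := by
  by_contra! h
  exact hx (eq_zero_of_forall_mul_atom hZ h)

/-- The basic way of discarding a cut: an atom of `C` turns the factors from `C` into scalars. -/
lemma exists_mul_atom_eq {Y C : StarSubalgebra ℂ Ω} (hC : C ≤ cm C) (hY : Y ≤ cm C) {z p : Ω}
    (hz : z ∈ Y ⊔ C) (hp : IsAtomProj C p) : ∃ y ∈ Y, z * p = y * p := by
  refine sup_induction_of_le_cm (p := fun z => ∃ y ∈ Y, z * p = y * p) hY ?_ ?_ hz
  · intro a ha b hb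
    obtain ⟨c, hc⟩ := hp.exists_smul hC hb
    exact ⟨c • a, Y.smul_mem ha c, by rw [mul_assoc, hc]; simp⟩
  · rintro x y ⟨a, ha, hxa⟩ ⟨b, hb, hyb⟩
    exact ⟨a + b, add_mem ha hb, by rw [add_mul, add_mul, hxa, hyb]⟩

/-- The conditional expectation `k` of `g * star g` is central in `F`, hence a scalar on the block.
If this scalar is zero, faithfulness of the trace kills `g`; otherwise `f` must vanish there. -/
lemma mul_eq_zero_of_block {F : StarSubalgebra ℂ Ω} {f g p : Ω} (hf : f ∈ F)
    (hg : g ∈ cm F) (hp : p ∈ centre F) (hblock : ∀ k ∈ centre F, ∃ c : ℂ, k * p = c • p)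
    (h : f * g * p = 0) : f * p = 0 ∨ g * p = 0 := by
  obtain ⟨E, hE, -, hl, hr, htr⟩ := exists_condExp F
  set k := E (g * star g) with hk
  have hkZ : k ∈ centre F := by
    refine ⟨hE _, mem_cm.2 fun a ha => ?_⟩
    rw [hk, ← hl a ha, ← hr a ha, mem_cm.1 (mul_mem hg (star_mem hg)) a ha]
  have key : ∀ x ∈ F, x * k = 0 → x * g = 0 := by
    intro x hx hxk
    have h1 : regTrace (star (star (x * g)) * star (x * g)) = 0 := by
      rw [star_star, star_mul, regTrace_mul_comm]
      calc _ = regTrace (x * (g * star g) * star x) := by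
            rw [regTrace_mul_comm]; simp [mul_assoc]
        _ = regTrace (star x * x * (g * star g)) := by rw [regTrace_mul_comm, mul_assoc]
        _ = 0 := by
            rw [← htr _ (mul_mem (star_mem hx) hx), ← hk, mul_assoc, hxk]; simp
    exact star_eq_zero.1 (eq_zero_of_regTrace_star_mul_self h1)
  have hgp : g * p = p * g := (mem_cm.1 hg p hp.1).symm
  obtain ⟨c, hc⟩ := hblock k hkZ
  have hpk : p * k = k * p := (mem_cm.1 hkZ.2 p hp.1)
  by_cases hc0 : c = 0
  · right
    rw [hgp]
    exact key p hp.1 (by rw [hpk, hc, hc0, zero_smul])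
  · left
    have h1 : f * p * k = 0 := by
      rw [hk, ← hl _ (mul_mem hf hp.1), ← mul_assoc, mul_assoc f p g, ← hgp, ← mul_assoc, h]
      simp
    rw [mul_assoc, hpk, hc, mul_smul_comm] at h1
    exact (smul_eq_zero.1 h1).resolve_left hc0

end Atoms
end QPartition

/-! ### Cut systems: unions and overlaps of intervals. -/

namespace QPartition
variable {Ω : Type*} [CStarAlgebra Ω]

/-- A cut system with `M` cuts on a circle: to the interval between the cuts `a ≤ b ≤ a + M` it
assigns an algebra `I a b`, with the commutant of `I a b` attached to the complementary interval.
The algebra `I a a` plays the role of the centre shared by the two sides of the cut `a`. -/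
structure CutSystem (M : ℕ) (I : ℤ → ℤ → StarSubalgebra ℂ Ω) : Prop where
  per : ∀ a b : ℤ, I (a + M) (b + M) = I a b
  comm : ∀ a b : ℤ, a ≤ b → b ≤ a + M → I b (a + M) = cm (I a b)
  step : ∀ a b : ℤ, a ≤ b → b < a + M → I a b ≤ I a (b + 1)
  tri : ∀ a b c : ℤ, a ≤ b → b ≤ c → c ≤ a + M →
    I b (a + M) ⊓ I c (b + M) ⊓ I a c ≤ I a a ⊔ I b b ⊔ I c c

namespace CutSystem
variable {M : ℕ} {I : ℤ → ℤ → StarSubalgebra ℂ Ω}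

lemma per_sub (h : CutSystem M I) (a b : ℤ) : I (a - M) (b - M) = I a b := by
  rw [← h.per (a - M) (b - M)]; congr 1 <;> ring

lemma cm_eq (h : CutSystem M I) {a b : ℤ} (hab : a ≤ b) (hb : b ≤ a + M) :
    cm (I a b) = I b (a + M) := (h.comm a b hab hb).symm

lemma cm_eq' (h : CutSystem M I) {a b : ℤ} (hab : a ≤ b) (hb : b ≤ a + M) :
    cm (I a b) = I (b - M) a := by
  rw [h.cm_eq hab hb, ← h.per (b - M) a]; congr 1; ring

lemma exists_shift (h : CutSystem M I) (hM : 0 < M) (a b : ℤ) :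
    ∃ c, b ≤ c ∧ c < b + M ∧ I c c = I a a := by
  have key : ∀ k : ℕ, ∀ a, I (a + k * M) (a + k * M) = I a a := by
    intro k
    induction k with
    | zero => simp
    | succ k ih =>
      intro a
      rw [← ih a, ← h.per (a + k * M)]; push_cast; ring_nf
  have hM' : (0 : ℤ) < M := by exact_mod_cast hM
  refine ⟨b + (a - b) % M, by have := Int.emod_nonneg (a - b) hM'.ne'; lia,
    by have := Int.emod_lt_of_pos (a - b) hM'; lia, ?_⟩
  have e := Int.emod_add_mul_ediv (a - b) M
  rcases le_total 0 ((a - b) / M) with hk | hk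
  · obtain ⟨k, hk⟩ := Int.eq_ofNat_of_zero_le hk
    rw [← key k (b + (a - b) % M)]
    have : b + (a - b) % M + k * M = a := by rw [hk] at e; linarith
    rw [this]
  · obtain ⟨k, hk⟩ := Int.eq_ofNat_of_zero_le (neg_nonneg.2 hk)
    rw [← key k a]
    have hk' : (a - b) / M = -(k : ℤ) := by linarith
    have : a + k * M = b + (a - b) % M := by rw [hk'] at e; linarith
    rw [this]

lemma mono_right (h : CutSystem M I) {a b b' : ℤ} (hab : a ≤ b) (hb : b ≤ b') (hb' : b' ≤ a + M) :
    I a b ≤ I a b' := by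
  induction b', hb using Int.leInduction with
  | base => exact le_rfl
  | succ n hn ih => exact (ih (by lia)).trans (h.step a n (by lia) (by lia))

variable [FiniteDimensional ℂ Ω] [hΩ : Fact (IsFactor Ω)]

/-- Monotonicity at the right end, read on complementary intervals. -/
lemma mono_left (h : CutSystem M I) {a a' b : ℤ} (ha : a' ≤ a) (hab : a ≤ b) (hb : b ≤ a' + M) :
    I a b ≤ I a' b := by
  rw [← cm_le_cm_iff, ← h.comm a b hab (by lia), ← h.comm a' b (by lia) hb]
  exact h.mono_right hb (by lia) (by lia)

lemma mono (h : CutSystem M I) {a a' b b' : ℤ} (ha : a' ≤ a) (hab : a ≤ b) (hb : b ≤ b')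
    (hb' : b' ≤ a' + M) : I a b ≤ I a' b' :=
  (h.mono_left ha hab (by lia)).trans (h.mono_right (by lia) hb hb')

lemma le_cm (h : CutSystem M I) {a b c d : ℤ} (hab : a ≤ b) (hbc : b ≤ c) (hcd : c ≤ d)
    (hd : d ≤ a + M) : I a b ≤ cm (I c d) := by
  rw [le_cm_comm, h.cm_eq hab (by lia)]
  exact h.mono hbc hcd hd (by lia)

lemma le_cm' (h : CutSystem M I) {a b c d : ℤ} (hab : a ≤ b) (hbc : b ≤ c) (hcd : c ≤ d)
    (hd : d ≤ a + M) : I c d ≤ cm (I a b) := le_cm_comm.1 (h.le_cm hab hbc hcd hd)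

lemma cut_le (h : CutSystem M I) {a b c : ℤ} (hab : a ≤ b) (hbc : b ≤ c) (hc : c ≤ a + M) :
    I b b ≤ I a c := h.mono hab le_rfl hbc hc

lemma cut_le_cm_cut (h : CutSystem M I) (hM : 0 < M) (a b : ℤ) : I a a ≤ cm (I b b) := by
  obtain ⟨c, h1, h2, h3⟩ := h.exists_shift hM a b
  rw [← h3]
  exact h.le_cm' le_rfl h1 le_rfl (by lia)

lemma cut_comm (h : CutSystem M I) (a : ℤ) : I a a ≤ cm (I a a) :=
  h.le_cm le_rfl le_rfl le_rfl (by lia)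

/-- The degenerate case `b = c` of the triangle axiom. -/
lemma centre_le (h : CutSystem M I) {a b : ℤ} (hab : a ≤ b) (hb : b ≤ a + M) :
    I a b ⊓ cm (I a b) ≤ I a a ⊔ I b b := by
  rw [h.cm_eq hab hb]
  have ht : _ ≤ I a a ⊔ I b b :=
    (h.tri a b b hab le_rfl hb).trans (sup_le le_rfl le_sup_right)
  refine le_trans ?_ ht
  refine le_inf (le_inf inf_le_right ?_) inf_le_left
  rw [← h.cm_eq le_rfl (by lia)]
  exact inf_le_left.trans (h.le_cm hab le_rfl le_rfl hb)

/-- The two intervals overlap in that from `p` to `s` and also touch at `r`, whence the extra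
centre. An element of both commutes with the centre of `I p s`. The modular law splits off `I p s`;
the rest commutes with all three pieces of the circle, and the triangle axiom reduces it to cut
centres. -/
lemma meet (h : CutSystem M I) {r p s : ℤ} (hrp : r ≤ p) (hps : p ≤ s) (hs : s ≤ r + M) :
    I p (r + M) ⊓ I r s ≤ I p s ⊔ I r r := by
  intro z hz
  have e1 : I p (r + M) = cm (I r p) := h.comm r p hrp (by lia)
  have e2 : I r s = cm (I s (r + M)) := by rw [h.comm r s (by lia) hs, cm_cm]
  have e3 : cm (I p s) = I s (p + M) := h.cm_eq hps (by lia)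
  have hz1 : z ∈ cm (I r p) := e1 ▸ hz.1
  have hz2 : z ∈ cm (I s (r + M)) := e2 ▸ hz.2
  have hrM : I (r + M) (r + M) = I r r := h.per r r
  have hsm : I (s - M) (s - M) = I s s := h.per_sub s s
  have hz3 : z ∈ I p s ⊔ cm (I p s) := by
    rw [← cm_centre]
    refine cm_anti (h.centre_le hps (by lia)) ?_
    rw [cm_sup]
    exact ⟨cm_anti (h.cut_le hrp le_rfl (by lia)) hz1, cm_anti (h.cut_le le_rfl hs (by lia)) hz2⟩
  have hQ : I r p ⊔ I s (r + M) ≤ cm (I p s) :=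
    sup_le (h.le_cm hrp le_rfl hps hs) (h.le_cm' hps le_rfl hs (by lia))
  have hz4 : z ∈ (I p s ⊔ cm (I p s)) ⊓ cm (I r p ⊔ I s (r + M)) :=
    ⟨hz3, by rw [cm_sup]; exact ⟨hz1, hz2⟩⟩
  rw [sup_inf_cm (by rw [cm_cm]) hQ] at hz4
  suffices hle : cm (I p s) ⊓ cm (I r p ⊔ I s (r + M)) ≤ I p s ⊔ I r r from
    (sup_le le_sup_left hle : I p s ⊔ _ ≤ _) hz4
  rw [cm_sup, ← e1, ← e2, e3]
  have ht := h.tri (s - M) r p (by lia) hrp (by lia)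
  rw [sub_add_cancel, ← h.per (s - M) p, sub_add_cancel, hsm] at ht
  refine le_trans (le_inf (le_inf ?_ ?_) inf_le_left) (ht.trans (sup_le (sup_le ?_ ?_) ?_))
  · exact inf_le_right.trans inf_le_right
  · exact inf_le_right.trans inf_le_left
  · exact (h.cut_le hps le_rfl (by lia)).trans le_sup_left
  · exact le_sup_right
  · exact (h.cut_le le_rfl hps (by lia)).trans le_sup_left

lemma join (h : CutSystem M I) {a b c : ℤ} (hab : a ≤ b) (hbc : b ≤ c) (hc : c ≤ a + M) :
    I a c ⊓ cm (I b b) ≤ I a b ⊔ I b c := by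
  rw [← cm_le_cm_iff, cm_inf, cm_cm, cm_sup, h.cm_eq hab (by lia), h.cm_eq hbc (by lia),
    h.cm_eq (by lia) hc, inf_comm]
  exact h.meet hbc hc (by lia)

lemma mul_comm_of_disjoint (h : CutSystem M I) {a b c d : ℤ} (hab : a ≤ b) (hbc : b ≤ c)
    (hcd : c ≤ d) (hd : d ≤ a + M) {x y : Ω} (hx : x ∈ I a b) (hy : y ∈ I c d) : x * y = y * x :=
  le_cm_iff.1 (h.le_cm hab hbc hcd hd) x hx y hy

/-- On each block of `I a b`, the products of nonzero elements of `I a b` and of its commutant are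
nonzero. -/
lemma block (h : CutSystem M I) {a b : ℤ} (hab : a ≤ b) (hb : b ≤ a + M) {x y α β : Ω}
    (hα : IsAtomProj (I a a) α) (hβ : IsAtomProj (I b b) β) (hx : x ∈ I a b)
    (hy : y ∈ I b (a + M)) (hxy : x * y * (α * β) = 0) : x * (α * β) = 0 ∨ y * (α * β) = 0 := by
  have hα1 : α ∈ I a b := h.cut_le le_rfl hab hb hα.mem
  have hβ1 : β ∈ I a b := h.cut_le hab le_rfl hb hβ.mem
  have hα2 : α ∈ cm (I a b) := h.le_cm le_rfl le_rfl hab hb hα.mem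
  have hβ2 : β ∈ cm (I a b) := h.le_cm' hab le_rfl le_rfl hb hβ.mem
  refine mul_eq_zero_of_block hx (by rwa [h.cm_eq hab hb]) ⟨mul_mem hα1 hβ1, mul_mem hα2 hβ2⟩ ?_ hxy
  intro k hk
  have hk' := h.centre_le hab hb hk
  obtain ⟨y, hy, hky⟩ := exists_mul_atom_eq (h.cut_comm b)
    (h.le_cm le_rfl hab le_rfl hb) hk' hβ
  obtain ⟨c, hc⟩ := hα.exists_smul (h.cut_comm a) hy
  refine ⟨c, ?_⟩
  have hαβ : α * β = β * α := h.mul_comm_of_disjoint le_rfl hab le_rfl hb hα.mem hβ.mem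
  rw [hαβ, ← mul_assoc, hky, mul_assoc, ← hαβ, ← mul_assoc, hc, smul_mul_assoc]

end CutSystem
end QPartition

/-! ### Uncorrelated cuts and the gluing of labels. -/

namespace QPartition
variable {Ω : Type*} [CStarAlgebra Ω]

lemma Uncorrelated.symm {F G : StarSubalgebra ℂ Ω} (h : Uncorrelated F G) : Uncorrelated G F := by
  intro g hg f hf hgf
  have := h (star f) (star_mem hf) (star g) (star_mem hg) (by rw [← star_mul, hgf, star_zero])
  simpa [or_comm] using this

lemma Uncorrelated.mono {F G F' G' : StarSubalgebra ℂ Ω} (h : Uncorrelated F G) (hF : F' ≤ F)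
    (hG : G' ≤ G) : Uncorrelated F' G' := fun f hf g hg => h f (hF hf) g (hG hg)

lemma Uncorrelated.mul_ne_zero {F G : StarSubalgebra ℂ Ω} (h : Uncorrelated F G) {f g : Ω}
    (hf : f ∈ F) (hg : g ∈ G) (hf0 : f ≠ 0) (hg0 : g ≠ 0) : f * g ≠ 0 := fun h0 =>
  (h f hf g hg h0).elim hf0 hg0

namespace CutSystem
variable {M : ℕ} {I : ℤ → ℤ → StarSubalgebra ℂ Ω}

/-- The algebra generated by the centres of all the cuts. -/
def labels (I : ℤ → ℤ → StarSubalgebra ℂ Ω) : StarSubalgebra ℂ Ω := ⨆ a, I a a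

lemma cut_le_labels (I : ℤ → ℤ → StarSubalgebra ℂ Ω) (a : ℤ) : I a a ≤ labels I :=
  le_iSup (fun a => I a a) a

variable [FiniteDimensional ℂ Ω] [hΩ : Fact (IsFactor Ω)]

lemma labels_le_cm (h : CutSystem M I) (hM : 0 < M) : labels I ≤ cm (labels I) := by
  refine iSup_le fun a => le_cm_comm.1 (iSup_le fun b => h.cut_le_cm_cut hM b a)

/-- The commutative ring structure on the label algebra. -/
abbrev labelRing (h : CutSystem M I) (hM : 0 < M) : CommRing (labels I) :=
  { (inferInstance : Ring (labels I)) with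
    mul_comm := fun x y => Subtype.ext (le_cm_iff.1 (h.labels_le_cm hM) x x.2 y y.2) }

/-- Atoms of the centres of three cuts are compatible as soon as they are pairwise compatible. -/
def Gluing (I : ℤ → ℤ → StarSubalgebra ℂ Ω) (M : ℕ) : Prop :=
  ∀ ⦃a b c : ℤ⦄, a ≤ b → b ≤ c → c ≤ a + M → ∀ ⦃α β γ : Ω⦄, IsAtomProj (I a a) α →
    IsAtomProj (I b b) β → IsAtomProj (I c c) γ → α * β ≠ 0 → β * γ ≠ 0 → γ * α ≠ 0 →
    α * β * γ ≠ 0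

/-- Every elementary interval is uncorrelated with some cut at distance at most `L` to its
right. -/
def Decorrelates (I : ℤ → ℤ → StarSubalgebra ℂ Ω) (L : ℕ) : Prop :=
  ∀ b : ℤ, ∃ w, b + 1 ≤ w ∧ w ≤ b + 1 + L ∧ Uncorrelated (I b (b + 1)) (I w w)

/-- A Markov property: once the labels at `a` and `b` are fixed, those on the two sides of this pair
of cuts are independent. -/
lemma mul_ne_zero_of_block (h : CutSystem M I) (hM : 0 < M) {a m b n : ℤ} (h1 : a ≤ m) (h2 : m ≤ b)
    (h3 : b ≤ n) (h4 : n ≤ a + M) :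
    letI := h.labelRing hM
    ∀ {α μ β ν : labels I}, IsAtomProj (I a a) (α : Ω) → (μ : Ω) ∈ I m m →
    IsAtomProj (I b b) (β : Ω) → (ν : Ω) ∈ I n n → α * β * μ ≠ 0 → α * β * ν ≠ 0 →
    α * β * μ * ν ≠ 0 := by
  let := h.labelRing hM
  intro α μ β ν hα hμ hβ hν e1 e2 e3
  have e4 : μ * ν * (α * β) = 0 := by rw [← e3]; ring
  have e5 : (μ : Ω) * ν * (α * β) = 0 := congrArg Subtype.val e4
  rcases h.block (by lia) (by lia) hα hβ (h.cut_le h1 h2 (by lia) hμ)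
    (h.cut_le h3 h4 (by lia) hν) e5 with e | e
  · exact e1 (by rw [mul_comm (α * β)]; exact Subtype.ext e)
  · exact e2 (by rw [mul_comm (α * β)]; exact Subtype.ext e)

lemma ne_zero_of_mul {R : Type*} [CommRing R] {x y : R} (h : y ≠ 0) (z : R) (e : x * z = y) :
    x ≠ 0 := by
  rintro rfl; exact h (by rw [← e, zero_mul])

/-- Induction on the distance from `b` to `c`: `β` is replaced by a label `μ` one step closer to
`γ`. The free space of length `L` before `a + M` leaves room for an auxiliary cut `w` that makes `μ`
compatible with `α`. -/
lemma linear_gluing (h : CutSystem M I) (hM : 0 < M) {L : ℕ} (hL : Decorrelates I L) (k : ℕ) :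
    letI := h.labelRing hM
    ∀ {a b c : ℤ}, a ≤ b → c = b + k → c + L ≤ a + M → ∀ {α β γ : labels I},
    IsAtomProj (I a a) (α : Ω) → IsAtomProj (I b b) (β : Ω) → IsAtomProj (I c c) (γ : Ω) →
    α * β ≠ 0 → β * γ ≠ 0 → α * β * γ ≠ 0 := by
  let := h.labelRing hM
  induction k with
  | zero =>
    intro a b c hab hc hcL α β γ hα hβ hγ e1 e2
    obtain rfl : c = b := by simpa using hc
    have : β = γ := Subtype.ext (hβ.eq_of_mul_ne_zero (h.cut_comm c) hγ
      fun e => e2 (Subtype.ext e))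
    rw [← this, mul_assoc, show β * β = β from Subtype.ext hβ.proj.isIdempotentElem]
    exact e1
  | succ k ih =>
    intro a b c hab hc hcL α β γ hα hβ hγ e1 e2
    have hex : ∀ (w : ℤ) (x : labels I), x ≠ 0 →
        ∃ τ : labels I, IsAtomProj (I w w) (τ : Ω) ∧ x * τ ≠ 0 := by
      intro w x hx
      obtain ⟨p, hp, hxp⟩ := exists_atom_mul_ne_zero (h.cut_comm w)
        (x := (x : Ω)) (fun e => hx (Subtype.ext e))
      exact ⟨⟨p, cut_le_labels I w hp.mem⟩, hp, fun e => hxp (congrArg Subtype.val e)⟩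
    obtain ⟨μ, hμ, e3⟩ := hex (b + 1) _ e2
    obtain ⟨w, hw1, hw2, hw3⟩ := hL b
    obtain ⟨τ, hτ, e4⟩ := hex w _ e1
    have hcast : c = b + 1 + k := by push_cast at hc; linarith
    have hβμ : β * μ ≠ 0 := ne_zero_of_mul e3 γ (by ring)
    have hβμτ : β * τ * μ ≠ 0 := by
      have := hw3.mul_ne_zero (f := (β : Ω) * μ) (g := τ)
        (mul_mem (h.cut_le le_rfl (by lia) (by lia) hβ.mem)
          (h.cut_le (by lia) le_rfl (by lia) hμ.mem)) hτ.mem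
        (fun e => hβμ (Subtype.ext e)) hτ.ne_zero
      intro e
      exact this (by
        have : β * μ * τ = 0 := by rw [← e]; ring
        exact congrArg Subtype.val this)
    have hα' : (α : Ω) ∈ I (a + M) (a + M) := by rw [h.per]; exact hα.mem
    -- The cuts `b` and `w` separate `μ` from `α`; hence `α` and `μ` are compatible and the
    -- induction applies to `α, μ, γ`.
    have e5 : β * τ * μ * α ≠ 0 := h.mul_ne_zero_of_block hM (a := b) (m := b + 1) (b := w)
      (n := a + M) (by lia) hw1 (by lia) (by lia) hβ hμ.mem hτ hα' hβμτ
      (ne_zero_of_mul e4 1 (by ring))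
    have e6 : α * μ * γ ≠ 0 := ih (by lia) hcast hcL hα hμ hγ
      (ne_zero_of_mul e5 (β * τ) (by ring)) (ne_zero_of_mul e3 β (by ring))
    -- Now `a` and `b + 1` separate `β` from `γ`, so `β` can be put back.
    have e7 : α * μ * β * γ ≠ 0 := h.mul_ne_zero_of_block hM (a := a) (m := b) (b := b + 1)
      (n := c) hab (by lia) (by lia) (by lia) hα hβ.mem hμ hγ.mem
      (ne_zero_of_mul e5 τ (by ring)) e6
    exact ne_zero_of_mul e7 μ (by ring)

/-- Rotate the three cuts so that some gap has length at least `L`. If only the gap from `b` to `c`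
offers this room, insert a label at `a + M - L` in that gap and glue twice. -/
theorem gluing (h : CutSystem M I) (hM : 0 < M) {L : ℕ} (hL : Decorrelates I L)
    (hLM : 2 * L ≤ M) : Gluing I M := by
  let := h.labelRing hM
  suffices H : ∀ ⦃a b c : ℤ⦄, a ≤ b → b ≤ c → c ≤ a + M → ∀ ⦃α β γ : labels I⦄,
      IsAtomProj (I a a) (α : Ω) → IsAtomProj (I b b) (β : Ω) → IsAtomProj (I c c) (γ : Ω) →
      α * β ≠ 0 → β * γ ≠ 0 → γ * α ≠ 0 → α * β * γ ≠ 0 by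
    intro a b c h1 h2 h3 α β γ hα hβ hγ e1 e2 e3 e
    exact H h1 h2 h3 (α := ⟨α, cut_le_labels I a hα.mem⟩) (β := ⟨β, cut_le_labels I b hβ.mem⟩)
      (γ := ⟨γ, cut_le_labels I c hγ.mem⟩) hα hβ hγ (fun e => e1 (congrArg Subtype.val e))
      (fun e => e2 (congrArg Subtype.val e)) (fun e => e3 (congrArg Subtype.val e)) (Subtype.ext e)
  intro a b c h1 h2 h3 α β γ hα hβ hγ e1 e2 e3
  have hα' : IsAtomProj (I (a + M) (a + M)) (α : Ω) := by rw [h.per]; exact hα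
  by_cases hc : c + L ≤ a + M
  · exact h.linear_gluing hM hL (c - b).toNat h1 (by lia) hc hα hβ hγ e1 e2
  by_cases hb : b ≤ a + M - L
  · obtain ⟨p, hp, hxp⟩ := exists_atom_mul_ne_zero (h.cut_comm (a + M - L))
      (x := (β : Ω) * γ) (fun e => e2 (Subtype.ext e))
    set κ : labels I := ⟨p, cut_le_labels I _ hp.mem⟩
    have e4 : β * γ * κ ≠ 0 := fun e => hxp (congrArg Subtype.val e)
    have e5 : α * β * κ ≠ 0 := h.linear_gluing hM hL (a + M - L - b).toNat h1 (by lia) (by lia)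
      hα hβ (γ := κ) hp e1 (ne_zero_of_mul e4 γ (by ring))
    have e6 : κ * γ * α ≠ 0 := h.linear_gluing hM hL (a + M - c).toNat (a := a + M - L) (b := c)
      (c := a + M) (by lia) (by lia) (by lia) (α := κ) hp hγ hα'
      (ne_zero_of_mul e4 β (by ring)) e3
    have e7 := h.mul_ne_zero_of_block hM (a := a) (m := b) (b := a + M - L) (n := c) h1 (by lia)
      (by lia) (by lia) (β := κ) hα hβ.mem hp hγ.mem
      (ne_zero_of_mul e5 1 (by ring)) (ne_zero_of_mul e6 1 (by ring))
    exact ne_zero_of_mul e7 κ (by ring)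
  · have e7 : β * γ * α ≠ 0 := h.linear_gluing hM hL (a + M - c).toNat (a := b) (b := c)
      (c := a + M) h2 (by lia) (by lia) hβ hγ hα' e2 e3
    exact ne_zero_of_mul e7 1 (by ring)

end CutSystem
end QPartition

/-! ### Detecting elements on the block of a distant atom. -/

namespace QPartition
variable {Ω : Type*} [CStarAlgebra Ω]

lemma exists_atom [FiniteDimensional ℂ Ω] [Nontrivial Ω] {C : StarSubalgebra ℂ Ω} (hC : C ≤ cm C) :
    ∃ p, IsAtomProj C p := by
  obtain ⟨p, hp, -⟩ := exists_atom_mul_ne_zero hC (one_ne_zero (α := Ω))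
  exact ⟨p, hp⟩

namespace CutSystem
variable {M : ℕ} {I : ℤ → ℤ → StarSubalgebra ℂ Ω}
variable [FiniteDimensional ℂ Ω] [hΩ : Fact (IsFactor Ω)]

/-- An element of `I a b` that is killed by an atom `π` of another cut vanishes, provided that `π`
is compatible with all the labels of `a` and `b` that the element involves. -/
lemma eq_zero_of_mul_atom (h : CutSystem M I) (hG : Gluing I M) {a b w : ℤ} (hab : a ≤ b)
    (hbw : b ≤ w) (hw : w ≤ a + M) {x π : Ω} (hx : x ∈ I a b) (hπ : IsAtomProj (I w w) π)
    (hxπ : x * π = 0) (H : ∀ α β, IsAtomProj (I a a) α → IsAtomProj (I b b) β →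
      x * (α * β) ≠ 0 → β * π ≠ 0 ∧ π * α ≠ 0) : x = 0 := by
  refine eq_zero_of_forall_mul_atom (h.cut_comm a) fun α hα =>
    eq_zero_of_forall_mul_atom (h.cut_comm b) fun β hβ => ?_
  rw [mul_assoc]
  by_contra hne
  obtain ⟨h1, h2⟩ := H α β hα hβ hne
  have hαβ : α * β ≠ 0 := fun e => hne (by rw [e, mul_zero])
  have hg := hG hab hbw hw hα hβ hπ hαβ h1 h2
  have hπI : π ∈ I b (a + M) := h.cut_le hbw hw (by lia) hπ.mem
  rcases h.block hab (by lia) hα hβ hx hπI (by rw [hxπ, zero_mul]) with e | e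
  · exact hne e
  · refine hg (Eq.trans ?_ e)
    exact h.mul_comm_of_disjoint hab le_rfl (by lia) le_rfl
      (mul_mem (h.cut_le le_rfl hab (by lia) hα.mem) (h.cut_le hab le_rfl (by lia) hβ.mem)) hπI

lemma eq_zero_of_uncorrelated (h : CutSystem M I) (hG : Gluing I M) {a b w : ℤ} (hab : a ≤ b)
    (hbw : b ≤ w) (hw : w ≤ a + M) (ha : Uncorrelated (I a a) (I w w))
    (hb : Uncorrelated (I b b) (I w w)) {x π : Ω} (hx : x ∈ I a b) (hπ : IsAtomProj (I w w) π)
    (hxπ : x * π = 0) : x = 0 :=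
  h.eq_zero_of_mul_atom hG hab hbw hw hx hπ hxπ fun _ _ hα hβ _ =>
    ⟨hb.mul_ne_zero hβ.mem hπ.mem hβ.ne_zero hπ.ne_zero,
      ha.symm.mul_ne_zero hπ.mem hα.mem hπ.ne_zero hα.ne_zero⟩

/-- If the outer cuts of two overlapping intervals are uncorrelated, then the intersection of their
algebras is the algebra of the overlap. -/
lemma inf_le_of_uncorrelated (h : CutSystem M I) (hM : 0 < M) (hG : Gluing I M) {a a' b b' : ℤ}
    (h1 : a ≤ a') (h2 : a' ≤ b) (h3 : b ≤ b') (h4 : b' ≤ a + M)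
    (hu : Uncorrelated (I a a) (I b' b')) : I a b ⊓ I a' b' ≤ I a' b := by
  intro z hz
  have hz1 : z ∈ I a' b ⊔ I a a := h.meet h1 h2 (by lia)
    ⟨h.mono le_rfl (by lia) h4 (by lia) hz.2, hz.1⟩
  have hz2 : z ∈ I a' b ⊔ I b' b' := by
    have := h.meet (r := b' - M) (p := a') (s := b) (by lia) h2 (by lia)
    rw [h.per_sub, sub_add_cancel] at this
    exact this ⟨hz.2, h.mono (by lia) (by lia) le_rfl (by lia) hz.1⟩
  let := h.labelRing hM
  refine mem_of_forall_mul_atom (h.cut_comm a') fun α hα =>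
    mem_of_forall_mul_atom (h.cut_comm b) fun β hβ => ?_
  by_cases hαβ : α * β = 0
  · rw [mul_assoc, hαβ, mul_zero]; exact zero_mem _
  -- The candidate `y` is read off at one label `π` of the cut `a`; it has to agree with `z`
  -- whatever the label of `b'`.
  obtain ⟨π, hπ, hαβπ⟩ := exists_atom_mul_ne_zero (h.cut_comm a) hαβ
  obtain ⟨y, hy, hzy⟩ := exists_mul_atom_eq (h.cut_comm a)
    (h.le_cm' le_rfl h1 h2 (by lia)) hz1 hπ
  have hαI : α ∈ I a' b := h.cut_le le_rfl h2 (by lia) hα.mem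
  have hβI : β ∈ I a' b := h.cut_le h2 le_rfl (by lia) hβ.mem
  suffices e : (z - y) * (α * β) = 0 by
    have : z * α * β = y * (α * β) := by
      rw [mul_assoc, ← sub_eq_zero, ← sub_mul, e]
    rw [this]
    exact mul_mem hy (mul_mem hαI hβI)
  refine eq_zero_of_forall_mul_atom (h.cut_comm b') fun σ hσ => ?_
  obtain ⟨x, hx, hzx⟩ := exists_mul_atom_eq (h.cut_comm b')
    (h.le_cm h2 h3 le_rfl (by lia)) hz2 hσ
  by_cases hαβσ : α * β * σ = 0
  · rw [mul_assoc, hαβσ, mul_zero]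
  have hl : ∀ {c p}, IsAtomProj (I c c) p → p ∈ labels I := fun hp => cut_le_labels I _ hp.mem
  obtain ⟨α', rfl⟩ : ∃ p : labels I, (p : Ω) = α := ⟨⟨α, hl hα⟩, rfl⟩
  obtain ⟨β', rfl⟩ : ∃ p : labels I, (p : Ω) = β := ⟨⟨β, hl hβ⟩, rfl⟩
  obtain ⟨π', rfl⟩ : ∃ p : labels I, (p : Ω) = π := ⟨⟨π, hl hπ⟩, rfl⟩
  obtain ⟨σ', rfl⟩ : ∃ p : labels I, (p : Ω) = σ := ⟨⟨σ, hl hσ⟩, rfl⟩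
  have e1 : α' * β' * π' ≠ 0 := fun e => hαβπ (congrArg Subtype.val e)
  have e2 : α' * β' * σ' ≠ 0 := fun e => hαβσ (congrArg Subtype.val e)
  have hπ' : IsAtomProj (I (a + M) (a + M)) (π' : Ω) := by rw [h.per]; exact hπ
  -- This is where the outer cuts must be uncorrelated: `σ` and `π` are then automatically
  -- compatible.
  have e3 : α' * σ' * π' ≠ 0 := by
    intro e
    refine hG (a := a') (b := b') (c := a + M) (by lia) h4 (by lia) hα hσ hπ' ?_ ?_ ?_
      (congrArg Subtype.val e)
    · exact fun e => ne_zero_of_mul (x := α' * σ') e2 β' (by ring) (Subtype.ext e)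
    · exact hu.symm.mul_ne_zero hσ.mem hπ.mem hσ.ne_zero hπ.ne_zero
    · exact fun e => ne_zero_of_mul (x := π' * α') e1 β' (by ring) (Subtype.ext e)
  have e4 : α' * σ' * β' * π' ≠ 0 := h.mul_ne_zero_of_block hM (a := a') (m := b) (b := b')
    (n := a + M) h2 h3 h4 (by lia) hα hβ.mem hσ hπ'.mem
    (ne_zero_of_mul e2 1 (by ring)) e3
  have e5 : (x - y) * ((σ' : Ω) * π') = 0 := by
    rw [sub_mul, ← mul_assoc x, ← hzx, sub_eq_zero,
      show (σ' : Ω) * π' = π' * σ' from congrArg Subtype.val (mul_comm σ' π'), ← mul_assoc y,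
      ← hzy, mul_assoc, mul_assoc,
      show (σ' : Ω) * π' = π' * σ' from congrArg Subtype.val (mul_comm σ' π')]
  -- The product `σ π` is nonzero on the block `α β`, and `x - y` is annihilated by it, so `x - y`
  -- vanishes on that block.
  have e6 : (x - y) * ((α' : Ω) * β') = 0 := by
    refine (h.block h2 (by lia) hα hβ (sub_mem hx hy)
      (mul_mem (h.cut_le h3 (by lia) (by lia) hσ.mem) (h.cut_le (by lia) (by lia) (by lia) hπ'.mem))
      (by rw [e5, zero_mul])).resolve_right fun e => ?_
    have e' : σ' * π' * (α' * β') = 0 := Subtype.ext e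
    exact e4 (by rw [← e']; ring)
  have e7 : ((α' : Ω) * β') * σ' = σ' * (α' * β') :=
    congrArg Subtype.val (mul_comm (α' * β') σ')
  rw [mul_assoc, e7, ← mul_assoc, sub_mul, hzx, ← sub_mul, mul_assoc, ← e7, ← mul_assoc, e6,
    zero_mul]

/-- The system seen in a mirror. -/
lemma mirror (h : CutSystem M I) : CutSystem M (fun a b => I (-b) (-a)) where
  per a b := by
    rw [← h.per (-(b + M))]; congr 1 <;> ring
  comm a b hab hb := by
    rw [h.cm_eq' (by lia) (by lia)]; congr 1; ring
  step a b hab hb := h.mono_left (by lia) (by lia) (by lia)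
  tri a b c hab hbc hc := by
    have := h.tri (-c) (-b) (-a) (by lia) (by lia) (by lia)
    have e1 : I (-(b + M)) (-c) = I (-b) (-c + M) := by
      rw [← h.per (-(b + M))]; congr 1; ring
    have e2 : I (-(a + M)) (-b) = I (-a) (-b + M) := by
      rw [← h.per (-(a + M))]; congr 1; ring
    simp only [e1, e2]
    refine le_trans (le_of_eq ?_) (this.trans (le_of_eq ?_))
    · rw [inf_comm (I (-a) (-b + M))]
    · rw [sup_comm (I (-c) (-c) ⊔ _), sup_comm (I (-c) (-c)), sup_assoc]

lemma Gluing.mirror (h : CutSystem M I) (hM : 0 < M) (hG : Gluing I M) :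
    Gluing (fun a b => I (-b) (-a)) M := by
  intro a b c hab hbc hc α β γ hα hβ hγ e1 e2 e3 e
  let := h.labelRing hM
  have hl : ∀ {c p}, IsAtomProj (I c c) p → p ∈ labels I := fun hp => cut_le_labels I _ hp.mem
  obtain ⟨α', rfl⟩ : ∃ p : labels I, (p : Ω) = α := ⟨⟨α, hl hα⟩, rfl⟩
  obtain ⟨β', rfl⟩ : ∃ p : labels I, (p : Ω) = β := ⟨⟨β, hl hβ⟩, rfl⟩
  obtain ⟨γ', rfl⟩ : ∃ p : labels I, (p : Ω) = γ := ⟨⟨γ, hl hγ⟩, rfl⟩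
  have hc : ∀ x y : labels I, (x : Ω) * y = y * x := fun x y => congrArg Subtype.val (mul_comm x y)
  refine hG (a := -c) (b := -b) (c := -a) (by lia) (by lia) (by lia) hγ hβ hα
    (by rwa [hc]) (by rwa [hc]) (by rwa [hc]) ?_
  have : γ' * β' * α' = α' * β' * γ' := by ring
  exact (congrArg Subtype.val this).trans e

end CutSystem
end QPartition

/-! ### Splitting the circle by an algebra whose end lies between two cuts. -/

namespace QPartition
variable {Ω : Type*} [CStarAlgebra Ω]
namespace CutSystem
variable {M : ℕ} {I : ℤ → ℤ → StarSubalgebra ℂ Ω}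
variable [FiniteDimensional ℂ Ω] [hΩ : Fact (IsFactor Ω)]

section HalfLine
variable {c₀ c u v e d₀ : ℤ} {R W : StarSubalgebra ℂ Ω}

/-- On a block of `d₀` and `c` the element becomes some `y` in `I c v`. Its commutators with `W` are
killed by an atom of `d₀`, hence vanish, so `y` localised at `c` still commutes with `R`. -/
lemma cm_inf_sup_cut_le (h : CutSystem M I) (hG : Gluing I M) (hc₀ : c₀ + M = d₀)
    (h1 : c₀ ≤ c) (h2 : c ≤ u) (h3 : u ≤ v) (h4 : v ≤ e) (h5 : e ≤ d₀) (hW : W ≤ I u e)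
    (hR : R = I v d₀ ⊔ W) (hu : Uncorrelated (I e e) (I d₀ d₀)) :
    cm R ⊓ (I c v ⊔ I d₀ d₀) ≤ (cm R ⊓ I c v) ⊔ I d₀ d₀ := by
  rintro z ⟨hzR, hz⟩
  rw [hR, cm_sup] at hzR
  refine mem_of_forall_mul_atom (h.cut_comm d₀) fun π hπ =>
    mem_of_forall_mul_atom (h.cut_comm c) fun α hα => ?_
  by_cases hπα : π * α = 0
  · rw [mul_assoc, hπα, mul_zero]; exact zero_mem _
  obtain ⟨y, hy, hzy⟩ := exists_mul_atom_eq (h.cut_comm d₀)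
    (h.le_cm (by lia) (by lia) le_rfl (by lia)) hz hπ
  have hαI : α ∈ I c v := h.cut_le le_rfl (by lia) (by lia) hα.mem
  have hπα' : α * π = π * α :=
    h.mul_comm_of_disjoint le_rfl (by lia) le_rfl (by lia) hα.mem hπ.mem
  have hyα : y * α ∈ cm R ⊓ I c v := by
    refine ⟨?_, mul_mem hy hαI⟩
    rw [hR, cm_sup]
    refine ⟨h.le_cm (by lia) le_rfl (by lia) (by lia) (mul_mem hy hαI), mem_cm.2 fun w hw => ?_⟩
    have hwI := hW hw
    have hwα : α * w = w * α :=
      h.mul_comm_of_disjoint le_rfl h2 (by lia) (by lia) hα.mem hwI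
    have hwπ : w * π = π * w :=
      h.mul_comm_of_disjoint (by lia) h5 le_rfl (by lia) hwI hπ.mem
    have hzw := mem_cm.1 hzR.2 w hw
    have hw' : w ∈ I c e := h.mono h2 (by lia) le_rfl (by lia) hwI
    have hy' : y * α ∈ I c e := h.mono le_rfl (by lia) h4 (by lia) (mul_mem hy hαI)
    rw [← sub_eq_zero]
    -- Compatibility with `π` holds at `e` by absence of correlations, and at `c` because only the
    -- label `α` occurs there.
    refine h.eq_zero_of_mul_atom hG (a := c) (b := e) (by lia) h5 (by lia)
      (sub_mem (mul_mem hw' hy') (mul_mem hy' hw')) hπ ?_ ?_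
    · have e1 : w * (y * α) * π = w * z * π * α := by
        rw [mul_assoc, mul_assoc, hπα', ← mul_assoc y, ← hzy]; simp only [mul_assoc]
      have e2 : y * α * w * π = z * w * π * α := by
        calc y * α * w * π = y * (α * (w * π)) := by simp only [mul_assoc]
          _ = y * (α * π) * w := by rw [hwπ]; simp only [mul_assoc]
          _ = y * π * (α * w) := by rw [hπα']; simp only [mul_assoc]
          _ = z * (π * w) * α := by rw [← hzy, hwα]; simp only [mul_assoc]
          _ = _ := by rw [← hwπ]; simp only [mul_assoc]
      rw [sub_mul, e1, e2, hzw, sub_self]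
    · intro α' ε hα' hε hne
      refine ⟨hu.mul_ne_zero hε.mem hπ.mem hε.ne_zero hπ.ne_zero, ?_⟩
      have : α = α' := by
        refine hα.eq_of_mul_ne_zero (h.cut_comm c) hα' fun e => hne ?_
        have e1 : (w * (y * α) - y * α * w) = (w * y - y * w) * α := by
          rw [mul_assoc y, hwα, sub_mul]; simp only [mul_assoc]
        rw [e1, mul_assoc, ← mul_assoc α, e, zero_mul, mul_zero]
      rwa [← this]
  have : z * π * α = y * α * π := by rw [hzy, mul_assoc, ← hπα', mul_assoc]
  rw [this]
  exact mul_mem ((le_sup_left : _ ≤ (cm R ⊓ I c v) ⊔ I d₀ d₀) hyα)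
    ((le_sup_right : _ ≤ (cm R ⊓ I c v) ⊔ I d₀ d₀) hπ.mem)

lemma half_le (h : CutSystem M I) (hc₀ : c₀ + M = d₀) (h2 : c₀ ≤ u) (h3 : u ≤ v)
    (h4 : v ≤ e) (h5 : e ≤ d₀) (hW : W ≤ I u e) (hR : R = I v d₀ ⊔ W) : R ≤ I u d₀ := by
  rw [hR]
  exact sup_le (h.mono h3 (by lia) le_rfl (by lia))
    (hW.trans (h.mono le_rfl (by lia) h5 (by lia)))

lemma le_cm_half (h : CutSystem M I) (hc₀ : c₀ + M = d₀) (h2 : c₀ ≤ u) (h3 : u ≤ v)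
    (h4 : v ≤ e) (h5 : e ≤ d₀) (hW : W ≤ I u e) (hR : R = I v d₀ ⊔ W) : I c₀ u ≤ cm R := by
  rw [← cm_le_cm_iff, cm_cm, h.cm_eq h2 (by lia), hc₀]
  exact h.half_le hc₀ h2 h3 h4 h5 hW hR

lemma cm_half_le (h : CutSystem M I) (hc₀ : c₀ + M = d₀) (h2 : c₀ ≤ u) (h3 : u ≤ v)
    (h4 : v ≤ e) (h5 : e ≤ d₀) (hR : R = I v d₀ ⊔ W) : cm R ≤ I c₀ v := by
  rw [← cm_le_cm_iff, cm_cm, h.cm_eq (by lia) (by lia), hc₀, hR]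
  exact le_sup_left

/-- The part of `cm R` that commutes with the cut `c` splits at `c`. -/
lemma cm_inf_cm_cut_le (h : CutSystem M I) (hG : Gluing I M) (hc₀ : c₀ + M = d₀)
    (h1 : c₀ ≤ c) (h2 : c ≤ u) (h3 : u ≤ v) (h4 : v ≤ e) (h5 : e ≤ d₀) (hW : W ≤ I u e)
    (hR : R = I v d₀ ⊔ W) (hu : Uncorrelated (I e e) (I d₀ d₀)) :
    cm R ⊓ cm (I c c) ≤ (cm R ⊓ I c v) ⊔ I c₀ c := by
  have hd₀ : I d₀ d₀ = I c₀ c₀ := by rw [← hc₀, h.per]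
  have hL := h.cm_half_le hc₀ (h1.trans h2) h3 h4 h5 hR
  have hL' := h.le_cm_half hc₀ (h1.trans h2) h3 h4 h5 hW hR
  have hP : I c₀ c ≤ cm R ⊓ cm (I c c) :=
    le_inf ((h.mono le_rfl h1 h2 (by lia)).trans hL') (h.le_cm h1 le_rfl le_rfl (by lia))
  have hZ : centre (I c₀ c) ≤ cm (cm R ⊓ cm (I c c)) := by
    rw [centre_eq]
    refine (h.centre_le h1 (by lia)).trans (sup_le ?_ ?_)
    · rw [← le_cm_comm, ← hd₀]
      refine inf_le_left.trans (hL.trans ?_)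
      exact h.le_cm (by lia) (by lia) le_rfl (by lia)
    · rw [← le_cm_comm]; exact inf_le_right
  -- Split off `I c₀ c`. What commutes with it and lies in `I c₀ v` is in `I c v` up to the centre
  -- of `c₀`, which is that of `d₀`.
  refine (le_sup_inf_cm hP hZ).trans (sup_le le_sup_right ?_)
  refine le_trans ?_ ((h.cm_inf_sup_cut_le hG hc₀ h1 h2 h3 h4 h5 hW hR hu).trans
    (sup_le_sup_left (by rw [hd₀]; exact h.cut_le le_rfl h1 (by lia)) _))
  refine le_inf (inf_le_left.trans inf_le_left) ?_
  rw [hd₀, h.cm_eq h1 (by lia)]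
  refine le_trans ?_ (h.meet h1 (h2.trans h3) (by lia))
  exact le_inf inf_le_right ((inf_le_left.trans inf_le_left).trans hL)

end HalfLine

/-- An algebra `R` that agrees with the algebra of the interval from a point between the cuts `u`
and `v` to the cut `d₀`, up to corrections localised near these two cuts. -/
structure Splitting (M : ℕ) (I : ℤ → ℤ → StarSubalgebra ℂ Ω) (c₀ d u v e d₀ : ℤ)
    (R : StarSubalgebra ℂ Ω) : Prop where
  per : c₀ + M = d₀
  le_d : c₀ ≤ d
  le_u : d ≤ u
  le_v : u ≤ v
  le_e : v ≤ e
  e_le : e ≤ d₀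
  right : ∃ W ≤ I u e, R = I v d₀ ⊔ W
  left : ∃ W ≤ I d v, cm R = I c₀ u ⊔ W
  unc_e : Uncorrelated (I e e) (I d₀ d₀)
  unc_d : Uncorrelated (I d d) (I d₀ d₀)
  unc_u : Uncorrelated (I u u) (I d₀ d₀)
  unc_v : Uncorrelated (I v v) (I d₀ d₀)

/-- The description of `R` near its right-hand form yields the one of `cm R`, with correction `cm R
⊓ I d v`. By double commutants it suffices that what commutes with `I c₀ u` and this correction lies
in `R`. -/
lemma splitting_of_le [Nontrivial Ω] (h : CutSystem M I) (hG : Gluing I M) {c₀ d u v e d₀ : ℤ}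
    {R W : StarSubalgebra ℂ Ω} (hc₀ : c₀ + M = d₀) (h1 : c₀ ≤ d) (h2 : d ≤ u) (h3 : u ≤ v)
    (h4 : v ≤ e) (h5 : e ≤ d₀) (hW : W ≤ I u e) (hR : R = I v d₀ ⊔ W)
    (hue : Uncorrelated (I e e) (I d₀ d₀)) (hud : Uncorrelated (I d d) (I d₀ d₀))
    (huu : Uncorrelated (I u u) (I d₀ d₀)) (huv : Uncorrelated (I v v) (I d₀ d₀))
    (hdu : Uncorrelated (I d d) (I u u)) : Splitting M I c₀ d u v e d₀ R := by
  refine ⟨hc₀, h1, h2, h3, h4, h5, ⟨W, hW, hR⟩, ⟨cm R ⊓ I d v, inf_le_right, ?_⟩,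
    hue, hud, huu, huv⟩
  have hL' := h.le_cm_half hc₀ (h1.trans h2) h3 h4 h5 hW hR
  refine le_antisymm ?_ (sup_le hL' inf_le_left)
  have hJ := h.cm_inf_cm_cut_le hG hc₀ h1 h2 h3 h4 h5 hW hR hue
  rw [← cm_le_cm_iff, cm_cm]
  intro z hz
  have hR' := h.half_le hc₀ (h1.trans h2) h3 h4 h5 hW hR
  have hz1 : z ∈ R ⊔ I d d := by
    rw [← cm_cm (R ⊔ I d d), cm_sup]
    refine cm_anti (hJ.trans (sup_le le_sup_right ?_)) hz
    exact le_sup_of_le_left (h.mono le_rfl h1 h2 (by lia))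
  have hz2 : z ∈ I u d₀ := by
    have := cm_anti (le_sup_left : I c₀ u ≤ I c₀ u ⊔ (cm R ⊓ I d v)) hz
    rwa [h.cm_eq (h1.trans h2) (by lia), hc₀] at this
  have hdM : I (d + M) (d + M) = I d d := h.per d d
  -- `z` lies in `R` up to the centre of `d`; an atom there removes it, since `d` is uncorrelated
  -- with both ends of `I u d₀`.
  obtain ⟨α, hα⟩ := exists_atom (h.cut_comm d)
  obtain ⟨y, hy, hzy⟩ := exists_mul_atom_eq (h.cut_comm d) (by
    rw [← hdM]; exact hR'.trans (h.le_cm (by lia) (by lia) le_rfl (by lia))) hz1 hα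
  have : z - y = 0 := by
    refine h.eq_zero_of_uncorrelated hG (a := u) (b := d₀) (w := d + M) (by lia) (by lia) (by lia)
      ?_ ?_ (sub_mem hz2 (hR' hy)) (π := α) ?_ (by rw [sub_mul, hzy, sub_self])
    · rw [hdM]; exact hdu.symm
    · rw [hdM]; exact hud.symm
    · rwa [hdM]
  rwa [sub_eq_zero.1 this]

namespace Splitting
variable {c₀ c d u v e d₀ : ℤ} {R : StarSubalgebra ℂ Ω}

/-- Reflection exchanges `R` and `cm R`, so each statement about one side yields the other. -/
lemma mirror (h : CutSystem M I) (s : Splitting M I c₀ d u v e d₀ R) :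
    Splitting M (fun a b => I (-b) (-a)) (-d₀) (-e) (-v) (-u) (-d) (-c₀) (cm R) := by
  have hd₀ : I d₀ d₀ = I c₀ c₀ := by rw [← s.per, h.per]
  have := s.per
  refine ⟨by lia, neg_le_neg s.e_le, neg_le_neg s.le_e, neg_le_neg s.le_v, neg_le_neg s.le_u,
    neg_le_neg s.le_d, ?_, ?_, ?_, ?_, ?_, ?_⟩ <;> simp only [neg_neg, cm_cm, ← hd₀]
  exacts [s.left, s.right, s.unc_d, s.unc_e, s.unc_v, s.unc_u]

lemma le_right (h : CutSystem M I) (s : Splitting M I c₀ d u v e d₀ R) : R ≤ I u d₀ := by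
  obtain ⟨W, hW, hR⟩ := s.right
  exact h.half_le s.per (s.le_d.trans s.le_u) s.le_v s.le_e s.e_le hW hR

lemma right_le (s : Splitting M I c₀ d u v e d₀ R) : I v d₀ ≤ R := by
  obtain ⟨W, hW, hR⟩ := s.right
  rw [hR]; exact le_sup_left

lemma cm_le_left (h : CutSystem M I) (s : Splitting M I c₀ d u v e d₀ R) : cm R ≤ I c₀ v := by
  simpa using (s.mirror h).le_right h.mirror

lemma left_le_cm (s : Splitting M I c₀ d u v e d₀ R) : I c₀ u ≤ cm R := by
  obtain ⟨W, hW, hR⟩ := s.left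
  rw [hR]; exact le_sup_left

lemma cm_inf_cm_cut_le (h : CutSystem M I) (hG : Gluing I M) (s : Splitting M I c₀ d u v e d₀ R)
    (h1 : c₀ ≤ c) (h2 : c ≤ u) : cm R ⊓ cm (I c c) ≤ (cm R ⊓ I c v) ⊔ I c₀ c := by
  obtain ⟨W, hW, hR⟩ := s.right
  exact h.cm_inf_cm_cut_le hG s.per h1 h2 s.le_v s.le_e s.e_le hW hR s.unc_e

lemma inf_cm_cut_le (h : CutSystem M I) (hM : 0 < M) (hG : Gluing I M)
    (s : Splitting M I c₀ d u v e d₀ R) (h1 : v ≤ c) (h2 : c ≤ d₀) :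
    R ⊓ cm (I c c) ≤ (R ⊓ I u c) ⊔ I c d₀ := by
  simpa [cm_cm] using (s.mirror h).cm_inf_cm_cut_le (c := -c) h.mirror (hG.mirror h hM)
    (neg_le_neg h2) (neg_le_neg h1)

/-- The centre of the new cut. -/
def cut (I : ℤ → ℤ → StarSubalgebra ℂ Ω) (u v : ℤ) (R : StarSubalgebra ℂ Ω) :
    StarSubalgebra ℂ Ω := R ⊓ cm R ⊓ I u v

/-- By `meet`, a central element lies in `I u v` up to the centre of `d₀`. At an atom of `d₀` it
becomes some `y` in `I u v`, and the commutators of `y` with both corrections are killed by this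
atom, hence zero. -/
lemma inf_cm_le [Nontrivial Ω] (h : CutSystem M I) (hG : Gluing I M)
    (s : Splitting M I c₀ d u v e d₀ R) : R ⊓ cm R ≤ cut I u v R ⊔ I d₀ d₀ := by
  rintro z ⟨hz1, hz2⟩
  have hd₀ : I d₀ d₀ = I c₀ c₀ := by rw [← s.per, h.per]
  obtain ⟨h0, h1, h2, h3, h4, h5, ⟨W, hW, hR⟩, ⟨W', hW', hR'⟩, hue, hud, huu, huv⟩ := id s
  have hz : z ∈ I u v ⊔ I d₀ d₀ := by
    rw [hd₀]
    refine h.meet (h1.trans h2) h3 (by lia) ⟨?_, s.cm_le_left h hz2⟩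
    rw [h0]; exact s.le_right h hz1
  refine mem_of_forall_mul_atom (h.cut_comm d₀) fun π hπ => ?_
  obtain ⟨y, hy, hzy⟩ := exists_mul_atom_eq (h.cut_comm d₀)
    (h.le_cm h3 (by lia) le_rfl (by lia)) hz hπ
  rw [hzy]
  have key : ∀ a b w, a ≤ u → v ≤ b → b ≤ d₀ → d₀ ≤ a + M → w ∈ I a b → z * w = w * z →
      Uncorrelated (I a a) (I d₀ d₀) → Uncorrelated (I b b) (I d₀ d₀) → w * y = y * w := by
    intro a b w ha hb hbd hda hw hzw hua hub
    have hy' : y ∈ I a b := h.mono ha h3 hb (by lia) hy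
    have hwπ : w * π = π * w :=
      h.mul_comm_of_disjoint (by lia) hbd le_rfl hda hw hπ.mem
    rw [← sub_eq_zero]
    refine h.eq_zero_of_uncorrelated hG (by lia) hbd hda hua hub
      (sub_mem (mul_mem hw hy') (mul_mem hy' hw)) hπ ?_
    rw [sub_mul, mul_assoc, mul_assoc, hwπ, ← hzy, ← mul_assoc, ← hzw, mul_assoc,
      ← mul_assoc y, ← hzy, hwπ, mul_assoc, sub_self]
  refine mul_mem (?_ : y ∈ cut I u v R ⊔ I d₀ d₀) ((le_sup_right : _ ≤ cut I u v R ⊔ _) hπ.mem)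
  refine (le_sup_left : _ ≤ cut I u v R ⊔ _) ⟨⟨?_, ?_⟩, hy⟩
  · rw [← cm_cm R, hR', cm_sup]
    refine ⟨h.le_cm' (h1.trans h2) le_rfl h3 (by lia) hy, mem_cm.2 fun w hw => ?_⟩
    refine key d v w h2 le_rfl (by lia) (by lia) (hW' hw) ?_ hud huv
    exact le_cm_iff.1 (le_refl (cm (cm R))) z (by rwa [cm_cm]) w
      (by rw [hR']; exact (le_sup_right : W' ≤ _) hw)
  · rw [hR, cm_sup]
    refine ⟨h.le_cm h3 le_rfl (by lia) (by lia) hy, mem_cm.2 fun w hw => ?_⟩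
    refine key u e w le_rfl h4 h5 (by lia) (hW hw) ?_ huu hue
    exact le_cm_iff.1 (le_refl (cm R)) z hz2 w (by rw [hR]; exact (le_sup_right : W ≤ _) hw)

/-- Both ends of `I u v` are uncorrelated with `d₀`, so the centre of `d₀` can be dropped. -/
lemma mem_of_mem_sup [Nontrivial Ω] (h : CutSystem M I) (hG : Gluing I M)
    (s : Splitting M I c₀ d u v e d₀ R) {Y : StarSubalgebra ℂ Ω} (hY : Y ≤ I u v) {z : Ω}
    (hz : z ∈ Y ⊔ I d₀ d₀) (hz' : z ∈ I u v) : z ∈ Y := by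
  obtain ⟨h0, h1, h2, h3, h4, h5, -, -, hue, hud, huu, huv⟩ := id s
  obtain ⟨π, hπ⟩ := exists_atom (h.cut_comm d₀)
  obtain ⟨y, hy, hzy⟩ := exists_mul_atom_eq (h.cut_comm d₀)
    (hY.trans (h.le_cm h3 (by lia) le_rfl (by lia))) hz hπ
  have := h.eq_zero_of_uncorrelated hG h3 (by lia) (by lia) huu huv (sub_mem hz' (hY hy)) hπ
    (by rw [sub_mul, hzy, sub_self])
  rwa [sub_eq_zero.1 this]

/-- The centre of the algebra between the new cut and the cut `c`. -/
lemma centre_inf_le [Nontrivial Ω] (h : CutSystem M I) (hM : 0 < M) (hG : Gluing I M)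
    (s : Splitting M I c₀ d u v e d₀ R) (h1 : v ≤ c) (h2 : c ≤ d₀) :
    (R ⊓ I u c) ⊓ cm (R ⊓ I u c) ≤ cut I u v R ⊔ I c c := by
  rintro z ⟨⟨hzR, hzI⟩, hz⟩
  have h0 := s.per
  have hdu := s.le_d.trans s.le_u
  have huv := s.le_v
  have hcR : I c c ≤ R := (h.cut_le h1 h2 (by lia)).trans s.right_le
  have hz1 : z ∈ cm R ⊔ I c c := by
    rw [← cm_cm (cm R ⊔ I c c), cm_sup, cm_cm]
    refine cm_anti (s.inf_cm_cut_le h hM hG h1 h2) ?_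
    rw [cm_sup]
    exact ⟨hz, h.le_cm (by lia) le_rfl h2 (by lia) hzI⟩
  have hz2 : z ∈ cut I u v R ⊔ I c c ⊔ I d₀ d₀ := by
    have : z ∈ (I c c ⊔ cm R) ⊓ cm (cm R) := ⟨by rwa [sup_comm], by rwa [cm_cm]⟩
    rw [sup_inf_cm_self (by rwa [cm_cm]), centre_cm, centre_eq] at this
    refine (sup_le ?_ ((s.inf_cm_le h hG).trans (sup_le ?_ le_sup_right)) :
      I c c ⊔ R ⊓ cm R ≤ _) this
    · exact le_sup_of_le_left le_sup_right
    · exact le_sup_of_le_left le_sup_left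
  have hle : cut I u v R ⊔ I c c ≤ I u c :=
    sup_le (inf_le_right.trans (h.mono le_rfl huv h1 (by lia))) (h.cut_le (by lia) le_rfl (by lia))
  refine mem_of_forall_mul_atom (h.cut_comm c) fun δ hδ => ?_
  -- The cut `c` may be close to `d₀`, even equal to it; so `π` is chosen compatible with `δ`
  -- instead of arbitrary.
  obtain ⟨π, hπ, hδπ⟩ := exists_atom_mul_ne_zero (h.cut_comm d₀) hδ.ne_zero
  obtain ⟨y, hy, hzy⟩ := exists_mul_atom_eq (h.cut_comm d₀)
    (hle.trans (h.le_cm (by lia) h2 le_rfl (by lia))) hz2 hπ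
  have hδI : δ ∈ I u c := h.cut_le (by lia) le_rfl (by lia) hδ.mem
  have hδπ' : δ * π = π * δ :=
    h.mul_comm_of_disjoint le_rfl h2 le_rfl (by lia) hδ.mem hπ.mem
  have e0 : (z - y) * δ = 0 := by
    refine h.eq_zero_of_mul_atom hG (by lia) h2 (by lia)
      (mul_mem (sub_mem hzI (hle hy)) hδI) hπ ?_ ?_
    · rw [mul_assoc, hδπ', ← mul_assoc, sub_mul, hzy, sub_self, zero_mul]
    · intro α β hα hβ hne
      refine ⟨?_, s.unc_u.symm.mul_ne_zero hπ.mem hα.mem hπ.ne_zero hα.ne_zero⟩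
      have : δ = β := by
        refine hδ.eq_of_mul_ne_zero (h.cut_comm c) hβ fun e => hne ?_
        have : α * β = β * α := h.mul_comm_of_disjoint le_rfl (by lia) le_rfl (by lia)
          hα.mem hβ.mem
        rw [this, mul_assoc, ← mul_assoc δ, e, zero_mul, mul_zero]
      rwa [← this]
  have : z * δ = y * δ := by rwa [sub_mul, sub_eq_zero] at e0
  rw [this]
  exact mul_mem hy ((le_sup_right : _ ≤ cut I u v R ⊔ _) hδ.mem)

lemma centre_cm_inf_le [Nontrivial Ω] (h : CutSystem M I) (hM : 0 < M) (hG : Gluing I M)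
    (s : Splitting M I c₀ d u v e d₀ R) (h1 : c₀ ≤ c) (h2 : c ≤ u) :
    (cm R ⊓ I c v) ⊓ cm (cm R ⊓ I c v) ≤ cut I u v R ⊔ I c c := by
  have := (s.mirror h).centre_inf_le (c := -c) h.mirror hM (hG.mirror h hM)
    (neg_le_neg h2) (neg_le_neg h1)
  simpa [cut, cm_cm, inf_comm (cm R) R] using this

/-- The triangle condition for the new cut and its two neighbours. -/
lemma inf_cm_inf_cm_le [Nontrivial Ω] (h : CutSystem M I) (hM : 0 < M) (hG : Gluing I M)
    (s : Splitting M I c₀ d u v e d₀ R) :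
    I u v ⊓ cm (cm R ⊓ I u v) ⊓ cm (R ⊓ I u v) ≤ I u u ⊔ I v v ⊔ cut I u v R := by
  rintro z ⟨⟨hz, hzF⟩, hzG⟩
  obtain ⟨h0, h1, h2, h3, h4, h5, -, -, hue, hud, huu, huv⟩ := id s
  have huR : I u u ≤ cm R := (h.cut_le (h1.trans h2) le_rfl (by lia)).trans s.left_le_cm
  have hvR : I v v ≤ R := (h.cut_le le_rfl (by lia) (by lia)).trans s.right_le
  have hz1 : z ∈ I u u ⊔ R := by
    rw [← cm_cm (I u u ⊔ R), cm_sup, inf_comm]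
    refine cm_anti (s.cm_inf_cm_cut_le h hG (h1.trans h2) le_rfl) ?_
    rw [cm_sup]
    exact ⟨hzF, h.le_cm' (by lia) le_rfl h3 (by lia) hz⟩
  have hz2 : z ∈ cm (R ⊓ cm (I v v)) := by
    refine cm_anti (s.inf_cm_cut_le h hM hG le_rfl (by lia)) ?_
    rw [cm_sup]
    exact ⟨hzG, h.le_cm h3 le_rfl (by lia) (by lia) hz⟩
  -- Two uses of the modular law leave the centres of `u` and `v` and that of `R`. The last
  -- contributes `cut I u v R` and the centre of `d₀`, which is then removed.
  have hz3 : z ∈ (I u u ⊔ R) ⊓ cm (R ⊓ cm (I v v)) := ⟨hz1, hz2⟩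
  rw [sup_inf_cm huR inf_le_left, cm_inf, cm_cm, sup_comm (cm R), inf_comm R] at hz3
  have e1 := sup_inf_cm_self (P := I v v) (Q := cm R) (by rwa [cm_cm])
  rw [cm_cm] at e1
  rw [e1, centre_cm, centre_eq] at hz3
  refine s.mem_of_mem_sup h hG (sup_le (sup_le ?_ ?_) inf_le_right) (?_ : _ ∈ _ ⊔ I d₀ d₀) hz
  · exact h.cut_le le_rfl h3 (by lia)
  · exact h.cut_le h3 le_rfl (by lia)
  refine (sup_le ?_ (sup_le ?_ ((s.inf_cm_le h hG).trans (sup_le ?_ le_sup_right))) :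
      I u u ⊔ (I v v ⊔ R ⊓ cm R) ≤ _) hz3
  · exact le_sup_of_le_left (le_sup_of_le_left le_sup_left)
  · exact le_sup_of_le_left (le_sup_of_le_left le_sup_right)
  · exact le_sup_of_le_left le_sup_right

end Splitting
end CutSystem
end QPartition

/-! ### Replacing one cut in a cut system. -/

namespace QPartition
variable {Ω : Type*} [CStarAlgebra Ω]
namespace CutSystem
variable {M : ℕ} {I : ℤ → ℤ → StarSubalgebra ℂ Ω}

open Classical in
/-- The system obtained from `I` by replacing the cut `x` by a new one, with centre `C` and with
algebra `P d` between `x` and `d`. -/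
noncomputable def insertCut (M : ℕ) (I : ℤ → ℤ → StarSubalgebra ℂ Ω) (x : ℤ)
    (P : ℤ → StarSubalgebra ℂ Ω) (C : StarSubalgebra ℂ Ω) (a b : ℤ) : StarSubalgebra ℂ Ω :=
  if (M : ℤ) ∣ a - x then
    if (M : ℤ) ∣ b - x then if b ≤ a then C else cm C else P (b - a + x)
  else if (M : ℤ) ∣ b - x then cm (P (a - b + M + x)) else I a b

section Insert
variable {x : ℤ} {P : ℤ → StarSubalgebra ℂ Ω} {C : StarSubalgebra ℂ Ω}

lemma not_dvd_sub {M : ℕ} {x d : ℤ} (h1 : x < d) (h2 : d < x + M) : ¬ (M : ℤ) ∣ d - x := fun h => by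
  have := Int.le_of_dvd (by lia) h; lia

lemma not_dvd_sub' {M : ℕ} {x c : ℤ} (h1 : x - M < c) (h2 : c < x) : ¬ (M : ℤ) ∣ c - x := fun h => by
  rw [← neg_sub, dvd_neg] at h
  have := Int.le_of_dvd (by lia) h; lia

lemma insertCut_per (I : ℤ → ℤ → StarSubalgebra ℂ Ω) (hI : ∀ a b, I (a + M) (b + M) = I a b)
    (a b : ℤ) : insertCut M I x P C (a + M) (b + M) = insertCut M I x P C a b := by
  have e : ∀ c : ℤ, (M : ℤ) ∣ c + M - x ↔ (M : ℤ) ∣ c - x := fun c => by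
    rw [show c + M - x = c - x + M by ring]; exact dvd_add_self_right
  simp only [insertCut, e, hI, add_le_add_iff_right]
  congr 3 <;> ring_nf

lemma insertCut_self : insertCut M I x P C x x = C := by simp [insertCut]

lemma insertCut_full (hM : 0 < M) : insertCut M I x P C x (x + M) = cm C := by
  have : ¬ (x + M ≤ x) := by lia
  simp [insertCut, this]

lemma insertCut_left {d : ℤ} (h1 : x < d) (h2 : d < x + M) : insertCut M I x P C x d = P d := by
  simp [insertCut, not_dvd_sub h1 h2]

lemma insertCut_right {c : ℤ} (h1 : x - M < c) (h2 : c < x) :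
    insertCut M I x P C c x = cm (P (c + M)) := by
  simp only [insertCut, not_dvd_sub' h1 h2, sub_self, dvd_zero, if_true, if_false]
  congr 2; ring

lemma insertCut_of_not_dvd {a b : ℤ} (ha : ¬ (M : ℤ) ∣ a - x) (hb : ¬ (M : ℤ) ∣ b - x) :
    insertCut M I x P C a b = I a b := by
  simp [insertCut, ha, hb]

lemma per_int (hI : ∀ a b, I (a + M) (b + M) = I a b) (k a b : ℤ) :
    I (a + k * M) (b + k * M) = I a b := by
  induction k using Int.induction_on with
  | zero => simp
  | succ k ih => rw [← ih, ← hI (a + k * M)]; congr 1 <;> ring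
  | pred k ih => rw [← ih, ← hI (a + (-k - 1) * M)]; congr 1 <;> ring

variable [FiniteDimensional ℂ Ω] [hΩ : Fact (IsFactor Ω)]

/-- The algebra of an interval, as seen from the four cuts `p, q, r, s` around the circle. -/
lemma quad (h : CutSystem M I) {p q r s : ℤ} (h1 : p ≤ q) (h2 : q ≤ r) (h3 : r ≤ s)
    (h4 : s ≤ p + M) :
    I p s ⊓ cm (I p q) ⊓ cm (I q r ⊔ I r s) ≤ I p p ⊔ (I q q ⊔ I r r ⊔ I s s) := by
  have e1 : I p s ⊓ cm (I p q) ≤ I p p ⊔ I q s := by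
    rw [h.cm_eq h1 (by lia), inf_comm, sup_comm]
    exact h.meet h1 (by lia) h4
  refine (inf_le_inf_right _ e1).trans ?_
  rw [sup_inf_cm (h.le_cm le_rfl h1 (by lia) h4) (sup_le (h.mono le_rfl h2 h3 (by lia))
    (h.mono h2 h3 le_rfl (by lia)))]
  refine sup_le_sup_left (le_trans ?_ (h.tri q r s h2 h3 (by lia))) _
  rw [cm_sup, h.cm_eq h2 (by lia), h.cm_eq h3 (by lia)]
  exact le_inf inf_le_right inf_le_left

set_option maxHeartbeats 1000000 in
-- Only the triangle axiom is substantial. Rotation brings `x` to the middle of any triangle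
-- containing it. The modular law then reduces that triangle to the local one between `x - 1`, `x`
-- and `x + 1`, at the price of extra cut centres that are eliminated one by one.
theorem insert (h : CutSystem M I) (hM : 2 ≤ M) (x : ℤ) (P : ℤ → StarSubalgebra ℂ Ω)
    (C : StarSubalgebra ℂ Ω)
    (hC : C ≤ P (x + 1)) (hC' : C ≤ cm (P (x - 1 + M)))
    (hstep : ∀ d, x < d → d < x - 1 + M → P d ≤ P (d + 1))
    (hle : ∀ d, x < d → d < x + M → P d ≤ I (x - 1) d)
    (hge : ∀ d, x < d → d < x + M → I (x + 1) d ≤ P d)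
    (htri : I (x - 1) (x + 1) ⊓ P (x - 1 + M) ⊓ cm (P (x + 1)) ≤
      I (x - 1) (x - 1) ⊔ I (x + 1) (x + 1) ⊔ C)
    (hcen : ∀ d, x < d → d < x + M → P d ⊓ cm (P d) ≤ C ⊔ I d d) :
    CutSystem M (insertCut M I x P C) := by
  set J := insertCut M I x P C with hJ
  have hper : ∀ a b, J (a + M) (b + M) = J a b := insertCut_per I h.per
  have hperZ := per_int hper
  have hIper := per_int h.per
  have hself : J x x = C := insertCut_self
  have hfull : J x (x + M) = cm C := insertCut_full (by lia)
  have hleft : ∀ d, x < d → d < x + M → J x d = P d := fun d h1 h2 => insertCut_left h1 h2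
  have hright : ∀ c, x - M < c → c < x → J c x = cm (P (c + M)) := fun c h1 h2 =>
    insertCut_right h1 h2
  have hnot : ∀ a b, ¬ (M : ℤ) ∣ a - x → ¬ (M : ℤ) ∣ b - x → J a b = I a b :=
    fun a b ha hb => insertCut_of_not_dvd ha hb
  have hcase : ∀ a, (∃ k, a = x + k * M) ∨ ¬ (M : ℤ) ∣ a - x := by
    intro a
    by_cases ha : (M : ℤ) ∣ a - x
    · obtain ⟨k, hk⟩ := ha
      exact Or.inl ⟨k, by rw [mul_comm k]; lia⟩
    · exact Or.inr ha
  have hdvd : ∀ a k : ℤ, (M : ℤ) ∣ a + k * M - x ↔ (M : ℤ) ∣ a - x := fun a k => by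
    rw [show a + k * M - x = a - x + k * M by ring]
    exact dvd_add_left (dvd_mul_left _ _)
  have hPmono : ∀ d d' : ℤ, x < d → d ≤ d' → d' < x + M → P d ≤ P d' := by
    intro d d' hd hdd' hd'
    induction d', hdd' using Int.leInduction with
    | base => exact le_rfl
    | succ n hn ih => exact (ih (by lia)).trans (hstep n (by lia) (by lia))
  have hcomm : ∀ a b : ℤ, a ≤ b → b ≤ a + M → J b (a + M) = cm (J a b) := by
    intro a b hab hb
    rcases hcase a with ⟨k, rfl⟩ | ha
    · have e1 := hperZ k x (b - k * M)
      have e2 := hperZ k (b - k * M) (x + M)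
      rw [sub_add_cancel] at e1 e2
      rw [e1, show x + k * M + M = x + M + k * M by ring, e2]
      rcases eq_or_lt_of_le (show x ≤ b - k * M by lia) with hd | hd
      · rw [← hd, hfull, hself]
      rcases eq_or_lt_of_le (show b - k * M ≤ x + M by lia) with hd' | hd'
      · rw [hd', hfull, hper, hself, cm_cm]
      · rw [hleft _ hd hd', ← sub_add_cancel (b - k * M) (M : ℤ), hper,
          hright _ (by lia) (by lia)]
    rcases hcase b with ⟨k, rfl⟩ | hb'
    · have e1 := hperZ k (a - k * M) x
      have e2 := hperZ k x (a - k * M + M)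
      rw [sub_add_cancel] at e1
      rw [show a - k * M + M + k * M = a + M by ring] at e2
      rw [e1, e2]
      have ha1 : x ≠ a - k * M := fun e => ha ⟨k, by rw [mul_comm (M : ℤ)]; lia⟩
      have ha2 : a - k * M ≠ x - M := fun e => ha ⟨k - 1, by rw [mul_sub, mul_comm (M : ℤ)]; lia⟩
      rw [hright _ (by lia) (by lia), hleft _ (by lia) (by lia), cm_cm]
    · rw [hnot a b ha hb', hnot _ _ hb' (by simpa using (hdvd a 1).not.2 ha), h.comm a b hab hb]
  have hstep' : ∀ a b : ℤ, a ≤ b → b < a + M → J a b ≤ J a (b + 1) := by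
    intro a b hab hb
    rcases hcase a with ⟨k, rfl⟩ | ha
    · have e1 := hperZ k x (b - k * M)
      have e2 := hperZ k x (b - k * M + 1)
      rw [sub_add_cancel] at e1
      rw [show b - k * M + 1 + k * M = b + 1 by ring] at e2
      rw [e1, e2]
      generalize hd : b - k * M = d
      rcases eq_or_lt_of_le (show x ≤ d by lia) with hd | hd
      · rw [← hd, hself, hleft _ (by lia) (by lia)]; exact hC
      rw [hleft d hd (by lia)]
      rcases eq_or_lt_of_le (show d + 1 ≤ x + M by lia) with hd' | hd'
      · rw [hd', hfull, le_cm_comm, show d = x - 1 + M by lia]; exact hC'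
      · rw [hleft _ (by lia) hd']; exact hstep d hd (by lia)
    rcases hcase b with ⟨k, rfl⟩ | hb'
    · have e1 := hperZ k (a - k * M) x
      have e2 := hperZ k (a - k * M) (x + 1)
      rw [sub_add_cancel] at e1 e2
      rw [show x + 1 + k * M = x + k * M + 1 by ring] at e2
      rw [e1, e2]
      have ha1 : x ≠ a - k * M := fun e => ha ⟨k, by rw [mul_comm (M : ℤ)]; lia⟩
      have ha3 : ¬ (M : ℤ) ∣ (a - k * M) - x := by
        rw [← hdvd _ k, sub_add_cancel]; exact ha
      have hc1 : x - M < a - k * M := by lia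
      have hc2 : a - k * M < x := by lia
      clear e1 e2
      generalize a - k * M = c at ha1 ha3 hc1 hc2 ⊢
      rw [hright c (by lia) (by lia), hnot c _ ha3 (not_dvd_sub (by lia) (by lia)),
        ← cm_le_cm_iff, cm_cm, h.cm_eq (by lia) (by lia)]
      exact hge _ (by lia) (by lia)
    rcases hcase (b + 1) with ⟨k, hk⟩ | hb''
    · obtain rfl : b = x - 1 + k * M := by lia
      have e1 := hperZ k (a - k * M) (x - 1)
      have e2 := hperZ k (a - k * M) x
      rw [sub_add_cancel] at e1 e2
      rw [hk, e1, e2]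
      have ha1 : x - M ≠ a - k * M := fun e => ha ⟨k - 1, by rw [mul_sub, mul_comm (M : ℤ)]; lia⟩
      have ha3 : ¬ (M : ℤ) ∣ (a - k * M) - x := by
        rw [← hdvd _ k, sub_add_cancel]; exact ha
      have hc1 : x - M < a - k * M := by lia
      have hc2 : a - k * M < x := by lia
      clear e1 e2
      generalize a - k * M = c at ha1 ha3 hc1 hc2 ⊢
      rw [hright c (by lia) (by lia), hnot c _ ha3 (not_dvd_sub' (by lia) (by lia)), le_cm_comm,
        h.cm_eq (by lia) (by lia)]
      exact hle _ (by lia) (by lia)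
    · rw [hnot a b ha hb', hnot a _ ha hb'']
      exact h.step a b hab hb
  have hcenL : ∀ d, x ≤ d → d ≤ x + M → J x d ⊓ cm (J x d) ≤ C ⊔ J d d := by
    intro d h1 h2
    rcases eq_or_lt_of_le h1 with hd | hd
    · rw [← hd, hself]; exact inf_le_of_left_le le_sup_left
    rcases eq_or_lt_of_le h2 with hd' | hd'
    · rw [hd', hfull, cm_cm]; exact inf_le_of_right_le le_sup_left
    have hdx := not_dvd_sub hd hd'
    rw [hleft d hd hd', hnot d d hdx hdx]
    exact hcen d hd hd'
  have hcenR : ∀ c, x - M ≤ c → c ≤ x → J c x ⊓ cm (J c x) ≤ J c c ⊔ C := by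
    intro c h1 h2
    rw [← hcomm c x h2 (by lia), show J c x = cm (J x (c + M)) by
      rw [hcomm c x h2 (by lia), cm_cm], inf_comm, sup_comm, ← hper c c]
    exact hcenL _ (by lia) (by lia)
  have htriX : ∀ a c : ℤ, a ≤ x → x ≤ c → c ≤ a + M →
      J x (a + M) ⊓ J c (x + M) ⊓ J a c ≤ J a a ⊔ J x x ⊔ J c c := by
    intro a c ha hc hca
    rw [hself]
    rcases eq_or_lt_of_le ha with rfl | ha'
    · refine le_trans ?_ ((hcenL c hc hca).trans (sup_le ?_ le_sup_right))
      · rw [← hcomm a c hc hca]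
        exact le_inf inf_le_right (inf_le_left.trans inf_le_right)
      · exact le_sup_of_le_left le_sup_right
    rcases eq_or_lt_of_le hc with rfl | hc'
    · refine le_trans ?_ ((hcenR a (by lia) ha).trans le_sup_left)
      rw [← hcomm a x ha (by lia)]
      exact le_inf inf_le_right (inf_le_left.trans inf_le_left)
    have hax := not_dvd_sub' (M := M) (x := x) (c := a) (by lia) ha'
    have hcx := not_dvd_sub (M := M) (x := x) (d := c) hc' (by lia)
    have e1 : J c (x + M) = cm (P c) := by rw [hcomm x c hc (by lia), hleft c hc' (by lia)]
    rw [hleft (a + M) (by lia) (by lia), e1, hnot a c hax hcx, hnot a a hax hax, hnot c c hcx hcx]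
    have hPc : I (x + 1) c ≤ P c := hge c hc' (by lia)
    have hPa : P (a + M) ≤ I (x - 1) (a + M) := hle _ (by lia) (by lia)
    have hPa' : P (x - 1 + M) ≤ I (x - 1) (x - 1 + M) := hle _ (by lia) (by lia)
    have hCK : C ≤ I (x - 1) (x + 1) := hC.trans (hle _ (by lia) (by lia))
    have hGF : P (x + 1) ≤ P (x - 1 + M) := hPmono _ _ (by lia) (by lia) (by lia)
    have hGc : P (x + 1) ≤ P c := hPmono _ _ (by lia) (by lia) (by lia)
    have haF : P (a + M) ≤ P (x - 1 + M) := hPmono _ _ (by lia) (by lia) (by lia)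
    have hca' : P c ≤ P (a + M) := hPmono _ _ (by lia) (by lia) (by lia)
    have hKc : cm (I (x - 1) (x + 1)) = I (x + 1) (x - 1 + M) := h.cm_eq (by lia) (by lia)
    have hvP : I (x + 1) (x + 1) ≤ P (x + 1) := hge _ (by lia) (by lia)
    rintro z ⟨⟨hz1, hz2⟩, hz3⟩
    have s1 : z ∈ I (x - 1) (x + 1) ⊔ cm (I (x - 1) (x + 1)) := by
      rw [← cm_centre, centre_eq]
      refine cm_anti (h.centre_le (by lia) (by lia)) ?_
      rw [cm_sup]
      refine ⟨?_, cm_anti (hvP.trans hGc) hz2⟩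
      rw [h.cm_eq le_rfl (by lia)]
      exact hPa' (haF hz1)
    set K := I (x - 1) (x + 1)
    -- The component in `K` satisfies the local triangle; the centres of `x - 1` and `x + 1` are
    -- absorbed by `cm K`.
    have s2 : z ∈ C ⊔ cm K := by
      have : z ∈ (cm K ⊔ K) ⊓ cm (cm (P (x - 1 + M)) ⊔ P (x + 1)) := by
        refine ⟨by rwa [sup_comm], ?_⟩
        rw [cm_sup, cm_cm]
        exact ⟨haF hz1, cm_anti hGc hz2⟩
      have hFK : cm (P (x - 1 + M)) ≤ K := by
        rw [← cm_le_cm_iff, cm_cm, hKc]; exact hge _ (by lia) (by lia)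
      rw [sup_inf_cm le_rfl (sup_le hFK (hle _ (by lia) (by lia))), cm_sup, cm_cm,
        ← inf_assoc] at this
      refine (sup_le le_sup_right (htri.trans (sup_le (sup_le ?_ ?_) le_sup_left)) :
        cm K ⊔ _ ≤ _) this
      · rw [hKc, ← h.per (x - 1) (x - 1)]
        exact le_sup_of_le_right (h.cut_le (by lia) le_rfl (by lia))
      · rw [hKc]
        exact le_sup_of_le_right (h.cut_le le_rfl (by lia) (by lia))
    -- The component outside `K` is reduced by `quad` to the centres of four cuts, of which `x - 1`
    -- and `x + 1` are unwanted.
    have s3 : z ∈ C ⊔ (I (x + 1) (x + 1) ⊔ (I c c ⊔ I (a + M) (a + M) ⊔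
        I (x - 1 + M) (x - 1 + M))) := by
      have : z ∈ (C ⊔ cm K) ⊓ cm (I (x + 1) c ⊔ (I c (a + M) ⊔ I (a + M) (x - 1 + M))) := by
        refine ⟨s2, ?_⟩
        rw [cm_sup, cm_sup]
        refine ⟨cm_anti hPc hz2, h.le_cm (by lia) le_rfl hca le_rfl hz3, ?_⟩
        exact h.le_cm (by lia) le_rfl (by lia) (by lia) (hPa hz1)
      rw [hKc, sup_inf_cm (by rw [← hKc, cm_cm]; exact hCK)
        (sup_le (h.mono le_rfl (by lia) (by lia) (by lia)) (sup_le
        (h.mono (by lia) (by lia) (by lia) (by lia)) (h.mono (by lia) (by lia) le_rfl (by lia)))),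
        cm_sup, ← inf_assoc] at this
      exact (sup_le_sup_left (h.quad (by lia) hca (by lia) (by lia)) C) this
    rw [h.per, h.per] at s3
    have hcP : I c c ≤ P c := (h.cut_le (by lia) le_rfl (by lia)).trans hPc
    have haP : I a a ≤ cm (P (a + M)) := by
      rw [← le_cm_comm, h.cm_eq le_rfl (by lia)]
      exact hPa.trans (h.mono (by lia) (by lia) le_rfl (by lia))
    have huP : I (x - 1) (x - 1) ≤ cm (P (x - 1 + M)) := by
      rw [← le_cm_comm, h.cm_eq le_rfl (by lia)]; exact hPa'
    -- Intersecting with `P (a + M)` trades the centre of `x - 1` for the centre of `P (a + M)`,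
    -- controlled by `hcen`.
    have s4 : z ∈ (I (x + 1) (x + 1) ⊔ I c c) ⊔ (I a a ⊔ C) := by
      have hP1 : I (x + 1) (x + 1) ⊔ I c c ≤ cm (cm (P (a + M))) := by
        rw [cm_cm]
        exact sup_le (hvP.trans (hGc.trans hca')) (hcP.trans hca')
      have : z ∈ ((I (x + 1) (x + 1) ⊔ I c c) ⊔ cm (P (a + M))) ⊓ cm (cm (P (a + M))) := by
        refine ⟨?_, by rwa [cm_cm]⟩
        refine (sup_le ?_ (sup_le ?_ (sup_le (sup_le ?_ ?_) ?_)) : C ⊔ _ ≤ _) s3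
        · exact le_sup_of_le_right (hC'.trans (cm_anti haF))
        · exact le_sup_of_le_left le_sup_left
        · exact le_sup_of_le_left le_sup_right
        · exact le_sup_of_le_right haP
        · exact le_sup_of_le_right (huP.trans (cm_anti haF))
      rw [sup_inf_cm_self hP1, centre_cm, centre_eq] at this
      refine (sup_le_sup_left ((hcen (a + M) (by lia) (by lia)).trans ?_) _) this
      rw [h.per, sup_comm]
    -- Likewise, commutation with `P c` eliminates the centre of `x + 1`.
    have s5 : z ∈ (I a a ⊔ P c) ⊓ cm (P c) := by
      refine ⟨(sup_le (sup_le ?_ ?_) (sup_le le_sup_left ?_) :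
        (I (x + 1) (x + 1) ⊔ I c c) ⊔ (I a a ⊔ C) ≤ _) s4, hz2⟩
      · exact le_sup_of_le_right (hvP.trans hGc)
      · exact le_sup_of_le_right hcP
      · exact le_sup_of_le_right (hC.trans hGc)
    rw [sup_inf_cm_self (haP.trans (cm_anti hca')), centre_eq] at s5
    rw [sup_assoc]
    exact (sup_le_sup_left (hcen c hc' (by lia)) _) s5
  refine ⟨hper, hcomm, hstep', ?_⟩
  have htriB : ∀ a b c, (∃ k, b = x + k * M) → a ≤ b → b ≤ c → c ≤ a + M →
      J b (a + M) ⊓ J c (b + M) ⊓ J a c ≤ J a a ⊔ J b b ⊔ J c c := by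
    rintro a b c ⟨k, rfl⟩ hab hbc hca
    have := htriX (a - k * M) (c - k * M) (by lia) (by lia) (by lia)
    rw [← hperZ k x, ← hperZ k (c - k * M), ← hperZ k (a - k * M), ← hperZ k (a - k * M),
      ← hperZ k x, ← hperZ k (c - k * M) (c - k * M)] at this
    convert this using 3 <;> ring_nf
  intro a b c hab hbc hca
  by_cases hb : ∃ k, b = x + k * M
  · exact htriB a b c hb hab hbc hca
  by_cases ha : ∃ k, a = x + k * M
  · have := htriB (c - M) a b ha (by lia) hab (by lia)
    rw [← hper (c - M) b, ← hper (c - M) (c - M), sub_add_cancel] at this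
    refine le_trans (le_inf (le_inf inf_le_right ?_) ?_)
      (this.trans (sup_le (sup_le le_sup_right ?_) ?_))
    · exact inf_le_left.trans inf_le_left
    · exact inf_le_left.trans inf_le_right
    · exact le_sup_of_le_left le_sup_left
    · exact le_sup_of_le_left le_sup_right
  by_cases hc : ∃ k, c = x + k * M
  · have := htriB b c (a + M) hc hbc hca (by lia)
    rw [hper a c, hper a a] at this
    refine le_trans (le_inf (le_inf ?_ inf_le_right) ?_)
      (this.trans (sup_le (sup_le ?_ le_sup_right) ?_))
    · exact inf_le_left.trans inf_le_right
    · exact inf_le_left.trans inf_le_left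
    · exact le_sup_of_le_left le_sup_right
    · exact le_sup_of_le_left le_sup_left
  have ha' := (hcase a).resolve_left ha
  have hb' := (hcase b).resolve_left hb
  have hc' := (hcase c).resolve_left hc
  have hM1 : ∀ a, ¬ (M : ℤ) ∣ a - x → ¬ (M : ℤ) ∣ a + M - x := fun a ha => by
    simpa using (hdvd a 1).not.2 ha
  rw [hnot b _ hb' (hM1 a ha'), hnot c _ hc' (hM1 b hb'), hnot a c ha' hc', hnot a a ha' ha',
    hnot b b hb' hb', hnot c c hc' hc']
  exact h.tri a b c hab hbc hca

end Insert
end CutSystem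
end QPartition

/-! ### The cut system produced by a splitting. -/

namespace QPartition
variable {Ω : Type*} [CStarAlgebra Ω]
namespace CutSystem
variable {M : ℕ} {I : ℤ → ℤ → StarSubalgebra ℂ Ω}
variable [FiniteDimensional ℂ Ω] [hΩ : Fact (IsFactor Ω)]

namespace Splitting
variable {c₀ c d x e d₀ : ℤ} {R : StarSubalgebra ℂ Ω}

/-- The algebra between the new cut `x` and the cut `d`. -/
noncomputable def newArc (M : ℕ) (I : ℤ → ℤ → StarSubalgebra ℂ Ω) (x d₀ : ℤ)
    (R : StarSubalgebra ℂ Ω) (d : ℤ) : StarSubalgebra ℂ Ω :=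
  if d ≤ d₀ then R ⊓ I (x - 1) d else cm (cm R ⊓ I (d - M) (x + 1))

/-- The system obtained by replacing the cut `x` by the one that `R` defines. -/
noncomputable def split (M : ℕ) (I : ℤ → ℤ → StarSubalgebra ℂ Ω) (x d₀ : ℤ)
    (R : StarSubalgebra ℂ Ω) : ℤ → ℤ → StarSubalgebra ℂ Ω :=
  insertCut M I x (newArc M I x d₀ R) (cut I (x - 1) (x + 1) R)

lemma newArc_of_le (h1 : d ≤ d₀) : newArc M I x d₀ R d = R ⊓ I (x - 1) d := if_pos h1

/-- The two formulas for the new intervals, short of `d₀` and beyond it, agree at `d₀`; this permits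
using either one there. -/
lemma newArc_of_ge (h : CutSystem M I) (s : Splitting M I c₀ c (x - 1) (x + 1) e d₀ R)
    (h1 : d₀ ≤ d) : newArc M I x d₀ R d = cm (cm R ⊓ I (d - M) (x + 1)) := by
  rcases eq_or_lt_of_le h1 with rfl | h1
  · rw [newArc_of_le le_rfl, inf_eq_left.2 (s.le_right h), ← s.per, add_sub_cancel_right,
      inf_eq_left.2 (s.cm_le_left h), cm_cm]
  · exact if_neg (by lia)

theorem cutSystem_split [Nontrivial Ω] (h : CutSystem M I) (hM : 2 ≤ M) (hG : Gluing I M)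
    (s : Splitting M I c₀ c (x - 1) (x + 1) e d₀ R) : CutSystem M (split M I x d₀ R) := by
  obtain ⟨h0, h1, h2, -, h4, h5, -⟩ := id s
  have hge := fun {d} => s.newArc_of_ge h (d := d)
  have hu := hge (d := x - 1 + M) (by lia)
  rw [add_sub_cancel_right] at hu
  have hv : newArc M I x d₀ R (x + 1) = R ⊓ I (x - 1) (x + 1) := newArc_of_le (by lia)
  refine h.insert hM x _ _ ?_ ?_ ?_ ?_ ?_ ?_ ?_
  · rw [hv]; exact inf_le_inf_right _ inf_le_left
  · rw [hu, cm_cm]; exact inf_le_inf_right _ inf_le_right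
  · intro d hd hd'
    by_cases hd₀ : d < d₀
    · rw [newArc_of_le hd₀.le, newArc_of_le (by lia)]
      exact inf_le_inf_left _ (h.mono le_rfl (by lia) (by lia) (by lia))
    · rw [hge (by lia), hge (by lia)]
      exact cm_anti (inf_le_inf_left _ (h.mono (by lia) (by lia) le_rfl (by lia)))
  · intro d hd hd'
    by_cases hd₀ : d ≤ d₀
    · rw [newArc_of_le hd₀]; exact inf_le_right
    · have : I (x - 1) d = cm (I (d - M) (x - 1)) := by
        rw [h.cm_eq (by lia) (by lia), sub_add_cancel]
      rw [hge (by lia), this]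
      refine cm_anti (le_inf (le_trans ?_ s.left_le_cm) ?_)
      · exact h.mono (by lia) (by lia) le_rfl (by lia)
      · exact h.mono le_rfl (by lia) (by lia) (by lia)
  · intro d hd hd'
    by_cases hd₀ : d ≤ d₀
    · rw [newArc_of_le hd₀]
      refine le_inf (le_trans ?_ s.right_le) ?_
      · exact h.mono le_rfl (by lia) (by lia) (by lia)
      · exact h.mono (by lia) (by lia) le_rfl (by lia)
    · have : I (x + 1) d = cm (I (d - M) (x + 1)) := by
        rw [h.cm_eq (by lia) (by lia), sub_add_cancel]
      rw [hge (by lia), this]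
      exact cm_anti inf_le_right
  · rw [hu, hv]
    exact s.inf_cm_inf_cm_le h (by lia) hG
  · intro d hd hd'
    by_cases hd₀ : d ≤ d₀
    · rw [newArc_of_le hd₀]
      exact s.centre_inf_le h (by lia) hG (by lia) hd₀
    · rw [hge (by lia), cm_cm, inf_comm, ← h.per_sub d d]
      exact s.centre_cm_inf_le h (by lia) hG (by lia) (by lia)

lemma split_left_of_le (s : Splitting M I c₀ c (x - 1) (x + 1) e d₀ R) (h1 : x < d) (h2 : d ≤ d₀) :
    split M I x d₀ R x d = R ⊓ I (x - 1) d := by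
  have := s.per; have := s.le_d; have := s.le_u
  rw [split, insertCut_left h1 (by lia), newArc_of_le h2]

lemma split_left_of_ge (h : CutSystem M I) (s : Splitting M I c₀ c (x - 1) (x + 1) e d₀ R)
    (h1 : d₀ ≤ d) (h2 : d < x + M) : split M I x d₀ R x d = R ⊔ I (x + 1) d := by
  have := s.per; have := s.e_le; have := s.le_e
  rw [split, insertCut_left (by lia) (by lia), s.newArc_of_ge h h1, cm_inf, cm_cm,
    h.cm_eq (by lia) (by lia), sub_add_cancel]

lemma split_right_of_ge (h : CutSystem M I) (s : Splitting M I c₀ c (x - 1) (x + 1) e d₀ R)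
    (h1 : c₀ ≤ d) (h2 : d < x) : split M I x d₀ R d x = cm R ⊓ I d (x + 1) := by
  have := s.per; have := s.e_le; have := s.le_e
  rw [split, insertCut_right (by lia) (by lia), s.newArc_of_ge h (by lia), cm_cm,
    add_sub_cancel_right]

lemma split_right_of_le (h : CutSystem M I) (s : Splitting M I c₀ c (x - 1) (x + 1) e d₀ R)
    (h1 : x - M < d) (h2 : d ≤ c₀) : split M I x d₀ R d x = cm R ⊔ I d (x - 1) := by
  have := s.per; have := s.le_d; have := s.le_u
  rw [split, insertCut_right (by lia) (by lia), newArc_of_le (by lia), cm_inf,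
    h.cm_eq' (by lia) (by lia), add_sub_cancel_right]

lemma split_of_not_dvd {a b : ℤ} (ha : ¬ (M : ℤ) ∣ a - x) (hb : ¬ (M : ℤ) ∣ b - x) :
    split M I x d₀ R a b = I a b := insertCut_of_not_dvd ha hb

lemma split_inf_le (h : CutSystem M I) (s : Splitting M I c₀ c (x - 1) (x + 1) e d₀ R) :
    split M I x d₀ R (x - 1) x ⊓ split M I x d₀ R x (x + 1) ≤ split M I x d₀ R x x := by
  have := s.le_e; have := s.e_le; have := s.le_d; have := s.le_u
  rw [s.split_right_of_ge h (by lia) (by lia), s.split_left_of_le (by lia) (by lia), split,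
    insertCut_self]
  exact le_inf (le_inf (inf_le_right.trans inf_le_left) (inf_le_left.trans inf_le_left))
    (inf_le_left.trans inf_le_right)

end Splitting
end CutSystem
end QPartition

/-! ### From partitions over a cycle to cut systems. -/

namespace QPartition
variable {Ω : Type*} [CStarAlgebra Ω]

lemma centre_comm (G : StarSubalgebra ℂ Ω) : centre G ≤ cm (centre G) := by
  rw [centre_eq]
  exact inf_le_right.trans (cm_anti inf_le_left)

section Bipartition
variable [FiniteDimensional ℂ Ω] {F₁ F₂ G : StarSubalgebra ℂ Ω}

lemma atom_comm {p g : Ω} (hp : IsAtomProj (centre G) p) (hg : g ∈ G) : g * p = p * g := by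
  have := hp.mem
  rw [centre_eq] at this
  exact mem_cm.1 this.2 g hg

lemma IsBipartition.le_cm (h : IsBipartition F₁ F₂ G) : F₂ ≤ cm F₁ := by
  intro g hg
  refine mem_cm.2 fun f hf => ?_
  rw [← sub_eq_zero]
  refine eq_zero_of_forall_mul_atom (centre_comm G) fun p hp => ?_
  have hg' := h.le_right hg
  have hf' := h.le_left hf
  have := (h.right_eq p hp).subset ⟨g, hg, rfl⟩
  have e := this.2 (p * f) ⟨f, hf, rfl⟩
  have hpp : p * p = p := hp.proj.isIdempotentElem
  have e1 : ∀ x y, x ∈ G → y ∈ G → p * x * (p * y) = x * y * p := by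
    intro x y hx hy
    rw [← mul_assoc, mul_assoc p, atom_comm hp hx, ← mul_assoc, hpp, mul_assoc,
      atom_comm hp (mul_mem hx hy)]
  rw [e1 g f hg' hf', e1 f g hf' hg'] at e
  rw [sub_mul, e, sub_self]

/-- Summing over the blocks of `G` replaces the blockwise commutant condition by an inclusion suited
to the lattice calculus. -/
lemma IsBipartition.inf_cm_le (h : IsBipartition F₁ F₂ G) : G ⊓ cm F₁ ≤ F₂ ⊔ centre G := by
  rintro z ⟨hz, hz'⟩
  refine mem_of_forall_mul_atom (centre_comm G) fun p hp => ?_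
  have hpp : p * p = p := hp.proj.isIdempotentElem
  have : p * z ∈ compress p F₂ := by
    rw [h.right_eq p hp]
    refine ⟨⟨z, hz, rfl⟩, ?_⟩
    rintro _ ⟨f, hf, rfl⟩
    have hf' := h.le_left hf
    rw [← mul_assoc, mul_assoc p, atom_comm hp hz, ← mul_assoc, hpp, mul_assoc,
      ← mul_assoc (p * f), mul_assoc p f, atom_comm hp hf', ← mul_assoc p p, hpp, mul_assoc p f,
      mem_cm.1 hz' f hf]
  obtain ⟨f, hf, e⟩ := this
  rw [atom_comm hp hz, e]
  exact mul_mem ((le_sup_right : _ ≤ F₂ ⊔ centre G) hp.mem)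
    ((le_sup_left : _ ≤ F₂ ⊔ centre G) hf)

/-- The converse passage to blocks: an element of `p G` commuting with `p F₁` commutes with `F₁`,
and `p` makes the centre of `G` scalar. -/
lemma compress_eq_of_inf_cm_le (h1 : F₁ ≤ G) (h2 : F₂ ≤ G) (hc : F₂ ≤ cm F₁)
    (h : G ⊓ cm F₁ ≤ F₂ ⊔ centre G) {p : Ω} (hp : IsAtomProj (centre G) p) :
    compress p F₂ = {x ∈ compress p G | ∀ y ∈ compress p F₁, x * y = y * x} := by
  have hpp : p * p = p := hp.proj.isIdempotentElem
  have hpG : p ∈ G := by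
    have := hp.mem; rw [centre_eq] at this; exact this.1
  ext x
  constructor
  · rintro ⟨g, hg, rfl⟩
    refine ⟨⟨g, h2 hg, rfl⟩, ?_⟩
    rintro _ ⟨f, hf, rfl⟩
    rw [← mul_assoc, mul_assoc p, atom_comm hp (h2 hg), ← mul_assoc, hpp, mul_assoc,
      ← mul_assoc (p * f), mul_assoc p f, atom_comm hp (h1 hf), ← mul_assoc p p, hpp, mul_assoc p f,
      mem_cm.1 (hc hg) f hf]
  · rintro ⟨⟨g, hg, rfl⟩, hx⟩
    have hz : p * g ∈ G ⊓ cm F₁ := by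
      refine ⟨mul_mem hpG hg, mem_cm.2 fun f hf => ?_⟩
      have e := hx (p * f) ⟨f, hf, rfl⟩
      have e1 : p * g * (p * f) = p * g * f := by
        rw [← mul_assoc, mul_assoc p, atom_comm hp hg, ← mul_assoc, hpp]
      have e2 : p * f * (p * g) = f * (p * g) := by
        rw [← atom_comm hp (h1 hf), mul_assoc, ← mul_assoc p p, hpp]
      rw [e1, e2] at e
      exact e.symm
    obtain ⟨y, hy, e⟩ := exists_mul_atom_eq (centre_comm G)
      (by rw [centre_eq, le_cm_comm]; exact inf_le_right.trans (cm_anti h2)) (h hz) hp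
    refine ⟨y, hy, ?_⟩
    rw [← atom_comm hp (h2 hy), ← e, ← atom_comm hp hg, mul_assoc, hpp]

lemma isBipartition_of_inf_cm_le (h1 : F₁ ≤ G) (h2 : F₂ ≤ G) (hc : F₂ ≤ cm F₁)
    (h : G ⊓ cm F₁ ≤ F₂ ⊔ centre G) (h' : G ⊓ cm F₂ ≤ F₁ ⊔ centre G) : IsBipartition F₁ F₂ G :=
  ⟨h1, h2, fun _ hp => compress_eq_of_inf_cm_le h1 h2 hc h hp,
    fun _ hp => compress_eq_of_inf_cm_le h2 h1 (le_cm_comm.1 hc) h' hp⟩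

end Bipartition

section Arcs
variable {N : ℕ}

/-- The vertices `p, p + 1, …, q - 1` of the cycle `ZMod N`. -/
def intArc (N : ℕ) (p q : ℤ) : Set (ZMod N) := {x | ∃ i : ℤ, p ≤ i ∧ i < q ∧ x = i}

lemma arc_eq_intArc (p : ℤ) (k : ℕ) : arc (p : ZMod N) k = intArc N p (p + k + 1) := by
  ext x
  constructor
  · rintro ⟨i, hi, rfl⟩
    exact ⟨p + i, by lia, by lia, by push_cast; rfl⟩
  · rintro ⟨i, h1, h2, rfl⟩
    refine ⟨(i - p).toNat, by lia, ?_⟩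
    have : ((i - p).toNat : ℤ) = i - p := Int.toNat_of_nonneg (by lia)
    have h3 : (((i - p).toNat : ℤ) : ZMod N) = ((i - p : ℤ) : ZMod N) := by rw [this]
    push_cast at h3
    rw [h3]; ring

lemma intArc_singleton (p : ℤ) : intArc N p (p + 1) = {(p : ZMod N)} := by
  ext x
  constructor
  · rintro ⟨i, h1, h2, rfl⟩
    obtain rfl : i = p := by lia
    rfl
  · rintro rfl
    exact ⟨p, le_rfl, by lia, rfl⟩

lemma exists_int_mem_Ico (hN : 0 < N) (x : ZMod N) (a : ℤ) :
    ∃ i : ℤ, a ≤ i ∧ i < a + N ∧ x = i := by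
  obtain ⟨j, rfl⟩ := ZMod.intCast_surjective x
  have hN' : (0 : ℤ) < N := by exact_mod_cast hN
  refine ⟨a + (j - a) % N, by have := Int.emod_nonneg (j - a) hN'.ne'; lia,
    by have := Int.emod_lt_of_pos (j - a) hN'; lia, ?_⟩
  have := Int.emod_add_mul_ediv (j - a) N
  have h2 : ((((j - a) % N + N * ((j - a) / N) : ℤ)) : ZMod N) = ((j - a : ℤ) : ZMod N) := by rw [this]
  push_cast at h2 ⊢
  rw [ZMod.natCast_self, zero_mul, add_zero] at h2
  rw [h2]; ring

lemma intCast_eq_iff {i j : ℤ} : (i : ZMod N) = j ↔ (N : ℤ) ∣ j - i :=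
  ZMod.intCast_eq_intCast_iff_dvd_sub i j N

lemma eq_of_intCast_eq {i j : ℤ} (h : (i : ZMod N) = j) (h1 : i - N < j) (h2 : j < i + N) :
    i = j := by
  rw [intCast_eq_iff] at h
  by_contra hne
  rcases lt_or_gt_of_ne hne with hlt | hlt
  · have := Int.le_of_dvd (by lia) h; lia
  · rw [← neg_sub, dvd_neg] at h
    have := Int.le_of_dvd (by lia) h; lia

lemma compl_intArc (hN : 0 < N) {p q : ℤ} :
    (intArc N p q)ᶜ = intArc N q (p + N) := by
  ext x
  constructor
  · intro hx
    obtain ⟨i, h1, h2, rfl⟩ := exists_int_mem_Ico hN x p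
    refine ⟨i, ?_, h2, rfl⟩
    by_contra hi
    exact hx ⟨i, h1, by lia, rfl⟩
  · rintro ⟨i, h1, h2, rfl⟩ ⟨j, h3, h4, e⟩
    have := eq_of_intCast_eq e (by lia) (by lia)
    lia

lemma intArc_univ (hN : 0 < N) (p : ℤ) : intArc N p (p + N) = Set.univ := by
  rw [← compl_intArc hN, Set.compl_univ_iff]
  ext x
  simp only [Set.mem_empty_iff_false, iff_false]
  rintro ⟨i, h1, h2, -⟩
  lia

lemma intArc_mono {p q p' q' : ℤ} (hp : p' ≤ p) (hq : q ≤ q') : intArc N p q ⊆ intArc N p' q' := by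
  rintro _ ⟨i, h1, h2, rfl⟩
  exact ⟨i, by lia, by lia, rfl⟩

lemma intArc_add (p q : ℤ) : intArc N (p + N) (q + N) = intArc N p q := by
  ext x
  constructor
  · rintro ⟨i, h1, h2, rfl⟩
    exact ⟨i - N, by lia, by lia, by simp⟩
  · rintro ⟨i, h1, h2, rfl⟩
    exact ⟨i + N, by lia, by lia, by simp⟩

lemma intArc_union {p q r : ℤ} (h1 : p ≤ q) (h2 : q ≤ r) :
    intArc N p q ∪ intArc N q r = intArc N p r := by
  refine Set.Subset.antisymm (Set.union_subset (intArc_mono le_rfl h2) (intArc_mono h1 le_rfl)) ?_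
  rintro _ ⟨i, h3, h4, rfl⟩
  by_cases hi : i < q
  · exact Or.inl ⟨i, h3, hi, rfl⟩
  · exact Or.inr ⟨i, by lia, h4, rfl⟩

end Arcs

section Coarse
variable {N : ℕ} {A : Set (ZMod N) → StarSubalgebra ℂ Ω}

lemma IsPartition.mono {V : Type*} {A : Set V → StarSubalgebra ℂ Ω} (hA : IsPartition A)
    {S T : Set V} (h : S ⊆ T) : A S ≤ A T := by
  have := (hA.bipartition S (T \ S) Set.disjoint_sdiff_right).le_left
  rwa [Set.union_sdiff_cancel h] at this

variable [FiniteDimensional ℂ Ω] [hΩ : Fact (IsFactor Ω)]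

/-- The union is the factor itself, whose centre is trivial, so there is a single block. -/
lemma IsPartition.compl {V : Type*} {A : Set V → StarSubalgebra ℂ Ω} (hA : IsPartition A)
    (S : Set V) : A Sᶜ = cm (A S) := by
  have h := hA.bipartition S Sᶜ disjoint_compl_right
  refine le_antisymm h.le_cm ?_
  have := h.inf_cm_le
  rwa [Set.union_compl_self, hA.univ, top_inf_eq, show centre (⊤ : StarSubalgebra ℂ Ω) = ⊥
    from hΩ.out, sup_bot_eq] at this

/-- The system of cuts between the neighbouring vertices of a partition over a cycle; the cut `p`
lies between the vertices `p - 1` and `p`. -/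
noncomputable def coarse (A : Set (ZMod N) → StarSubalgebra ℂ Ω) (p q : ℤ) :
    StarSubalgebra ℂ Ω :=
  if q = p then centre (A {((p - 1 : ℤ) : ZMod N)}) ⊓ centre (A {(p : ZMod N)})
  else if q = p + N then
    cm (centre (A {((p - 1 : ℤ) : ZMod N)}) ⊓ centre (A {(p : ZMod N)}))
  else A (intArc N p q)

lemma coarse_self (p : ℤ) :
    coarse A p p = centre (A {((p - 1 : ℤ) : ZMod N)}) ⊓ centre (A {(p : ZMod N)}) := if_pos rfl

lemma coarse_full (hN : 0 < N) (p : ℤ) : coarse A p (p + N) = cm (coarse A p p) := by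
  rw [coarse_self, coarse, if_neg (by lia), if_pos rfl]

lemma coarse_arc {p q : ℤ} (h1 : p < q) (h2 : q < p + N) : coarse A p q = A (intArc N p q) := by
  rw [coarse, if_neg (by lia), if_neg (by lia)]

lemma coarse_per (p q : ℤ) : coarse A (p + N) (q + N) = coarse A p q := by
  have e : (((p + N : ℤ) - 1 : ℤ) : ZMod N) = ((p - 1 : ℤ) : ZMod N) := by push_cast; simp
  simp only [coarse, intArc_add, add_left_inj, e, Int.cast_add, Int.cast_natCast,
    ZMod.natCast_self, add_zero]

/-- Strong connectivity expresses the centres of intervals by cuts, and the bipartition of adjacent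
intervals then gives the triangle axiom. -/
lemma cutSystem_coarse (hA : IsStronglyConnectedPartition A) (hN : 2 ≤ N) :
    CutSystem N (coarse A) := by
  have hP := hA.isPartition
  have hcomm : ∀ a b : ℤ, a ≤ b → b ≤ a + N → coarse A b (a + N) = cm (coarse A a b) := by
    intro a b hab hb
    rcases eq_or_lt_of_le hab with rfl | hab'
    · rw [coarse_full (by lia)]
    rcases eq_or_lt_of_le hb with rfl | hb'
    · rw [coarse_full (by lia), cm_cm, coarse_per]
    · rw [coarse_arc hab' hb', coarse_arc hb' (by lia), ← hP.compl,
        compl_intArc (by lia)]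
  have hcen : ∀ a b : ℤ, a ≤ b → b ≤ a + N →
      coarse A a b ⊓ cm (coarse A a b) ≤ coarse A a a ⊔ coarse A b b := by
    intro a b hab hb
    rcases eq_or_lt_of_le hab with rfl | hab'
    · exact inf_le_of_left_le le_sup_left
    rcases eq_or_lt_of_le hb with rfl | hb'
    · rw [coarse_full (by lia), cm_cm]; exact inf_le_of_right_le le_sup_left
    have := hA.centre_arc (a : ZMod N) (b - a - 1).toNat (by lia)
    have hk : ((b - a - 1).toNat : ℤ) = b - a - 1 := Int.toNat_of_nonneg (by lia)
    have hk' : ((b - a - 1).toNat : ZMod N) = b - a - 1 := by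
      rw [← Int.cast_natCast, hk]; push_cast; ring
    rw [arc_eq_intArc, hk, hk'] at this
    rw [coarse_arc hab' hb', ← centre_eq, show b = a + (b - a - 1) + 1 by ring, this,
      ← show b = a + (b - a - 1) + 1 by ring, coarse_self, coarse_self]
    push_cast
    refine le_of_eq ?_
    congr 6 <;> ring
  have hstep : ∀ a b : ℤ, a ≤ b → b < a + N → coarse A a b ≤ coarse A a (b + 1) := by
    intro a b hab hb
    rcases eq_or_lt_of_le hab with rfl | hab'
    · rw [coarse_self, coarse_arc (by lia) (by lia), intArc_singleton, centre_eq (A {(a : ZMod N)})]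
      exact inf_le_right.trans inf_le_left
    rcases eq_or_lt_of_le (show b + 1 ≤ a + N by lia) with hb' | hb'
    · have : intArc N a b = {((a - 1 : ℤ) : ZMod N)}ᶜ := by
        rw [← intArc_singleton, compl_intArc (by lia)]; congr 1 <;> lia
      rw [hb', coarse_full (by lia), coarse_arc hab' hb, this, hP.compl, coarse_self,
        centre_eq (A {((a - 1 : ℤ) : ZMod N)})]
      exact cm_anti (inf_le_left.trans inf_le_left)
    · rw [coarse_arc hab' hb, coarse_arc (by lia) hb']
      exact hP.mono (intArc_mono le_rfl (by lia))
  refine ⟨coarse_per, hcomm, hstep, ?_⟩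
  intro a b c hab hbc hc
  rcases eq_or_lt_of_le hab with rfl | hab'
  · refine le_trans ?_ ((hcen a c hbc hc).trans (sup_le_sup_right le_sup_left _))
    rw [← hcomm a c hbc hc]
    exact le_inf inf_le_right (inf_le_left.trans inf_le_right)
  rcases eq_or_lt_of_le hbc with rfl | hbc'
  · refine le_trans ?_ ((hcen a b hab hc).trans le_sup_left)
    rw [← hcomm a b hab hc]
    exact le_inf inf_le_right (inf_le_left.trans inf_le_left)
  rcases eq_or_lt_of_le hc with rfl | hc'
  · refine le_trans ?_ ((hcen a b hab (by lia)).trans le_sup_left)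
    rw [← hcomm a b hab (by lia), coarse_per]
    exact le_inf (inf_le_left.trans inf_le_right) (inf_le_left.trans inf_le_left)
  have hdis : Disjoint (intArc N a b) (intArc N b c) := by
    rw [← Set.subset_compl_iff_disjoint_left, compl_intArc (by lia)]
    exact intArc_mono le_rfl hc
  have hbip := hP.bipartition _ _ hdis
  rw [intArc_union hab hbc] at hbip
  have h1 : coarse A a c ⊓ cm (coarse A a b) ≤
      coarse A b c ⊔ (coarse A a c ⊓ cm (coarse A a c)) := by
    rw [coarse_arc hab' (by lia), coarse_arc hbc' (by lia), coarse_arc (by lia) hc', ← centre_eq]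
    exact hbip.inf_cm_le
  have hle : coarse A b c ≤ coarse A a c := by
    rw [coarse_arc hbc' (by lia), coarse_arc (by lia) hc']
    exact hP.mono (intArc_mono hab le_rfl)
  rw [hcomm a b hab (by lia), hcomm b c hbc (by lia)]
  rintro z ⟨⟨hz1, hz2⟩, hz3⟩
  -- The bipartition puts `z` in `coarse A b c` up to the centre of the union; commuting with
  -- `coarse A b c` reduces that factor to its centre.
  have hz : z ∈ ((coarse A a c ⊓ cm (coarse A a c)) ⊔ coarse A b c) ⊓ cm (coarse A b c) :=
    ⟨by rw [sup_comm]; exact h1 ⟨hz3, hz1⟩, hz2⟩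
  rw [sup_inf_cm_self (inf_le_right.trans (cm_anti hle)), centre_eq] at hz
  refine (sup_le ((hcen a c (by lia) hc).trans ?_) ((hcen b c hbc (by lia)).trans ?_) :
    _ ≤ coarse A a a ⊔ coarse A b b ⊔ coarse A c c) hz
  · exact sup_le_sup_right le_sup_left _
  · exact sup_le_sup_right le_sup_right _

lemma CutSystem.comap {N M : ℕ} {I : ℤ → ℤ → StarSubalgebra ℂ Ω} (h : CutSystem N I) {f : ℤ → ℤ}
    (hf : Monotone f) (hfM : ∀ a, f (a + M) = f a + N) :
    CutSystem M (fun a b => I (f a) (f b)) where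
  per a b := by rw [hfM, hfM, h.per]
  comm a b hab hb := by rw [hfM]; exact h.comm _ _ (hf hab) (hfM a ▸ hf hb)
  step a b hab hb := h.mono_right (hf hab) (hf (by lia)) (hfM a ▸ hf (by lia))
  tri a b c hab hbc hc := by
    rw [hfM, hfM]; exact h.tri _ _ _ (hf hab) (hf hbc) (hfM a ▸ hf hc)

end Coarse
end QPartition

/-! ### From cut systems to partitions. -/

namespace QPartition
variable {Ω : Type*} [CStarAlgebra Ω]
namespace CutSystem
variable {M : ℕ} {I : ℤ → ℤ → StarSubalgebra ℂ Ω}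

/-- The algebra that a cut system assigns to a set of vertices, where the vertex `k` lies between
the cuts `k` and `k + 1`: it is generated by the algebras of the intervals in this set. -/
def part (M : ℕ) (I : ℤ → ℤ → StarSubalgebra ℂ Ω) (S : Set (ZMod M)) : StarSubalgebra ℂ Ω :=
  ⨆ (a : ℤ) (b : ℤ) (_ : a < b ∧ b ≤ a + M ∧ intArc M a b ⊆ S), I a b

lemma le_part {S : Set (ZMod M)} {a b : ℤ} (h1 : a < b) (h2 : b ≤ a + M)
    (h3 : intArc M a b ⊆ S) : I a b ≤ part M I S :=
  le_iSup₂_of_le a b (le_iSup_of_le ⟨h1, h2, h3⟩ le_rfl)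

lemma part_le {S : Set (ZMod M)} {Y : StarSubalgebra ℂ Ω}
    (h : ∀ a b : ℤ, a < b → b ≤ a + M → intArc M a b ⊆ S → I a b ≤ Y) : part M I S ≤ Y :=
  iSup₂_le fun a b => iSup_le fun hab => h a b hab.1 hab.2.1 hab.2.2

lemma part_mono {S T : Set (ZMod M)} (h : S ⊆ T) : part M I S ≤ part M I T :=
  part_le fun _ _ h1 h2 h3 => le_part h1 h2 (h3.trans h)

lemma part_empty : part M I ∅ = ⊥ := by
  refine le_bot_iff.1 (part_le fun a b h1 _ h3 => ?_)
  exact (h3 ⟨a, le_rfl, h1, rfl⟩).elim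

lemma eq_of_forall_eq_pred {γ : Type*} {cl : ℤ → γ} {a b : ℤ}
    (h : ∀ j, a < j → j < b → cl (j - 1) = cl j) {i : ℤ} (h1 : a ≤ i) (h2 : i < b) :
    cl i = cl a := by
  induction i, h1 using Int.leInduction with
  | base => rfl
  | succ n hn ih =>
    have := h (n + 1) (by lia) h2
    rw [add_sub_cancel_right] at this
    rw [← this, ih (by lia)]

lemma exists_shift_arc (hI : ∀ a b, I (a + M) (b + M) = I a b) (hM : 0 < M) (a b : ℤ) (o : ℤ) :
    ∃ c, o ≤ c ∧ c < o + M ∧ I a b = I c (c + (b - a)) ∧ (c : ZMod M) = a ∧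
      intArc M c (c + (b - a)) = intArc M a b := by
  obtain ⟨c, h1, h2, e⟩ := exists_int_mem_Ico hM (a : ZMod M) o
  obtain ⟨k, hk⟩ := intCast_eq_iff.1 e
  refine ⟨c, h1, h2, ?_, e.symm, ?_⟩
  · rw [← per_int hI k a b]
    congr 1 <;> lia
  · ext x
    constructor
    · rintro ⟨i, h3, h4, rfl⟩
      refine ⟨i - k * M, by lia, by lia, by simp⟩
    · rintro ⟨i, h3, h4, rfl⟩
      refine ⟨i + k * M, by lia, by lia, by simp⟩

variable [FiniteDimensional ℂ Ω] [hΩ : Fact (IsFactor Ω)]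

lemma part_le_cm (h : CutSystem M I) (hM : 0 < M) {S T : Set (ZMod M)} (hST : Disjoint S T) :
    part M I T ≤ cm (part M I S) := by
  refine part_le fun c d h1 h2 h3 => le_cm_comm.1 (part_le fun a b h4 h5 h6 => ?_)
  obtain ⟨c', hc1, hc2, e, -, e'⟩ := exists_shift_arc h.per hM c d a
  rw [e]
  rw [← e'] at h3
  have hb : b ≤ c' := by
    by_contra hb
    exact hST.le_bot ⟨h6 ⟨c', hc1, by lia, rfl⟩, h3 ⟨c', le_rfl, by lia, rfl⟩⟩
  refine h.le_cm (by lia) hb (by lia) ?_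
  by_contra hd
  refine hST.le_bot ⟨h6 ⟨a, le_rfl, h4, rfl⟩, h3 ⟨a + M, by lia, by lia, ?_⟩⟩
  simp

lemma cut_le_part (h : CutSystem M I) (hM : 0 < M) {S : Set (ZMod M)} {k : ℤ}
    (hk : ((k - 1 : ℤ) : ZMod M) ∈ S ∨ (k : ZMod M) ∈ S) : I k k ≤ part M I S := by
  rcases hk with hk | hk
  · refine (h.cut_le (a := k - 1) (c := k) (by lia) le_rfl (by lia)).trans
      (le_part (by lia) (by lia) ?_)
    have := intArc_singleton (N := M) (k - 1)
    rw [sub_add_cancel] at this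
    rw [this]; simpa using hk
  · refine (h.cut_le (a := k) (c := k + 1) le_rfl (by lia) (by lia)).trans
      (le_part (by lia) (by lia) ?_)
    rw [intArc_singleton]; simpa using hk

/-- An element that commutes with the cuts at which the colouring `cl` of the vertices changes
belongs to the algebra generated by the intervals of constant colour. -/
lemma mem_of_forall_cut (h : CutSystem M I) (hM : 0 < M) (hbot : ∃ p q, I p p ⊓ I q q = ⊥)
    {γ : Type*} (cl : ℤ → γ) {Y : StarSubalgebra ℂ Ω}
    (hY : ∀ a b : ℤ, a < b → b ≤ a + M → (∀ i, a ≤ i → i < b → cl i = cl a) → I a b ≤ Y) {z : Ω}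
    (hz : ∀ k, cl (k - 1) ≠ cl k → z ∈ cm (I k k)) : z ∈ Y := by
  by_cases ho : ∃ o, cl (o - 1) ≠ cl o
  · obtain ⟨o, ho⟩ := ho
    -- Open the circle at a change of colour `o` and sweep from the right: no change lies strictly
    -- between `o + m` and `n`. At the next change, `join` splits off a monochromatic interval.
    have key : ∀ m : ℕ, ∀ n, o + m ≤ n → o < n → n ≤ o + M →
        (∀ k, o + m < k → k < n → cl (k - 1) = cl k) → ∀ z ∈ I o n,
        (∀ k, o < k → k < n → cl (k - 1) ≠ cl k → z ∈ cm (I k k)) → z ∈ Y := by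
      intro m
      induction m with
      | zero =>
        intro n _ hn hnM hcl z hz _
        exact hY o n hn hnM (fun i h1 h2 => eq_of_forall_eq_pred (by simpa using hcl) h1 h2) hz
      | succ m ih =>
        intro n hmn hn hnM hcl z hz hzk
        rcases eq_or_lt_of_le hmn with hmn' | hmn'
        · exact ih n (by lia) hn hnM (fun k _ _ => by lia) z hz hzk
        by_cases hc : cl (o + m + 1 - 1) = cl (o + m + 1)
        · refine ih n (by lia) hn hnM (fun k h1 h2 => ?_) z hz hzk
          rcases eq_or_lt_of_le (show o + m + 1 ≤ k by lia) with rfl | h3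
          · exact hc
          · exact hcl k (by push_cast; lia) h2
        set k := o + m + 1 with hk
        push_cast at hmn hmn' hcl
        let Q : StarSubalgebra ℂ Ω := ⨆ (j : ℤ) (_ : o < j ∧ j < k ∧ cl (j - 1) ≠ cl j), I j j
        have hQ : Q ≤ I o k := iSup₂_le fun j hj => h.cut_le hj.1.le hj.2.1.le (by lia)
        have hzQ : z ∈ (I k n ⊔ I o k) ⊓ cm Q := by
          refine ⟨?_, ?_⟩
          · rw [sup_comm]
            exact h.join (by lia) (by lia) (by lia) ⟨hz, hzk k (by lia) (by lia) hc⟩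
          · change z ∈ cm Q
            simp only [Q, cm_iSup, StarSubalgebra.mem_iInf]
            exact fun j hj => hzk j hj.1 (by lia) hj.2.2
        rw [sup_inf_cm (h.le_cm' (by lia) le_rfl (by lia) (by lia)) hQ] at hzQ
        refine (sup_le ?_ ?_ : _ ≤ Y) hzQ
        · exact hY k n (by lia) (by lia) fun i h1 h2 =>
            eq_of_forall_eq_pred (fun j h3 h4 => hcl j (by lia) h4) h1 h2
        · rintro y ⟨hy1, hy2⟩
          refine ih k (by lia) (by lia) (by lia) (fun _ _ _ => by lia) y hy1 ?_
          intro j h1 h2 h3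
          exact cm_anti (le_iSup₂_of_le j ⟨h1, h2, h3⟩ le_rfl : I j j ≤ Q) hy2
    have hzo := hz o ho
    rw [h.cm_eq le_rfl (by lia)] at hzo
    exact key M (o + M) le_rfl (by lia) le_rfl (fun k _ _ => by lia) z hzo
      fun k _ _ hk => hz k hk
  · push Not at ho
    -- With a single colour nothing forces `z` to commute with any cut; but two opened circles
    -- generate everything when their cuts share only scalars.
    obtain ⟨p, q, hpq⟩ := hbot
    have hcm : ∀ o, cm (I o o) ≤ Y := fun o => by
      rw [h.cm_eq le_rfl (by lia)]
      exact hY o _ (by lia) le_rfl fun i h1 h2 => eq_of_forall_eq_pred (fun j _ _ => ho j) h1 h2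
    have : (⊤ : StarSubalgebra ℂ Ω) ≤ Y := by
      rw [← cm_bot, ← hpq, cm_inf]
      exact sup_le (hcm p) (hcm q)
    exact this trivial

lemma intArc_subset {S : Set (ZMod M)} {a b : ℤ}
    (h : ∀ i, a ≤ i → i < b → (i : ZMod M) ∈ S) : intArc M a b ⊆ S := by
  rintro _ ⟨i, h1, h2, rfl⟩
  exact h i h1 h2

/-- Duality for arbitrary sets. An element commuting with `part M I S` commutes with the boundary
cuts, so it lies in the algebra generated by both sides. The modular law leaves `part M I Sᶜ` and
the centre of `part M I S`. -/
theorem cm_part (h : CutSystem M I) (hM : 0 < M) (hbot : ∃ p q, I p p ⊓ I q q = ⊥)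
    (S : Set (ZMod M)) : cm (part M I S) = part M I Sᶜ := by
  have hle : part M I Sᶜ ≤ cm (part M I S) := h.part_le_cm hM disjoint_compl_right
  let cl : ℤ → Prop := fun i => (i : ZMod M) ∈ S
  have hmem : ∀ z, (∀ k, cl (k - 1) ≠ cl k → z ∈ cm (I k k)) → z ∈ part M I Sᶜ ⊔ part M I S := by
    intro z hz
    refine h.mem_of_forall_cut hM hbot cl (fun a b h1 h2 h3 => ?_) hz
    by_cases ha : cl a
    · exact le_sup_of_le_right (le_part h1 h2 (intArc_subset fun i hi hi' =>
        Eq.mpr (h3 i hi hi') ha))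
    · exact le_sup_of_le_left (le_part h1 h2 (intArc_subset fun i hi hi' => by
        have := h3 i hi hi'
        exact fun hS => ha (this ▸ hS)))
  have hb1 : ∀ k, cl (k - 1) ≠ cl k → I k k ≤ part M I S := by
    intro k hk
    refine h.cut_le_part hM ?_
    by_contra! hc
    exact hk (propext ⟨fun h => (hc.1 h).elim, fun h => (hc.2 h).elim⟩)
  have hb2 : ∀ k, cl (k - 1) ≠ cl k → I k k ≤ part M I Sᶜ := by
    intro k hk
    refine h.cut_le_part hM ?_
    by_contra! hc
    simp only [Set.mem_compl_iff, not_not] at hc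
    exact hk (propext ⟨fun _ => hc.2, fun _ => hc.1⟩)
  refine le_antisymm (fun z hz => ?_) hle
  have hz1 : z ∈ (part M I Sᶜ ⊔ part M I S) ⊓ cm (part M I S) :=
    ⟨hmem z fun k hk => cm_anti (hb1 k hk) hz, hz⟩
  rw [sup_inf_cm_self hle] at hz1
  refine (sup_le le_rfl ?_ : _ ≤ part M I Sᶜ) hz1
  let D : StarSubalgebra ℂ Ω := ⨆ (k : ℤ) (_ : cl (k - 1) ≠ cl k), I k k
  -- Taking commutants, the centre of `part M I S` is generated by boundary cuts, which belong to
  -- both sides.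
  have hD : cm D ≤ part M I Sᶜ ⊔ part M I S := fun z hz =>
    hmem z fun k hk => cm_anti (le_iSup₂_of_le k hk le_rfl : I k k ≤ D) hz
  have hD' : D ≤ part M I Sᶜ := iSup₂_le hb2
  refine le_trans ?_ hD'
  rw [← cm_le_cm_iff]
  refine hD.trans ?_
  rw [cm_centre, sup_comm]
  exact sup_le_sup_left hle _

/-- The same argument with three colours: `S`, `T` and the rest. -/
lemma part_inf_cm_le (h : CutSystem M I) (hM : 0 < M) (hbot : ∃ p q, I p p ⊓ I q q = ⊥)
    {S T : Set (ZMod M)} (hST : Disjoint S T) :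
    part M I (S ∪ T) ⊓ cm (part M I S) ≤ part M I T ⊔ centre (part M I (S ∪ T)) := by
  let cl : ℤ → Prop × Prop := fun i => ((i : ZMod M) ∈ S, (i : ZMod M) ∈ T)
  set X := part M I S ⊔ part M I (S ∪ T)ᶜ with hX
  have hnot : ∀ i : ℤ, (i : ZMod M) ∈ S → (i : ZMod M) ∉ T := fun i h1 h2 => hST.le_bot ⟨h1, h2⟩
  have hU := h.cm_part hM hbot (S ∪ T)
  have hmem : ∀ z, (∀ k, cl (k - 1) ≠ cl k → z ∈ cm (I k k)) → z ∈ part M I T ⊔ X := by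
    intro z hz
    refine h.mem_of_forall_cut hM hbot cl (fun a b h1 h2 h3 => ?_) hz
    have h3' : ∀ i, a ≤ i → i < b →
        (((i : ZMod M) ∈ S) = ((a : ZMod M) ∈ S)) ∧ (((i : ZMod M) ∈ T) = ((a : ZMod M) ∈ T)) :=
      fun i hi hi' => Prod.ext_iff.1 (h3 i hi hi')
    by_cases haT : (a : ZMod M) ∈ T
    · exact le_sup_of_le_left (le_part h1 h2 (intArc_subset fun i hi hi' =>
        (h3' i hi hi').2 ▸ haT))
    by_cases haS : (a : ZMod M) ∈ S
    · exact le_sup_of_le_right (le_sup_of_le_left (le_part h1 h2 (intArc_subset fun i hi hi' =>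
        (h3' i hi hi').1 ▸ haS)))
    · refine le_sup_of_le_right (le_sup_of_le_right (le_part h1 h2 (intArc_subset fun i hi hi' =>
        ?_)))
      rintro (hi1 | hi1)
      · exact haS ((h3' i hi hi').1 ▸ hi1)
      · exact haT ((h3' i hi hi').2 ▸ hi1)
  have hcase : ∀ k, cl (k - 1) ≠ cl k → I k k ≤ part M I S ∨ I k k ≤ part M I (S ∪ T)ᶜ := by
    intro k hk
    by_cases hS : ((k - 1 : ℤ) : ZMod M) ∈ S ∨ (k : ZMod M) ∈ S
    · exact Or.inl (h.cut_le_part hM hS)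
    · right
      push Not at hS
      refine h.cut_le_part hM ?_
      by_contra! hc
      simp only [Set.mem_compl_iff, not_not, Set.mem_union, hS.1, hS.2, false_or] at hc
      exact hk (Prod.ext (propext ⟨fun h => (hS.1 h).elim, fun h => (hS.2 h).elim⟩)
        (propext ⟨fun _ => hc.2, fun _ => hc.1⟩))
  have hcase' : ∀ k, cl (k - 1) ≠ cl k →
      I k k ≤ part M I T ⊔ centre (part M I (S ∪ T)) := by
    intro k hk
    by_cases hT : ((k - 1 : ℤ) : ZMod M) ∈ T ∨ (k : ZMod M) ∈ T
    · exact le_sup_of_le_left (h.cut_le_part hM hT)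
    refine le_sup_of_le_right ?_
    push Not at hT
    rw [centre_eq, hU]
    refine le_inf (h.cut_le_part hM ?_) (h.cut_le_part hM ?_)
    · by_contra! hc
      simp only [Set.mem_union, not_or] at hc
      exact hk (Prod.ext (propext ⟨fun h => (hc.1.1 h).elim, fun h => (hc.2.1 h).elim⟩)
        (propext ⟨fun h => (hc.1.2 h).elim, fun h => (hc.2.2 h).elim⟩))
    · by_contra! hc
      simp only [Set.mem_compl_iff, not_not, Set.mem_union, hT.1, hT.2, or_false] at hc
      exact hk (Prod.ext (propext ⟨fun _ => hc.2, fun _ => hc.1⟩)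
        (propext ⟨fun h => (hT.1 h).elim, fun h => (hT.2 h).elim⟩))
  have hTX : part M I T ≤ cm X := by
    rw [hX, cm_sup]
    exact le_inf (h.part_le_cm hM hST) (h.part_le_cm hM
      (Set.disjoint_left.2 fun x hx hx' => hx (Or.inr hx')))
  rintro z ⟨hz1, hz2⟩
  have hz1' : z ∈ cm (part M I (S ∪ T)ᶜ) := by rwa [← hU, cm_cm]
  have hz3 : z ∈ (part M I T ⊔ X) ⊓ cm X := by
    refine ⟨hmem z fun k hk => ?_, by rw [hX, cm_sup]; exact ⟨hz2, hz1'⟩⟩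
    rcases hcase k hk with hk' | hk'
    · exact cm_anti hk' hz2
    · exact cm_anti hk' hz1'
  rw [sup_inf_cm_self hTX] at hz3
  refine (sup_le le_sup_left ?_ : _ ≤ part M I T ⊔ centre (part M I (S ∪ T))) hz3
  let D : StarSubalgebra ℂ Ω := ⨆ (k : ℤ) (_ : cl (k - 1) ≠ cl k), I k k
  have hD : cm D ≤ part M I T ⊔ X := fun z hz =>
    hmem z fun k hk => cm_anti (le_iSup₂_of_le k hk le_rfl : I k k ≤ D) hz
  refine le_trans ?_ (iSup₂_le hcase' : D ≤ _)
  rw [← cm_le_cm_iff]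
  refine hD.trans ?_
  rw [cm_centre, sup_comm]
  exact sup_le_sup_left hTX _

lemma part_univ (h : CutSystem M I) (hM : 0 < M) (hbot : ∃ p q, I p p ⊓ I q q = ⊥) :
    part M I Set.univ = ⊤ := by
  rw [← Set.compl_empty, ← h.cm_part hM hbot, part_empty, cm_bot]

lemma isPartition_part (h : CutSystem M I) (hM : 0 < M) (hbot : ∃ p q, I p p ⊓ I q q = ⊥) :
    IsPartition (part M I) where
  empty := part_empty
  univ := h.part_univ hM hbot
  bipartition S T hST := by
    refine isBipartition_of_inf_cm_le (part_mono Set.subset_union_left)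
      (part_mono Set.subset_union_right) (h.part_le_cm hM hST) (h.part_inf_cm_le hM hbot hST) ?_
    rw [Set.union_comm]
    exact h.part_inf_cm_le hM hbot hST.symm

lemma part_intArc (h : CutSystem M I) {a b : ℤ} (h1 : a < b) (h2 : b < a + M) :
    part M I (intArc M a b) = I a b := by
  refine le_antisymm (part_le fun c d h3 h4 h5 => ?_) (le_part h1 h2.le subset_rfl)
  obtain ⟨c', hc1, hc2, e, -, e'⟩ := exists_shift_arc h.per (by lia) c d a
  rw [← e'] at h5
  rw [e]
  obtain ⟨i, hi1, hi2, hi⟩ := h5 ⟨c', le_rfl, by lia, rfl⟩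
  obtain rfl := eq_of_intCast_eq hi (by lia) (by lia)
  refine h.mono hc1 (by lia) ?_ h2.le
  by_contra hd
  obtain ⟨j, hj1, hj2, hj⟩ := h5 ⟨b, by lia, by lia, rfl⟩
  have := eq_of_intCast_eq hj (by lia) (by lia)
  lia

lemma centre_eq_sup (h : CutSystem M I) {a b : ℤ} (h1 : a ≤ b) (h2 : b ≤ a + M) :
    centre (I a b) = I a a ⊔ I b b := by
  rw [centre_eq]
  refine le_antisymm (h.centre_le h1 h2) (sup_le (le_inf ?_ ?_) (le_inf ?_ ?_))
  · exact h.cut_le le_rfl h1 h2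
  · exact h.le_cm le_rfl le_rfl h1 h2
  · exact h.cut_le h1 le_rfl h2
  · exact h.le_cm' h1 le_rfl le_rfl h2

/-- The condition `hadj` ensures that neighbouring vertices share no more of their centres than the
cut between them. -/
theorem isStronglyConnectedPartition_part (h : CutSystem M I) (hM : 2 ≤ M)
    (hbot : ∃ p q, I p p ⊓ I q q = ⊥) (hadj : ∀ a, I (a - 1) a ⊓ I a (a + 1) ≤ I a a) :
    IsStronglyConnectedPartition (part M I) where
  isPartition := h.isPartition_part (by lia) hbot
  centre_arc m k hk := by
    obtain ⟨p, rfl⟩ := ZMod.intCast_surjective m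
    have hsing : ∀ p : ℤ, part M I {(p : ZMod M)} = I p (p + 1) := fun p => by
      rw [← intArc_singleton, h.part_intArc (by lia) (by lia)]
    have key : ∀ p : ℤ, centre (part M I {((p - 1 : ℤ) : ZMod M)}) ⊓
        centre (part M I {(p : ZMod M)}) = I p p := by
      intro p
      rw [hsing, hsing, sub_add_cancel]
      refine le_antisymm ?_ (le_inf ?_ ?_)
      · refine (inf_le_inf ?_ ?_).trans (hadj p)
        all_goals rw [centre_eq]; exact inf_le_left
      · rw [h.centre_eq_sup (by lia) (by lia)]; exact le_sup_right
      · rw [h.centre_eq_sup (by lia) (by lia)]; exact le_sup_left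
    have e1 := key p
    have e2 := key (p + k + 1)
    rw [add_sub_cancel_right] at e2
    push_cast at e1 e2
    rw [e1, e2, arc_eq_intArc, h.part_intArc (by lia) (by lia), h.centre_eq_sup (by lia) (by lia)]

end CutSystem

/-- An atom `p` of the intersection satisfies `p * (1 - p) = 0`; this forces `p = 1`. -/
lemma inf_eq_bot_of_uncorrelated [FiniteDimensional ℂ Ω] {F G : StarSubalgebra ℂ Ω}
    (hF : F ≤ cm F) (h : Uncorrelated F G) : F ⊓ G = ⊥ := by
  refine le_bot_iff.1 fun z hz => ?_
  have hc : F ⊓ G ≤ cm (F ⊓ G) := inf_le_left.trans (hF.trans (cm_anti inf_le_left))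
  obtain ⟨s, hs, h1⟩ := exists_sum_atoms hc
  have hex : ∃ c : ℂ, z = c • 1 := by
    rcases s.eq_empty_or_nonempty with rfl | ⟨p, hp⟩
    · refine ⟨0, ?_⟩
      rw [← mul_one z, ← h1]; simp
    · have hpa := hs p hp
      have hp1 : p * (1 - p) = 0 := by
        rw [mul_sub, mul_one, hpa.proj.isIdempotentElem, sub_self]
      have := (h p hpa.mem.1 (1 - p) (sub_mem (one_mem _) hpa.mem.2) hp1).resolve_left hpa.ne_zero
      obtain ⟨c, hc'⟩ := hpa.exists_smul hc hz
      rw [← sub_eq_zero.1 this, mul_one] at hc'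
      exact ⟨c, hc'⟩
  obtain ⟨c, rfl⟩ := hex
  exact (⊥ : StarSubalgebra ℂ Ω).smul_mem (one_mem _) c

end QPartition

/-! ### Localisation and the treatment of one even cut. -/

namespace QPartition
variable {Ω : Type*} [CStarAlgebra Ω]

/-- Intervals between cuts congruent to `s` modulo 2 are uncorrelated if the gaps between them have
length at least `2 * l`. -/
def CorrelationGap (I : ℤ → ℤ → StarSubalgebra ℂ Ω) (M l : ℕ) (s : ℤ) : Prop :=
  ∀ p q p' q' : ℤ, (p - s) % 2 = 0 → (q - s) % 2 = 0 → (p' - s) % 2 = 0 → (q' - s) % 2 = 0 →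
    p < q → q + 2 * l ≤ p' → p' < q' → q' + 2 * l ≤ p + M → Uncorrelated (I p q) (I p' q')

section Gap
variable {M l : ℕ} {s : ℤ} {I : ℤ → ℤ → StarSubalgebra ℂ Ω}
variable [FiniteDimensional ℂ Ω] [hΩ : Fact (IsFactor Ω)]

/-- The cut `w` bounds a vertex on each side, and the circle is long enough for one of them to keep
the required gaps. -/
lemma CorrelationGap.vertex_cut (hc : CorrelationGap I M l s) (h : CutSystem M I)
    (hM : M % 2 = 0) (hl : 4 * l + 4 ≤ M) {a w : ℤ} (ha : (a - s) % 2 = 0) (hw : (w - s) % 2 = 0)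
    (h1 : a + 2 + 2 * l ≤ w) (h2 : w + 2 * l ≤ a + M) : Uncorrelated (I a (a + 2)) (I w w) := by
  by_cases h3 : w + 2 + 2 * l ≤ a + M
  · exact (hc a (a + 2) w (w + 2) ha (by lia) hw (by lia) (by lia) h1 (by lia) h3).mono le_rfl
      (h.cut_le le_rfl (by lia) (by lia))
  · exact (hc a (a + 2) (w - 2) w ha (by lia) (by lia) hw (by lia) (by lia) (by lia) h2).mono
      le_rfl (h.cut_le (by lia) le_rfl (by lia))

lemma CorrelationGap.cut_cut (hc : CorrelationGap I M l s) (h : CutSystem M I)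
    (hM : M % 2 = 0) (hl : 4 * l + 4 ≤ M) {a w : ℤ} (ha : (a - s) % 2 = 0) (hw : (w - s) % 2 = 0)
    (h1 : a + 2 * l ≤ w) (h2 : w + 2 * l ≤ a + M) : Uncorrelated (I a a) (I w w) := by
  by_cases h3 : a + 2 + 2 * l ≤ w
  · exact (hc.vertex_cut h hM hl ha hw h3 h2).mono (h.cut_le le_rfl (by lia) (by lia)) le_rfl
  · have := hc.vertex_cut h hM hl (a := a - 2) (w := w) (by lia) hw (by lia) (by lia)
    rw [sub_add_cancel] at this
    exact this.mono (h.cut_le (by lia) le_rfl (by lia)) le_rfl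

lemma CorrelationGap.gluing (hc : CorrelationGap I M l s) (h : CutSystem M I)
    (hM : M % 2 = 0) (hl : 4 * l + 4 ≤ M) : CutSystem.Gluing I M := by
  refine h.gluing (L := 2 * l + 1) (by lia) (fun b => ?_) (by lia)
  by_cases hb : (b - s) % 2 = 0
  · refine ⟨b + 2 + 2 * l, by lia, by push_cast; lia, ?_⟩
    exact (hc.vertex_cut h hM hl hb (by lia) le_rfl (by lia)).mono
      (h.mono le_rfl (by lia) (by lia) (by lia)) le_rfl
  · refine ⟨b + 1 + 2 * l, by lia, by push_cast; lia, ?_⟩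
    have := hc.vertex_cut h hM hl (a := b - 1) (w := b + 1 + 2 * l) (by lia) (by lia) (by lia)
      (by lia)
    exact this.mono (h.mono (by lia) (by lia) (by lia) (by lia)) le_rfl

end Gap

section Edges
variable {R M : ℕ} {T : Set ℤ}

/-- The left end of the region in which the algebra of an interval starting at `a` is localised. -/
def leftEdge (R : ℕ) (a : ℤ) : ℤ := if a % 2 = 1 then a - R else a + 1 - R

open Classical in
/-- The right end of the region in which the algebra of an interval ending at `b` is localised, if
`T` is the set of even cuts that have been treated. -/
noncomputable def rightEdge (R : ℕ) (T : Set ℤ) (b : ℤ) : ℤ :=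
  if b % 2 = 1 then b + R else if b ∈ T then b - 1 + R else b + 1 + R

lemma leftEdge_odd {a : ℤ} (h : a % 2 = 1) : leftEdge R a = a - R := if_pos h

lemma leftEdge_even {a : ℤ} (h : a % 2 = 0) : leftEdge R a = a + 1 - R := if_neg (by lia)

lemma rightEdge_odd {a : ℤ} (h : a % 2 = 1) : rightEdge R T a = a + R := if_pos h

lemma rightEdge_of_mem {a : ℤ} (h : a % 2 = 0) (hT : a ∈ T) : rightEdge R T a = a - 1 + R := by
  rw [rightEdge, if_neg (by lia), if_pos hT]

lemma leftEdge_mod (a : ℤ) : (leftEdge R a - (R + 1)) % 2 = 0 := by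
  unfold leftEdge; split_ifs <;> lia

lemma rightEdge_mod (a : ℤ) : (rightEdge R T a - (R + 1)) % 2 = 0 := by
  unfold rightEdge; split_ifs <;> lia

lemma le_leftEdge {a c : ℤ} (hc : c % 2 = 1) (h : c ≤ a) : c - R ≤ leftEdge R a := by
  unfold leftEdge; split_ifs <;> lia

lemma leftEdge_le {a c : ℤ} (hc : c % 2 = 1) (h : a ≤ c) : leftEdge R a ≤ c - R := by
  unfold leftEdge; split_ifs <;> lia

lemma le_rightEdge {a c : ℤ} (hc : c % 2 = 1) (h : c ≤ a) : c + R ≤ rightEdge R T a := by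
  unfold rightEdge; split_ifs <;> lia

lemma rightEdge_le {a c : ℤ} (hc : c % 2 = 1) (h : a ≤ c) : rightEdge R T a ≤ c + R := by
  unfold rightEdge; split_ifs <;> lia

lemma leftEdge_le_rightEdge (hR : 1 ≤ R) {a b : ℤ} (h : a < b) :
    leftEdge R a ≤ rightEdge R T b := by
  unfold rightEdge leftEdge; split_ifs <;> lia

lemma emod_two_add_mul (hM : M % 2 = 0) (a k : ℤ) : (a + k * M) % 2 = a % 2 := by
  obtain ⟨N, rfl⟩ : ∃ N, M = 2 * N := ⟨M / 2, by lia⟩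
  push_cast
  rw [show a + k * (2 * N) = a + 2 * (k * N) by ring]
  lia

lemma leftEdge_add_mul (hM : M % 2 = 0) (a k : ℤ) :
    leftEdge R (a + k * M) = leftEdge R a + k * M := by
  unfold leftEdge; rw [emod_two_add_mul hM]; split_ifs <;> ring

lemma rightEdge_add_mul (hM : M % 2 = 0) (hT : ∀ b k : ℤ, b + k * M ∈ T ↔ b ∈ T) (a k : ℤ) :
    rightEdge R T (a + k * M) = rightEdge R T a + k * M := by
  unfold rightEdge; rw [emod_two_add_mul hM, hT]; split_ifs <;> ring

end Edges

/-- A refinement of the cut system `I₀` at the even cuts, those in `T` having been treated, such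
that the algebras of intervals are localised with respect to `J`. -/
structure Refinement (M R : ℕ) (I₀ J : ℤ → ℤ → StarSubalgebra ℂ Ω) (T : Set ℤ)
    (I : ℤ → ℤ → StarSubalgebra ℂ Ω) : Prop where
  sys : CutSystem M I
  odd : ∀ a b : ℤ, a % 2 = 1 → b % 2 = 1 → I a b = I₀ a b
  loc : ∀ a b : ℤ, a < b → b < a + M → rightEdge R T b < leftEdge R a + M →
    I a b ≤ J (leftEdge R a) (rightEdge R T b)
  adj : ∀ a : ℤ, a % 2 = 0 → I (a - 1) a ⊓ I a (a + 1) ≤ I a a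

section Step
variable {M R lA lB : ℕ} {I₀ J I : ℤ → ℤ → StarSubalgebra ℂ Ω} {T : Set ℤ}
variable [FiniteDimensional ℂ Ω] [hΩ : Fact (IsFactor Ω)]

/-- The centre of a cut lies in the intervals ending and starting there, hence in the overlap of
their localisations. -/
lemma CutSystem.cut_le_of_loc (h : CutSystem M I) (hJ : CutSystem M J)
    (hJc : CorrelationGap J M lB (R + 1)) (hM : M % 2 = 0) (hR : 1 ≤ R)
    (hMR : 4 * R + 4 * lB + 2 ≤ M)
    (hloc : ∀ a b : ℤ, a % 2 = 1 → b % 2 = 1 → a < b → b + 2 * R < a + M →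
      I a b ≤ J (a - R) (b + R)) {a : ℤ} (ha : a % 2 = 1) : I a a ≤ J (a - R) (a + R) := by
  -- An even length for which the outer cuts of the two localisations are `2 * lB` apart on both
  -- sides of the circle.
  obtain ⟨k, hk, hk1, hk2⟩ : ∃ k : ℤ, k % 2 = 0 ∧ (lB : ℤ) + 1 ≤ k ∧ k ≤ lB + 2 :=
    ⟨2 * ((lB + 2) / 2), by lia, by lia, by lia⟩
  have h1 : I a a ≤ J (a - k - R) (a + R) :=
    (h.cut_le (by lia) le_rfl (by lia)).trans (hloc (a - k) a (by lia) ha (by lia) (by lia))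
  have h2 : I a a ≤ J (a - R) (a + k + R) :=
    (h.cut_le le_rfl (by lia) (by lia)).trans (hloc a (a + k) ha (by lia) (by lia) (by lia))
  refine (le_inf h1 h2).trans (hJ.inf_le_of_uncorrelated (by lia)
    (hJc.gluing hJ hM (by lia)) (by lia) (by lia) (by lia) (by lia) ?_)
  exact hJc.cut_cut hJ hM (by lia) (by lia) (by lia) (by lia) (by lia)

lemma Refinement.loc_odd (H : Refinement M R I₀ J T I) {a b : ℤ} (ha : a % 2 = 1) (hb : b % 2 = 1)
    (hab : a < b) (hbR : b + 2 * R < a + M) : I a b ≤ J (a - R) (b + R) := by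
  have := H.loc a b hab (by lia) (by rw [leftEdge_odd ha, rightEdge_odd hb]; lia)
  rwa [leftEdge_odd ha, rightEdge_odd hb] at this

/-- One step of the construction. `K` is generated by the old algebra to the right of `x + 1` and by
an algebra `W` of `J` contained in `I (x - 1) e`, so that `cm K` stays to the left of `W`. -/
theorem Refinement.exists_insert [Nontrivial Ω] (H : Refinement M R I₀ J T I) (hJ : CutSystem M J)
    (hI₀ : CorrelationGap I₀ M lA 1) (hJc : CorrelationGap J M lB (R + 1)) (hM : M % 2 = 0)
    (hR : 1 ≤ R) (hMR : 4 * R + 4 * lA + 4 * lB + 2 ≤ M) (hT : ∀ b k : ℤ, b + k * M ∈ T ↔ b ∈ T)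
    {x : ℤ} (hx : x % 2 = 0) :
    ∃ I', Refinement M R I₀ J (T ∪ {b | (M : ℤ) ∣ b - x}) I' := by
  have h := H.sys
  have hI : CorrelationGap I M lA 1 := by
    intro p q p' q' h1 h2 h3 h4 h5 h6 h7 h8
    rw [H.odd p q (by lia) (by lia), H.odd p' q' (by lia) (by lia)]
    exact hI₀ p q p' q' h1 h2 h3 h4 h5 h6 h7 h8
  have hG := hI.gluing h hM (by lia)
  have hGJ := hJc.gluing hJ hM (by lia)
  have hM0 : 0 < M := by lia
  have hMe : (M : ℤ) % 2 = 0 := by lia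
  -- The cuts `x + 1 + R` and `e - R` are `2 * lB` apart, as needed for intersections in `J`. The
  -- steps of `2 * lA` to `d₀` and `d'` decorrelate `e` from `d₀` and `d'` from `x - 1`.
  obtain ⟨e, he⟩ : ∃ e : ℤ, e = x + 1 + 2 * R + 2 * lB := ⟨_, rfl⟩
  obtain ⟨d₀, hd₀⟩ : ∃ d : ℤ, d = e + 2 * lA := ⟨_, rfl⟩
  obtain ⟨d', hd'⟩ : ∃ d : ℤ, d = x - 1 - 2 * lA := ⟨_, rfl⟩
  obtain ⟨c₀, hc₀⟩ : ∃ c : ℤ, c = d₀ - M := ⟨_, rfl⟩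
  set W := J (x - 1 + R) (e - R) with hWdef
  have hW : W ≤ I (x - 1) e := by
    rw [← cm_le_cm_iff, h.cm_eq (by lia) (by lia), hWdef, hJ.cm_eq (by lia) (by lia)]
    have := H.loc_odd (a := e) (b := x - 1 + M) (by lia) (by lia) (by lia) (by lia)
    rwa [show x - 1 + M + (R : ℤ) = x - 1 + R + M by ring] at this
  set K := I (x + 1) d₀ ⊔ W with hK
  have hcut := fun {a : ℤ} (ha : a % 2 = 1) => h.cut_le_of_loc hJ hJc hM hR (by lia)
    (fun _ _ => H.loc_odd) ha
  -- The gap from `d₀` round to `d'` may be shorter than `2 * lA`, so correlations in `J` are used.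
  -- The lower bound on `M` is exactly what leaves `2 * lB` between the two localisations.
  have hud : Uncorrelated (I d' d') (I d₀ d₀) :=
    (hJc (d' - R) (d' + R) (d₀ - R) (d₀ + R) (by lia) (by lia) (by lia) (by lia) (by lia) (by lia)
      (by lia) (by lia)).mono (hcut (by lia)) (hcut (by lia))
  have s : CutSystem.Splitting M I c₀ d' (x - 1) (x + 1) e d₀ K := by
    refine h.splitting_of_le hG (by lia) (by lia) (by lia) (by lia) (by lia) (by lia) hW hK
      ?_ hud ?_ ?_ ?_
    all_goals exact hI.cut_cut h hM (by lia) (by lia) (by lia) (by lia) (by lia)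
  have hsys := s.cutSystem_split h (by lia) hG
  have hT' : ∀ b k : ℤ, b + k * M ∈ T ∪ {b | (M : ℤ) ∣ b - x} ↔ b ∈ T ∪ {b | (M : ℤ) ∣ b - x} := by
    intro b k
    have : (M : ℤ) ∣ b + k * M - x ↔ (M : ℤ) ∣ b - x := by
      rw [show b + k * M - x = b - x + k * M by ring]
      exact dvd_add_left (dvd_mul_left _ _)
    simp only [Set.mem_union, Set.mem_ofPred_eq, hT, this]
  have hρ : ∀ b, ¬ (M : ℤ) ∣ b - x →
      rightEdge R (T ∪ {b | (M : ℤ) ∣ b - x}) b = rightEdge R T b := by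
    intro b hb
    have : b ∈ T ∪ {b | (M : ℤ) ∣ b - x} ↔ b ∈ T :=
      ⟨fun h => h.resolve_right hb, Or.inl⟩
    unfold rightEdge
    split_ifs with h1 h2 h3 h3
    · rfl
    · rfl
    · exact (h3 (this.1 h2)).elim
    · exact (h2 (this.2 h3)).elim
    · rfl
  have hxT : rightEdge R (T ∪ {b | (M : ℤ) ∣ b - x}) x = x - 1 + R :=
    rightEdge_of_mem hx (Or.inr (by simp))
  generalize T ∪ {b | (M : ℤ) ∣ b - x} = T' at hT' hρ hxT ⊢
  have h2M : (2 : ℤ) ∣ M := Int.dvd_of_emod_eq_zero hMe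
  have hodd : ∀ a : ℤ, a % 2 = 1 → ¬ (M : ℤ) ∣ a - x := fun a ha hd => by
    have := h2M.trans hd; lia
  have hKJ : K ≤ J (x + 1 - R) (d₀ + R) := by
    refine sup_le (H.loc_odd (by lia) (by lia) (by lia) (by lia)) ?_
    exact hJ.mono (by lia) (by lia) (by lia) (by lia)
  have hKW : cm K ≤ J (e - R - M) (x - 1 + R) := by
    rw [← hJ.cm_eq' (by lia) (by lia)]
    exact cm_anti le_sup_right
  have hleft : ∀ b, x < b → b < x + M → rightEdge R T b < leftEdge R x + M →
      CutSystem.Splitting.split M I x d₀ K x b ≤ J (leftEdge R x) (rightEdge R T b) := by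
    intro b hb hbM hbR
    rw [leftEdge_even hx] at hbR ⊢
    by_cases hbd : b ≤ d₀
    · have hb1 : rightEdge R T b ≤ d₀ + R := rightEdge_le (by lia) hbd
      have hb2 : x + 1 + R ≤ rightEdge R T b := le_rightEdge (by lia) (by lia)
      have hb3 := rightEdge_mod (R := R) (T := T) b
      rw [s.split_left_of_le hb hbd]
      rcases eq_or_lt_of_le hb1 with hb4 | hb4
      · rw [hb4]; exact inf_le_left.trans hKJ
      have h1 := H.loc (x - 1) b (by lia) (by lia) (by rw [leftEdge_odd (by lia)]; lia)
      rw [leftEdge_odd (by lia)] at h1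
      -- The old interval has the correct right end in `J` and `K` the correct left end;
      -- intersecting keeps both.
      refine le_trans (le_inf (inf_le_right.trans h1) (inf_le_left.trans hKJ))
        (hJ.inf_le_of_uncorrelated hM0 hGJ (by lia) (by lia) hb1 (by lia) ?_)
      exact hJc.cut_cut hJ hM (by lia) (by lia) (by lia) (by lia) (by lia)
    · have hb1 : d₀ + R ≤ rightEdge R T b := le_rightEdge (by lia) (by lia)
      rw [s.split_left_of_ge h (by lia) hbM]
      refine sup_le (hKJ.trans (hJ.mono le_rfl (by lia) hb1 (by lia))) ?_
      have h1 := H.loc (x + 1) b (by lia) (by lia) (by rw [leftEdge_odd (by lia)]; lia)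
      rwa [leftEdge_odd (by lia)] at h1
  have hmid : ∀ a, c₀ ≤ a → a < x →
      CutSystem.Splitting.split M I x d₀ K a x ≤ J (leftEdge R a) (x - 1 + R) := by
    intro a ha hax
    have ha1 : c₀ - R ≤ leftEdge R a := le_leftEdge (by lia) ha
    have ha2 : leftEdge R a ≤ x - 1 - R := leftEdge_le (by lia) (by lia)
    have ha3 := leftEdge_mod (R := R) a
    rw [s.split_right_of_ge h ha hax]
    by_cases ha4 : leftEdge R a = e - R - M
    · rw [ha4]; exact inf_le_left.trans hKW
    have h1 := H.loc a (x + 1) (by lia) (by lia) (by rw [rightEdge_odd (by lia)]; lia)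
    rw [rightEdge_odd (by lia)] at h1
    -- Here `cm K` supplies the improved right end `x - 1 + R`, and the old interval the left end.
    refine le_trans (inf_le_inf hKW h1)
      (hJ.inf_le_of_uncorrelated hM0 hGJ (by lia) (by lia) (by lia) (by lia) ?_)
    exact hJc.cut_cut hJ hM (by lia) (by lia) (by lia) (by lia) (by lia)
  have hright : ∀ a, x - M < a → a < x → x - 1 + R < leftEdge R a + M →
      CutSystem.Splitting.split M I x d₀ K a x ≤ J (leftEdge R a) (x - 1 + R) := by
    intro a ha hax haR
    by_cases hac : c₀ ≤ a
    · exact hmid a hac hax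
    have ha1 : leftEdge R a ≤ c₀ - R := leftEdge_le (by lia) (by lia)
    rw [s.split_right_of_le h ha (by lia)]
    refine sup_le ?_ ?_
    · have h1 := hmid c₀ le_rfl (by lia)
      rw [s.split_right_of_ge h le_rfl (by lia), inf_eq_left.2 (s.cm_le_left h),
        leftEdge_odd (by lia)] at h1
      exact h1.trans (hJ.mono ha1 (by lia) le_rfl (by lia))
    · have h1 := H.loc a (x - 1) (by lia) (by lia) (by rw [rightEdge_odd (by lia)]; lia)
      rwa [rightEdge_odd (by lia)] at h1
  refine ⟨CutSystem.Splitting.split M I x d₀ K, hsys, ?_, ?_, ?_⟩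
  · intro a b ha hb
    rw [CutSystem.Splitting.split_of_not_dvd (hodd a ha) (hodd b hb), H.odd a b ha hb]
  · intro a b hab hb hR'
    have hJp := CutSystem.per_int hJ.per
    have hSp := CutSystem.per_int hsys.per
    by_cases hax : (M : ℤ) ∣ a - x
    · obtain ⟨k, hk⟩ := hax
      obtain rfl : a = x + k * M := by rw [mul_comm k]; lia
      obtain ⟨b, rfl⟩ : ∃ c, b = c + k * M := ⟨b - k * M, by ring⟩
      rw [leftEdge_add_mul hM, rightEdge_add_mul hM hT', hρ b
        (CutSystem.not_dvd_sub (by lia) (by lia))] at hR' ⊢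
      rw [hSp, hJp]
      exact hleft b (by lia) (by lia) (by lia)
    by_cases hbx : (M : ℤ) ∣ b - x
    · obtain ⟨k, hk⟩ := hbx
      obtain rfl : b = x + k * M := by rw [mul_comm k]; lia
      obtain ⟨a, rfl⟩ : ∃ c, a = c + k * M := ⟨a - k * M, by ring⟩
      rw [leftEdge_add_mul hM, rightEdge_add_mul hM hT', hxT] at hR' ⊢
      rw [hSp, hJp]
      exact hright a (by lia) (by lia) (by lia)
    · rw [hρ b hbx] at hR' ⊢
      rw [CutSystem.Splitting.split_of_not_dvd hax hbx]
      exact H.loc a b hab hb hR'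
  · intro a ha
    have hSp := CutSystem.per_int hsys.per
    by_cases hax : (M : ℤ) ∣ a - x
    · obtain ⟨k, hk⟩ := hax
      obtain rfl : a = x + k * M := by rw [mul_comm k]; lia
      rw [show x + k * M - 1 = x - 1 + k * M by ring, show x + k * M + 1 = x + 1 + k * M by ring,
        hSp, hSp, hSp]
      exact s.split_inf_le h
    · rw [CutSystem.Splitting.split_of_not_dvd (hodd _ (by lia)) hax,
        CutSystem.Splitting.split_of_not_dvd hax (hodd _ (by lia)),
        CutSystem.Splitting.split_of_not_dvd hax hax]
      exact H.adj a ha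

theorem Refinement.exists_univ [Nontrivial Ω] (H : Refinement M R I₀ J ∅ I) (hJ : CutSystem M J)
    (hI₀ : CorrelationGap I₀ M lA 1) (hJc : CorrelationGap J M lB (R + 1)) (hM : M % 2 = 0)
    (hR : 1 ≤ R) (hMR : 4 * R + 4 * lA + 4 * lB + 2 ≤ M) :
    ∃ I' T, (∀ b : ℤ, b % 2 = 0 → b ∈ T) ∧ Refinement M R I₀ J T I' := by
  have key : ∀ m : ℕ, ∃ I' T, (∀ b k : ℤ, b + k * M ∈ T ↔ b ∈ T) ∧
      (∀ j : ℕ, j < m → 2 * (j : ℤ) ∈ T) ∧ Refinement M R I₀ J T I' := by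
    intro m
    induction m with
    | zero => exact ⟨I, ∅, by simp, by simp, H⟩
    | succ m ih =>
      obtain ⟨I', T, hT, hm, H'⟩ := ih
      obtain ⟨I'', H''⟩ := H'.exists_insert hJ hI₀ hJc hM hR hMR hT (x := 2 * m) (by lia)
      refine ⟨I'', _, ?_, ?_, H''⟩
      · intro b k
        have : (M : ℤ) ∣ b + k * M - 2 * m ↔ (M : ℤ) ∣ b - 2 * m := by
          rw [show b + k * M - 2 * m = b - 2 * m + k * M by ring]
          exact dvd_add_left (dvd_mul_left _ _)
        simp only [Set.mem_union, Set.mem_ofPred_eq, hT, this]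
      · intro j hj
        rcases eq_or_lt_of_le (Nat.lt_succ_iff.1 hj) with rfl | hj'
        · right; simp
        · exact Or.inl (hm j hj')
  -- The set `T` is periodic, so the first `M` even integers cover every even cut.
  obtain ⟨I', T, hT, hm, H'⟩ := key M
  refine ⟨I', T, fun b hb => ?_, H'⟩
  have hM' : (0 : ℤ) < M := by lia
  have e := Int.emod_add_mul_ediv b M
  have h1 := Int.emod_nonneg b hM'.ne'
  have h2 := Int.emod_lt_of_pos b hM'
  have h3 : b % M % 2 = 0 := by
    have := emod_two_add_mul (M := M) hM (b % M) (b / M)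
    rw [mul_comm, e] at this
    lia
  rw [← e, mul_comm, hT]
  have := hm (b % M / 2).toNat (by lia)
  rwa [Int.toNat_of_nonneg (by lia), show 2 * (b % M / 2) = b % M by lia] at this

end Step
end QPartition

/-! ### Positions on the circle and the fine-grained partition. -/

namespace QPartition
variable {Ω : Type*} [CStarAlgebra Ω]

section Positions

/-- Replaces representatives on the circle by positions of integers on the line; the turns are
absorbed in the choice of the lift `i`. -/
lemma mem_thicken_iff {N V W : ℕ} {p : ZMod V → ℚ} {q : ZMod W → ℚ} {P Q : ℤ → ℚ}
    (hP : ∀ i : ℤ, ∃ k : ℤ, p i = P i + k * N) (hP' : ∀ i k : ℤ, P (i + k * V) = P i + k * N)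
    (hQ : ∀ i : ℤ, ∃ k : ℤ, q i = Q i + k * N) {ρ : ℚ} {S : Set (ZMod V)} {j : ℤ} :
    (j : ZMod W) ∈ thicken N p q ρ S ↔ ∃ i : ℤ, (i : ZMod V) ∈ S ∧ |Q j - P i| ≤ ρ := by
  obtain ⟨l, hl⟩ := hQ j
  constructor
  · rintro ⟨v, hv, k, hk⟩
    obtain ⟨i, rfl⟩ := ZMod.intCast_surjective v
    obtain ⟨m, hm⟩ := hP i
    refine ⟨i + (m + k - l) * V, by simpa using hv, ?_⟩
    rw [hP']
    rw [hl, hm] at hk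
    convert hk using 2
    push_cast; ring
  · rintro ⟨i, hi, h⟩
    obtain ⟨m, hm⟩ := hP i
    refine ⟨i, hi, l - m, ?_⟩
    rw [hl, hm]
    convert h using 2
    push_cast; ring

variable {N : ℕ}

lemma pos_intCast (hN : 0 < N) (δ : ℚ) (i : ℤ) : ∃ k : ℤ, pos N δ i = (i + δ) + k * N := by
  have : NeZero N := ⟨hN.ne'⟩
  refine ⟨-(i / N), ?_⟩
  have e : ((i : ZMod N).val : ℤ) = i - N * (i / N) := by
    rw [ZMod.val_intCast]; exact Int.emod_def i N
  have e' : ((i : ZMod N).val : ℚ) = i - N * ((i / N : ℤ) : ℚ) := by exact_mod_cast e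
  rw [pos, e']; push_cast; ring

lemma finePos_intCast (hN : 0 < N) (i : ℤ) :
    ∃ k : ℤ, finePos N i = ((i : ℚ) / 2 + 1 / 4) + k * N := by
  have : NeZero (2 * N) := ⟨by lia⟩
  refine ⟨-(i / (2 * N : ℕ)), ?_⟩
  have e : ((i : ZMod (2 * N)).val : ℤ) = i - (2 * N : ℕ) * (i / (2 * N : ℕ)) := by
    rw [ZMod.val_intCast]; exact Int.emod_def i _
  have e' : ((i : ZMod (2 * N)).val : ℚ) = i - (2 * N : ℕ) * ((i / (2 * N : ℕ) : ℤ) : ℚ) := by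
    exact_mod_cast e
  rw [finePos, e']; push_cast; ring

lemma abs_le_iff_of_eq {x y c : ℚ} {m n : ℤ} (hc : 0 < c) (hx : c * x = m) (hy : c * y = n) :
    |x| ≤ y ↔ |m| ≤ n := by
  rw [← mul_le_mul_iff_right₀ hc, ← abs_of_pos hc, ← abs_mul, abs_of_pos hc, hx, hy,
    ← Int.cast_abs, Int.cast_le]

lemma mem_thicken_pos (hN : 0 < N) {δ : ℚ} {l : ℕ} {S : Set (ZMod N)} {j : ℤ} :
    (j : ZMod N) ∈ thicken N (pos N δ) (pos N δ) l S ↔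
      ∃ i : ℤ, (i : ZMod N) ∈ S ∧ |j - i| ≤ (l : ℤ) := by
  rw [mem_thicken_iff (P := fun i => i + δ) (Q := fun i => i + δ) (pos_intCast hN δ)
    (fun i k => by push_cast; ring) (pos_intCast hN δ)]
  refine exists_congr fun i => and_congr_right fun _ => ?_
  exact abs_le_iff_of_eq one_pos (by push_cast; ring) (by push_cast; ring)

lemma mem_thicken_pos_pos (hN : 0 < N) {R ε : ℕ} {S : Set (ZMod N)} {j : ℤ} :
    (j : ZMod N) ∈ thicken N (pos N 0) (pos N (ε / 2)) (R / 2) S ↔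
      ∃ i : ℤ, (i : ZMod N) ∈ S ∧ |2 * j + ε - 2 * i| ≤ (R : ℤ) := by
  rw [mem_thicken_iff (P := fun i => i + 0) (Q := fun i => i + ε / 2) (pos_intCast hN 0)
    (fun i k => by push_cast; ring) (pos_intCast hN _)]
  refine exists_congr fun i => and_congr_right fun _ => ?_
  exact abs_le_iff_of_eq two_pos (by push_cast; ring) (by push_cast; ring)

/-- The fine vertices at distance `1 / 4` from `n` are `2 * n - 1` and `2 * n`. -/
lemma mem_thicken_pos_fine (hN : 0 < N) {S : Set (ZMod N)} {j : ℤ} :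
    (j : ZMod (2 * N)) ∈ thicken N (pos N 0) (finePos N) (1 / 4) S ↔
      (((j + 1) / 2 : ℤ) : ZMod N) ∈ S := by
  rw [mem_thicken_iff (P := fun i => i + 0) (Q := fun i => (i : ℚ) / 2 + 1 / 4) (pos_intCast hN 0)
    (fun i k => by push_cast; ring) (finePos_intCast hN)]
  have : ∀ i : ℤ, |(j : ℚ) / 2 + 1 / 4 - (i + 0)| ≤ 1 / 4 ↔ i = (j + 1) / 2 := by
    intro i
    rw [abs_le_iff_of_eq (m := 2 * j + 1 - 4 * i) (n := 1) four_pos (by push_cast; ring)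
      (by push_cast; ring), abs_le]
    lia
  simp only [this, exists_eq_right]

lemma mem_thicken_fine (hN : 0 < N) {l : ℕ} {S : Set (ZMod (2 * N))} {j : ℤ} :
    (j : ZMod (2 * N)) ∈ thicken N (finePos N) (finePos N) (l + 1 / 2) S ↔
      ∃ i : ℤ, (i : ZMod (2 * N)) ∈ S ∧ |j - i| ≤ 2 * (l : ℤ) + 1 := by
  rw [mem_thicken_iff (P := fun i => (i : ℚ) / 2 + 1 / 4) (Q := fun i => (i : ℚ) / 2 + 1 / 4)
    (finePos_intCast hN) (fun i k => by push_cast; ring) (finePos_intCast hN)]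
  refine exists_congr fun i => and_congr_right fun _ => ?_
  exact abs_le_iff_of_eq two_pos (by push_cast; ring) (by push_cast; ring)

lemma mem_thicken_fine_pos (hN : 0 < N) {R ε : ℕ} {S : Set (ZMod (2 * N))} {j : ℤ} :
    (j : ZMod N) ∈ thicken N (finePos N) (pos N (ε / 2)) (R / 2 - 1 / 4) S ↔
      ∃ i : ℤ, (i : ZMod (2 * N)) ∈ S ∧ |4 * j + 2 * ε - 2 * i - 1| ≤ 2 * (R : ℤ) - 1 := by
  rw [mem_thicken_iff (P := fun i => (i : ℚ) / 2 + 1 / 4) (Q := fun i => i + ε / 2)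
    (finePos_intCast hN) (fun i k => by push_cast; ring) (pos_intCast hN _)]
  refine exists_congr fun i => and_congr_right fun _ => ?_
  exact abs_le_iff_of_eq four_pos (by push_cast; ring) (by push_cast; ring)

lemma exists_lift_of_mem_intArc {a b i : ℤ} (h : (i : ZMod N) ∈ intArc N a b) :
    ∃ k : ℤ, a ≤ i + k * N ∧ i + k * N < b := by
  obtain ⟨j, h1, h2, e⟩ := h
  obtain ⟨k, hk⟩ := intCast_eq_iff.1 e
  exact ⟨k, by rw [mul_comm k]; lia, by rw [mul_comm k]; lia⟩

end Positions

section Coarse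
variable {N : ℕ} {A : Set (ZMod N) → StarSubalgebra ℂ Ω}
variable [FiniteDimensional ℂ Ω] [hΩ : Fact (IsFactor Ω)]

lemma coarse_uncorrelated (hA : IsPartition A) {δ : ℚ} {l : ℕ}
    (hl : CorrelationLengthLE N (pos N δ) A l) {p q p' q' : ℤ} (h1 : p < q) (h2 : q + l ≤ p')
    (h3 : p' < q') (h4 : q' + l ≤ p + N) : Uncorrelated (coarse A p q) (coarse A p' q') := by
  rw [coarse_arc h1 (by lia), coarse_arc h3 (by lia)]
  refine (hl (intArc N p q)).mono le_rfl (hA.mono ?_)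
  rintro _ ⟨j, hj1, hj2, rfl⟩ hj
  obtain ⟨i, hi, hij⟩ := (mem_thicken_pos (by lia)).1 hj
  obtain ⟨k, hk1, hk2⟩ := exists_lift_of_mem_intArc hi
  rw [abs_le] at hij
  rcases le_or_gt 0 k with hk | hk
  · have : 0 ≤ k * (N : ℤ) := by positivity
    lia
  · have : k * (N : ℤ) ≤ -1 * N := mul_le_mul_of_nonneg_right (by lia) (by positivity)
    lia

lemma coarse_inf_le (hA : IsPartition A) (hN : 2 ≤ N) (p : ℤ) :
    coarse A (p - 1) p ⊓ coarse A p (p + 1) ≤ coarse A p p := by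
  have hdis : Disjoint ({((p - 1 : ℤ) : ZMod N)} : Set (ZMod N)) {(p : ZMod N)} := by
    rw [Set.disjoint_singleton]
    intro e
    have := eq_of_intCast_eq e (by lia) (by lia)
    lia
  have hc := (hA.bipartition _ _ hdis).le_cm
  have e := intArc_singleton (N := N) (p - 1)
  rw [sub_add_cancel] at e
  rw [coarse_arc (by lia) (by lia), coarse_arc (by lia) (by lia), e, intArc_singleton, coarse_self,
    centre_eq, centre_eq]
  refine le_inf (le_inf inf_le_left (inf_le_right.trans hc)) (le_inf inf_le_right ?_)
  exact inf_le_left.trans (le_cm_comm.1 hc)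

/-- One inclusion for all sets, applied to `Sᶜ`, gives the other by commutants. -/
lemma part_coarse (hA : IsStronglyConnectedPartition A) (hN : 2 ≤ N)
    (hbot : ∃ p q, coarse A p p ⊓ coarse A q q = ⊥) (S : Set (ZMod N)) :
    CutSystem.part N (coarse A) S = A S := by
  have hP := hA.isPartition
  have hle : ∀ S, CutSystem.part N (coarse A) S ≤ A S := by
    refine fun S => CutSystem.part_le fun a b h1 h2 h3 => ?_
    rcases eq_or_lt_of_le h2 with rfl | h2
    · rw [intArc_univ (by lia), Set.univ_subset_iff] at h3
      rw [h3, hP.univ]; exact le_top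
    · rw [coarse_arc h1 h2]; exact hP.mono h3
  refine le_antisymm (hle S) ?_
  rw [← compl_compl S, hP.compl, ← (cutSystem_coarse hA hN).cm_part (by lia) hbot]
  exact cm_anti (hle _)

end Coarse

section FineGraining
variable [FiniteDimensional ℂ Ω] [hΩ : Fact (IsFactor Ω)]
variable {N R lA lB ε : ℕ} {A B : Set (ZMod N) → StarSubalgebra ℂ Ω}

/-- The cuts of a partition of the circle, doubled: the cuts congruent to `ε + 1` modulo 2 are
those of the partition, and the remaining ones coincide with their successors. -/
noncomputable def doubled (A : Set (ZMod N) → StarSubalgebra ℂ Ω) (ε : ℕ) (a b : ℤ) :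
    StarSubalgebra ℂ Ω := coarse A ((a + 2 - ε) / 2) ((b + 2 - ε) / 2)

lemma cutSystem_doubled (hA : IsStronglyConnectedPartition A) (hN : 2 ≤ N) (ε : ℕ) :
    CutSystem (2 * N) (doubled A ε) :=
  (cutSystem_coarse hA hN).comap (f := fun a => (a + 2 - ε) / 2)
    (fun a b hab => by dsimp only; lia) (fun a => by push_cast; lia)

lemma correlationGap_doubled (hA : IsPartition A) {δ : ℚ} {l : ℕ}
    (hl : CorrelationLengthLE N (pos N δ) A l) {s : ℤ} (hs : (s - (ε + 1)) % 2 = 0) :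
    CorrelationGap (doubled A ε) (2 * N) l s := by
  intro p q p' q' h1 h2 h3 h4 h5 h6 h7 h8
  push_cast at h8
  exact coarse_uncorrelated hA hl (by lia) (by lia) (by lia) (by lia)

lemma coarse_le_doubled (hB : IsPartition B) (hε : ε = R % 2) (hR : 1 ≤ R)
    (hAB : ∀ S, A S ≤ B (thicken N (pos N 0) (pos N (ε / 2)) (R / 2) S)) {p q : ℤ} (hpq : p < q)
    (hq : q + R < p + N) : coarse A p q ≤ doubled B ε (2 * p - 1 - R) (2 * q - 1 + R) := by
  have hN : 0 < N := by lia
  rw [coarse_arc hpq (by lia), doubled, coarse_arc (by lia) (by lia)]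
  refine (hAB _).trans (hB.mono fun x hx => ?_)
  obtain ⟨j, rfl⟩ := ZMod.intCast_surjective x
  obtain ⟨i, hi, hij⟩ := (mem_thicken_pos_pos hN).1 hx
  obtain ⟨k, hk1, hk2⟩ := exists_lift_of_mem_intArc hi
  rw [abs_le] at hij
  refine ⟨j + k * N, ?_, ?_, by simp⟩
  · lia
  · lia

/-- Starting point of the iteration: an even cut equals its successor, so it inherits the left and
right edges of the latter. -/
lemma refinement_doubled (hA : IsStronglyConnectedPartition A) (hB : IsStronglyConnectedPartition B)
    (hlB : CorrelationLengthLE N (pos N (ε / 2)) B lB) (hε : ε = R % 2) (hR : 1 ≤ R)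
    (hN : 2 * R + 2 * lB + 1 ≤ N)
    (hAB : ∀ S, A S ≤ B (thicken N (pos N 0) (pos N (ε / 2)) (R / 2) S)) :
    Refinement (2 * N) R (doubled A 0) (doubled B ε) ∅ (doubled A 0) := by
  have hsA := cutSystem_doubled hA (by lia) 0
  have hsB := cutSystem_doubled hB (by lia) ε
  have hBc := correlationGap_doubled (ε := ε) hB.isPartition hlB (s := R + 1) (by lia)
  have hloc : ∀ a b : ℤ, a % 2 = 1 → b % 2 = 1 → a < b → b + 2 * R < a + (2 * N : ℕ) →
      doubled A 0 a b ≤ doubled B ε (a - R) (b + R) := by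
    intro a b ha hb hab hbR
    push_cast at hbR
    have := coarse_le_doubled hB.isPartition hε hR hAB (p := (a + 1) / 2)
      (q := (b + 1) / 2) (by lia) (by lia)
    rw [show 2 * ((a + 1) / 2) - 1 - (R : ℤ) = a - R by lia,
      show 2 * ((b + 1) / 2) - 1 + (R : ℤ) = b + R by lia] at this
    rw [doubled, show (a + 2 - ((0 : ℕ) : ℤ)) / 2 = (a + 1) / 2 by lia,
      show (b + 2 - ((0 : ℕ) : ℤ)) / 2 = (b + 1) / 2 by lia]
    exact this
  have hcut := fun {a : ℤ} (ha : a % 2 = 1) =>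
    hsA.cut_le_of_loc hsB hBc (by lia) hR (by lia) hloc ha
  refine ⟨hsA, fun _ _ _ _ => rfl, ?_, ?_⟩
  · intro a b hab hb hRb
    obtain ⟨a', ha', ea, ha2, ha3⟩ : ∃ a' : ℤ, a' % 2 = 1 ∧ leftEdge R a = a' - R ∧
        (a + 2 - ((0 : ℕ) : ℤ)) / 2 = (a' + 2 - ((0 : ℕ) : ℤ)) / 2 ∧ (a ≤ a' ∧ a' ≤ a + 1) := by
      by_cases ha : a % 2 = 1
      · exact ⟨a, ha, leftEdge_odd ha, rfl, by lia⟩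
      · exact ⟨a + 1, by lia, leftEdge_even (by lia), by lia, by lia⟩
    obtain ⟨b', hb', eb, hb2, hb3⟩ : ∃ b' : ℤ, b' % 2 = 1 ∧ rightEdge R ∅ b = b' + R ∧
        (b + 2 - ((0 : ℕ) : ℤ)) / 2 = (b' + 2 - ((0 : ℕ) : ℤ)) / 2 ∧ (b ≤ b' ∧ b' ≤ b + 1) := by
      by_cases hb : b % 2 = 1
      · exact ⟨b, hb, rightEdge_odd hb, rfl, by lia⟩
      · exact ⟨b + 1, by lia, by rw [rightEdge, if_neg hb, if_neg (by simp)], by lia, by lia⟩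
    rw [ea, eb] at hRb ⊢
    have e : doubled A 0 a b = doubled A 0 a' b' := by rw [doubled, doubled, ha2, hb2]
    rw [e]
    rcases eq_or_lt_of_le (show a' ≤ b' by lia) with rfl | hlt
    · exact hcut ha'
    · exact hloc a' b' ha' hb' hlt (by lia)
  · intro a ha
    refine inf_le_of_right_le (le_of_eq ?_)
    rw [doubled, doubled]
    congr 1
    lia

theorem exists_fineGraining [Nontrivial Ω] (hA : IsStronglyConnectedPartition A)
    (hB : IsStronglyConnectedPartition B) (hlA : CorrelationLengthLE N (pos N 0) A lA)
    (hlB : CorrelationLengthLE N (pos N (ε / 2)) B lB) (hε : ε = R % 2) (hR : 1 ≤ R)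
    (hN : 2 * R + 2 * lA + 2 * lB + 1 ≤ N)
    (hAB : ∀ S, A S ≤ B (thicken N (pos N 0) (pos N (ε / 2)) (R / 2) S)) :
    ∃ A' : Set (ZMod (2 * N)) → StarSubalgebra ℂ Ω, IsStronglyConnectedPartition A' ∧
      CorrelationLengthLE N (finePos N) A' (lA + 1 / 2) ∧
      (∀ S, A S = A' (thicken N (pos N 0) (finePos N) (1 / 4) S)) ∧
      ∀ S, A' S ≤ B (thicken N (finePos N) (pos N (ε / 2)) (R / 2 - 1 / 4) S) := by
  have hN0 : 0 < N := by lia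
  have hsB := cutSystem_doubled hB (by lia) ε
  have hBc := correlationGap_doubled (ε := ε) hB.isPartition hlB (s := R + 1) (by lia)
  have hAc := correlationGap_doubled (ε := 0) hA.isPartition hlA (s := 1) (by lia)
  obtain ⟨I, T, hT, H⟩ := (refinement_doubled hA hB hlB hε hR (by lia) hAB).exists_univ hsB hAc
    hBc (by lia) hR (by lia)
  have h := H.sys
  -- Two cuts at distance `2 * lA` share only scalars, which provides the hypothesis on trivial
  -- intersections in the passage to partitions.
  have hunc := hAc.cut_cut (cutSystem_doubled hA (by lia) 0) (by lia) (by lia) (a := 1)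
    (w := 1 + 2 * lA) (by lia) (by lia) le_rfl (by push_cast; lia)
  have hinf := inf_eq_bot_of_uncorrelated ((cutSystem_doubled hA (by lia) 0).cut_comm 1) hunc
  have hbotA : ∃ p q, coarse A p p ⊓ coarse A q q = ⊥ := ⟨_, _, hinf⟩
  have hbot : ∃ p q, I p p ⊓ I q q = ⊥ := by
    refine ⟨1, 1 + 2 * lA, ?_⟩
    rw [H.odd 1 1 (by lia) (by lia), H.odd _ _ (by lia) (by lia)]
    exact hinf
  have hcoarse : ∀ p q : ℤ, I (2 * p - 1) (2 * q - 1) = coarse A p q := by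
    intro p q
    rw [H.odd _ _ (by lia) (by lia), doubled]
    congr 1 <;> lia
  have hadj : ∀ a, I (a - 1) a ⊓ I a (a + 1) ≤ I a a := by
    intro a
    by_cases ha : a % 2 = 0
    · exact H.adj a ha
    obtain ⟨p, rfl⟩ : ∃ p, a = 2 * p - 1 := ⟨(a + 1) / 2, by lia⟩
    rw [hcoarse]
    refine le_trans (inf_le_inf ?_ ?_) (coarse_inf_le hA.isPartition (by lia) p)
    · rw [← hcoarse]; exact h.mono (by lia) (by lia) le_rfl (by lia)
    · rw [← hcoarse]; exact h.mono le_rfl (by lia) (by lia) (by lia)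
  have hle : ∀ S, A S ≤ CutSystem.part (2 * N) I (thicken N (pos N 0) (finePos N) (1 / 4) S) := by
    intro S
    rw [← part_coarse hA (by lia) hbotA S]
    refine CutSystem.part_le fun a b h1 h2 h3 => ?_
    rw [← hcoarse]
    refine CutSystem.le_part (by lia) (by push_cast; lia) (CutSystem.intArc_subset fun i hi1 hi2 => ?_)
    rw [mem_thicken_pos_fine hN0]
    exact h3 ⟨_, by lia, by lia, rfl⟩
  have hcompl : ∀ S, (thicken N (pos N 0) (finePos N) (1 / 4) S)ᶜ =
      thicken N (pos N 0) (finePos N) (1 / 4) Sᶜ := by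
    intro S
    ext x
    obtain ⟨j, rfl⟩ := ZMod.intCast_surjective x
    rw [Set.mem_compl_iff, mem_thicken_pos_fine hN0, mem_thicken_pos_fine hN0, Set.mem_compl_iff]
  have heq : ∀ S, A S = CutSystem.part (2 * N) I (thicken N (pos N 0) (finePos N) (1 / 4) S) := by
    intro S
    refine le_antisymm (hle S) ?_
    rw [← cm_le_cm_iff, h.cm_part (by lia) hbot, hcompl, ← hA.isPartition.compl]
    exact hle _
  refine ⟨CutSystem.part (2 * N) I, h.isStronglyConnectedPartition_part (by lia) hbot hadj,
    ?_, heq, ?_⟩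
  · intro S
    -- The coarse vertices that meet `S`: thickening them by `lA` costs at most `1 / 2` more on the
    -- fine scale.
    let U : Set (ZMod N) := {n | ∃ j : ℤ, (j : ZMod (2 * N)) ∈ S ∧ (((j + 1) / 2 : ℤ) : ZMod N) = n}
    have h1 : CutSystem.part (2 * N) I S ≤ A U := by
      rw [heq]
      refine CutSystem.part_mono fun x hx => ?_
      obtain ⟨j, rfl⟩ := ZMod.intCast_surjective x
      rw [mem_thicken_pos_fine hN0]
      exact ⟨j, hx, rfl⟩
    have h2 : CutSystem.part (2 * N) I (thicken N (finePos N) (finePos N) (lA + 1 / 2) S)ᶜ ≤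
        A (thicken N (pos N 0) (pos N 0) lA U)ᶜ := by
      rw [heq]
      refine CutSystem.part_mono fun x hx => ?_
      obtain ⟨j, rfl⟩ := ZMod.intCast_surjective x
      rw [mem_thicken_pos_fine hN0]
      intro hj
      refine hx ?_
      rw [mem_thicken_fine hN0]
      obtain ⟨i, ⟨j', hj', e⟩, hij⟩ := (mem_thicken_pos hN0).1 hj
      obtain ⟨k, hk⟩ := intCast_eq_iff.1 e
      refine ⟨j' + k * (2 * N : ℕ), ?_, ?_⟩
      · rwa [← intCast_eq_iff.2 (⟨k, by ring⟩ : ((2 * N : ℕ) : ℤ) ∣ j' + k * (2 * N : ℕ) - j')]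
      push_cast
      rw [abs_le] at hij ⊢
      rw [show k * (2 * (N : ℤ)) = 2 * (N * k) by ring]
      lia
    exact (hlA U).mono h1 h2
  · intro S
    refine CutSystem.part_le fun a b hab hb hS => ?_
    have key : ∀ j : ℤ, leftEdge R a + 1 ≤ 2 * j + ε → 2 * j + ε + 1 ≤ rightEdge R T b →
        (j : ZMod N) ∈ thicken N (finePos N) (pos N (ε / 2)) (R / 2 - 1 / 4) S := by
      intro j h1 h2
      rw [mem_thicken_fine_pos hN0]
      have h3 : a ≤ 2 * j + ε + R - 1 := by
        unfold leftEdge at h1; split_ifs at h1 <;> lia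
      have h4 : 2 * j + ε - R ≤ b - 1 := by
        by_cases hb2 : b % 2 = 1
        · rw [rightEdge_odd hb2] at h2; lia
        · rw [rightEdge_of_mem (by lia) (hT b (by lia))] at h2; lia
      -- The fine vertices within reach of `j` run from `2 * j + ε - R` to `2 * j + ε + R - 1`; take
      -- the first one not before `a`.
      refine ⟨max a (2 * j + ε - R), hS ⟨_, le_max_left _ _, by lia, rfl⟩, ?_⟩
      rw [abs_le]
      lia
    have hm := leftEdge_mod (R := R) a
    have hm' := rightEdge_mod (R := R) (T := T) b
    -- If the localisation wraps around the whole circle, the thickening of `S` contains every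
    -- vertex.
    by_cases hlt : rightEdge R T b < leftEdge R a + (2 * N : ℕ)
    · have hb' : b < a + (2 * N : ℕ) := by
        refine lt_of_le_of_ne hb ?_
        rintro rfl
        have e := leftEdge_add_mul (R := R) (M := 2 * N) (by lia) a 1
        rw [one_mul] at e
        have h5 : leftEdge R (a + (2 * N : ℕ)) ≤ rightEdge R T (a + (2 * N : ℕ)) := by
          by_cases ha2 : (a + (2 * N : ℕ)) % 2 = 1
          · rw [rightEdge_odd ha2, leftEdge_odd ha2]; lia
          · rw [rightEdge_of_mem (by lia) (hT _ (by lia)), leftEdge_even (by lia)]; lia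
        lia
      have h1 := H.loc a b hab hb' hlt
      have h2 := leftEdge_le_rightEdge (T := T) hR hab
      refine h1.trans ?_
      rw [doubled]
      push_cast at hlt
      have hmono : ∀ x ∈ intArc N ((leftEdge R a + 2 - ε) / 2) ((rightEdge R T b + 2 - ε) / 2),
          x ∈ thicken N (finePos N) (pos N (ε / 2)) (R / 2 - 1 / 4) S := by
        rintro _ ⟨j, hj1, hj2, rfl⟩
        exact key j (by lia) (by lia)
      have hne : leftEdge R a < rightEdge R T b := by
        unfold leftEdge
        by_cases hb2 : b % 2 = 1
        · rw [rightEdge_odd hb2]; split_ifs <;> lia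
        · rw [rightEdge_of_mem (by lia) (hT b (by lia))]; split_ifs <;> lia
      rw [coarse_arc (by lia) (by lia)]
      exact hB.isPartition.mono hmono
    · have huniv : thicken N (finePos N) (pos N (ε / 2)) (R / 2 - 1 / 4) S = Set.univ := by
        refine Set.eq_univ_of_forall fun x => ?_
        obtain ⟨j, hj1, hj2, rfl⟩ := exists_int_mem_Ico hN0 x ((leftEdge R a + 2 - ε) / 2)
        push_cast at hlt
        exact key j (by lia) (by lia)
      rw [huniv, hB.isPartition.univ]
      exact le_top

end FineGraining

lemma isStronglyConnectedPartition_of_subsingleton [Subsingleton Ω] {M : ℕ}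
    (A : Set (ZMod M) → StarSubalgebra ℂ Ω) : IsStronglyConnectedPartition A := by
  have hs : ∀ F G : StarSubalgebra ℂ Ω, F = G := fun F G => by
    ext x
    rw [Subsingleton.elim x 0]
    exact ⟨fun _ => zero_mem _, fun _ => zero_mem _⟩
  refine ⟨⟨hs _ _, hs _ _, fun S T _ => ⟨(hs _ _).le, (hs _ _).le, ?_, ?_⟩⟩, fun _ _ _ => hs _ _⟩
  all_goals exact fun p hp => (hp.ne_zero (Subsingleton.elim _ _)).elim

lemma fract_half (R : ℕ) : Int.fract ((R : ℚ) / 2) = ((R % 2 : ℕ) : ℚ) / 2 := by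
  rw [Int.fract_eq_iff]
  have h : (R % 2 : ℕ) ≤ 1 := by lia
  have h' : ((R % 2 : ℕ) : ℚ) ≤ 1 := by exact_mod_cast h
  refine ⟨by positivity, by linarith, (R / 2 : ℕ), ?_⟩
  have e : R = 2 * (R / 2) + R % 2 := by lia
  have e' : (R : ℚ) = 2 * (R / 2 : ℕ) + (R % 2 : ℕ) := by exact_mod_cast e
  rw [e']
  simp only [Int.cast_natCast]
  ring

end QPartition

theorem mainTheorem2 {Ω : Type*} [CStarAlgebra Ω] [FiniteDimensional ℂ Ω]
    (hΩ : QPartition.IsFactor Ω)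
    (N : ℕ) (r : ℚ) (hr_pos : 0 < r) (hr : ∃ R : ℕ, r = R / 2) (lA lB : ℕ)
    (A : Set (ZMod N) → StarSubalgebra ℂ Ω)
    (hA : QPartition.IsStronglyConnectedPartition A)
    (hlA : QPartition.CorrelationLengthLE N (QPartition.pos N 0) A lA)
    -- `Int.fract r` is `0` for integral `r` and `1/2` for half-integral `r`
    (B : Set (ZMod N) → StarSubalgebra ℂ Ω)
    (hB : QPartition.IsStronglyConnectedPartition B)
    (hlB : QPartition.CorrelationLengthLE N (QPartition.pos N (Int.fract r)) B lB)
    (hAB : ∀ S : Set (ZMod N),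
      A S ≤ B (QPartition.thicken N (QPartition.pos N 0) (QPartition.pos N (Int.fract r)) r S))
    (hN : 4 * r + 2 * (lA + lB) + 1 ≤ N) :
    ∃ A' : Set (ZMod (2 * N)) → StarSubalgebra ℂ Ω,
      QPartition.IsStronglyConnectedPartition A' ∧
      QPartition.CorrelationLengthLE N (QPartition.finePos N) A' (lA + 1 / 2) ∧
      (∀ S : Set (ZMod N),
        A S = A' (QPartition.thicken N (QPartition.pos N 0) (QPartition.finePos N) (1 / 4) S)) ∧
      (∀ S : Set (ZMod (2 * N)),
        A' S ≤ B (QPartition.thicken N (QPartition.finePos N) (QPartition.pos N (Int.fract r))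
          (r - 1 / 4) S)) := by
  obtain ⟨R, rfl⟩ := hr
  have hR : 1 ≤ R := by
    rcases Nat.eq_zero_or_pos R with rfl | h
    · simp at hr_pos
    · exact h
  have hN' : 2 * R + 2 * lA + 2 * lB + 1 ≤ N := by
    have : (2 * R + 2 * lA + 2 * lB + 1 : ℚ) ≤ N := by linarith
    exact_mod_cast this
  -- The zero algebra also satisfies the hypothesis on the centre, but has no atoms; there all
  -- subalgebras coincide.
  rcases subsingleton_or_nontrivial Ω with hs | hs
  · have hs' : ∀ F G : StarSubalgebra ℂ Ω, F = G := fun F G => by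
      ext x
      rw [Subsingleton.elim x 0]
      exact ⟨fun _ => zero_mem _, fun _ => zero_mem _⟩
    exact ⟨fun _ => ⊥, QPartition.isStronglyConnectedPartition_of_subsingleton _,
      fun _ _ _ _ _ _ => Or.inl (Subsingleton.elim _ _), fun _ => hs' _ _, fun _ => (hs' _ _).le⟩
  · have : Fact (QPartition.IsFactor Ω) := ⟨hΩ⟩
    rw [QPartition.fract_half] at *
    exact QPartition.exists_fineGraining hA hB hlA hlB rfl hR hN' hAB
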